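/- Let $k$ be an algebraically closed field of characteristic $p>0$ and let $X$ be a smooth variety over $k$ (a smooth separated scheme of finite type over $k$; it need not be irreducible). Let $\mathcal T_X$ be the tangent sheaf, i.e. the sheaf of $k$-linear derivations of $\mathcal O_X$, and let $\mathcal D_X=U_{\mathcal O_X}(\mathcal T_X)$ be the sheaf of crystalline differential operators: the sheaf of rings generated by $\mathcal O_X$ and $\mathcal T_X$ subject to $f\cdot\partial=f\partial$, $\partial\cdot f-f\cdot\partial=\partial(f)$ and $\partial'\cdot\partial''-\partial''\cdot\partial'=[\partial',\partial'']$. Let $\pi:T^*X=\mathrm{Spec}_X(\mathrm{Sym}_{\mathcal O_X}\mathcal T_X)\to X$ be the cotangent bundle, and for a $k$-scheme $Y$ let $Y^{(1)}$ be its Frobenius twist: the same scheme, on whose functions $a\in k$ acts as $a^{1/p}$ does on those of $Y$. For a vector field $\partial$ let $\partial^{[p]}$ be the vector field $f\mapsto\partial^p(f)$. Then there is a $k$-linear homomorphism of sheaves of rings $\theta:\pi_*\mathcal O_{T^*X^{(1)}}\to\mathcal D_X$ on $X$ that sends a function $f\in\mathcal O_{X^{(1)}}$ to $f^p$ and a vector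 field $\partial$ (a fibrewise linear function on $T^*X^{(1)}$) to $\partial^p-\partial^{[p]}$. It is an isomorphism onto the center of $\mathcal D_X$, and through it $\mathcal D_X$ is an Azumaya algebra over $T^*X^{(1)}$: there are an Azumaya algebra $\mathcal A$ on the scheme $T^*X^{(1)}$, i.e. a quasi-coherent sheaf of $\mathcal O_{T^*X^{(1)}}$-algebras which over the affine open sets $W$ of a suitable cover is given by an Azumaya algebra over the ring of functions of $W$, and an isomorphism $\pi_*\mathcal A\cong\mathcal D_X$ of sheaves of rings that is compatible with $\theta$. If $\dim X>0$, this Azumaya algebra is non-trivial: $\mathcal A$ is not isomorphic, as a sheaf of $\mathcal O_{T^*X^{(1)}}$-algebras, to $\mathcal End(V)$ for any vector bundle $V$ on $T^*X^{(1)}$. -/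

import Mathlib

universe u

open CategoryTheory AlgebraicGeometry TopologicalSpace Opposite

noncomputable section

namespace CrystallineDiff

/-! ### Enveloping algebra of a Lie algebroid (at the level of rings) -/

section Envelope

variable (A L : Type u) [CommRing A] [LieRing L] [Module A L] [LieRingModule L A]

/-- The defining relations of the enveloping algebra of a Lie algebroid `L` over `A`:
`A` is a subring of coefficients, `f · ∂ = f∂`, `∂ · f - f · ∂ = ∂(f)` and
`∂' · ∂'' - ∂'' · ∂' = [∂', ∂'']`. -/
inductive EnvelopeRel : FreeAlgebra ℤ (A ⊕ L) → FreeAlgebra ℤ (A ⊕ L) → Prop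
  | one : EnvelopeRel (FreeAlgebra.ι ℤ (Sum.inl 1)) 1
  | add_fun (a b : A) : EnvelopeRel (FreeAlgebra.ι ℤ (Sum.inl (a + b)))
      (FreeAlgebra.ι ℤ (Sum.inl a) + FreeAlgebra.ι ℤ (Sum.inl b))
  | mul_fun (a b : A) : EnvelopeRel (FreeAlgebra.ι ℤ (Sum.inl (a * b)))
      (FreeAlgebra.ι ℤ (Sum.inl a) * FreeAlgebra.ι ℤ (Sum.inl b))
  | add_vec (x y : L) : EnvelopeRel (FreeAlgebra.ι ℤ (Sum.inr (x + y)))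
      (FreeAlgebra.ι ℤ (Sum.inr x) + FreeAlgebra.ι ℤ (Sum.inr y))
  | smul (a : A) (x : L) : EnvelopeRel (FreeAlgebra.ι ℤ (Sum.inl a) * FreeAlgebra.ι ℤ (Sum.inr x))
      (FreeAlgebra.ι ℤ (Sum.inr (a • x)))
  | comm (a : A) (x : L) : EnvelopeRel
      (FreeAlgebra.ι ℤ (Sum.inr x) * FreeAlgebra.ι ℤ (Sum.inl a) -
        FreeAlgebra.ι ℤ (Sum.inl a) * FreeAlgebra.ι ℤ (Sum.inr x))
      (FreeAlgebra.ι ℤ (Sum.inl ⁅x, a⁆))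
  | lie (x y : L) : EnvelopeRel
      (FreeAlgebra.ι ℤ (Sum.inr x) * FreeAlgebra.ι ℤ (Sum.inr y) -
        FreeAlgebra.ι ℤ (Sum.inr y) * FreeAlgebra.ι ℤ (Sum.inr x))
      (FreeAlgebra.ι ℤ (Sum.inr ⁅x, y⁆))

/-- The enveloping algebra `U_A(L)` of a Lie algebroid. -/
abbrev Envelope : Type u := RingQuot (EnvelopeRel A L)

namespace Envelope

/-- The map of the coefficients to the enveloping algebra. -/
def ofFun : A →+* Envelope A L where
  toFun a := RingQuot.mkRingHom (EnvelopeRel A L) (FreeAlgebra.ι ℤ (Sum.inl a))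
  map_one' := (RingQuot.mkRingHom_rel EnvelopeRel.one).trans (map_one _)
  map_mul' a b := (RingQuot.mkRingHom_rel (EnvelopeRel.mul_fun a b)).trans (map_mul _ _ _)
  map_zero' := by
    have h := (RingQuot.mkRingHom_rel (EnvelopeRel.add_fun (A := A) (L := L) 0 0)).trans
      (map_add _ _ _)
    simpa using h
  map_add' a b := (RingQuot.mkRingHom_rel (EnvelopeRel.add_fun a b)).trans (map_add _ _ _)

/-- The map of the Lie algebroid to its enveloping algebra. -/
def ofVec : L →+ Envelope A L :=
  AddMonoidHom.mk' (fun x ↦ RingQuot.mkRingHom (EnvelopeRel A L) (FreeAlgebra.ι ℤ (Sum.inr x)))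
    fun x y ↦ (RingQuot.mkRingHom_rel (EnvelopeRel.add_vec x y)).trans (map_add _ _ _)

lemma ofFun_mul_ofVec (a : A) (x : L) : ofFun A L a * ofVec A L x = ofVec A L (a • x) :=
  (map_mul _ _ _).symm.trans (RingQuot.mkRingHom_rel (EnvelopeRel.smul a x))

lemma ofVec_comm_ofFun (a : A) (x : L) :
    ofVec A L x * ofFun A L a - ofFun A L a * ofVec A L x = ofFun A L ⁅x, a⁆ := by
  have h := RingQuot.mkRingHom_rel (EnvelopeRel.comm a x)
  rw [map_sub, map_mul, map_mul] at h
  exact h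

lemma ofVec_comm_ofVec (x y : L) :
    ofVec A L x * ofVec A L y - ofVec A L y * ofVec A L x = ofVec A L ⁅x, y⁆ := by
  have h := RingQuot.mkRingHom_rel (EnvelopeRel.lie (A := A) x y)
  rw [map_sub, map_mul, map_mul] at h
  exact h

variable {A L}

/-- The universal property of the enveloping algebra. -/
def lift {R : Type u} [Ring R] (φ : A →+* R) (ψ : L →+ R)
    (hsmul : ∀ a x, φ a * ψ x = ψ (a • x))
    (hcomm : ∀ a x, ψ x * φ a - φ a * ψ x = φ ⁅x, a⁆)
    (hlie : ∀ x y, ψ x * ψ y - ψ y * ψ x = ψ ⁅x, y⁆) : Envelope A L →+* R :=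
  RingQuot.lift ⟨(FreeAlgebra.lift ℤ (Sum.elim φ ψ) : FreeAlgebra ℤ (A ⊕ L) →ₐ[ℤ] R).toRingHom, by
    intro _ _ h
    induction h with
    | one => simp
    | add_fun a b => simp
    | mul_fun a b => simp
    | add_vec x y => simp
    | smul a x => simpa using hsmul a x
    | comm a x => simpa using hcomm a x
    | lie x y => simpa using hlie x y⟩

section

variable {R : Type u} [Ring R] (φ : A →+* R) (ψ : L →+ R)
    (hsmul : ∀ a x, φ a * ψ x = ψ (a • x))
    (hcomm : ∀ a x, ψ x * φ a - φ a * ψ x = φ ⁅x, a⁆)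
    (hlie : ∀ x y, ψ x * ψ y - ψ y * ψ x = ψ ⁅x, y⁆)

@[simp] lemma lift_ofFun (a : A) : lift φ ψ hsmul hcomm hlie (ofFun A L a) = φ a :=
  (RingQuot.lift_mkRingHom_apply _ _ _).trans (FreeAlgebra.lift_ι_apply _ _)

@[simp] lemma lift_ofVec (x : L) : lift φ ψ hsmul hcomm hlie (ofVec A L x) = ψ x :=
  (RingQuot.lift_mkRingHom_apply _ _ _).trans (FreeAlgebra.lift_ι_apply _ _)

end

lemma hom_ext {R : Type u} [Ring R] {f g : Envelope A L →+* R}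
    (h₁ : ∀ a, f (ofFun A L a) = g (ofFun A L a)) (h₂ : ∀ x, f (ofVec A L x) = g (ofVec A L x)) :
    f = g := by
  refine RingQuot.ringQuot_ext f g ?_
  have key : ∀ t : FreeAlgebra ℤ (A ⊕ L), f (RingQuot.mkRingHom (EnvelopeRel A L) t) =
      g (RingQuot.mkRingHom (EnvelopeRel A L) t) := by
    intro t
    induction t with
    | grade0 r =>
      change f (RingQuot.mkRingHom _ (algebraMap ℤ _ r)) = g (RingQuot.mkRingHom _ (algebraMap ℤ _ r))
      simp
    | grade1 x =>
      cases x with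
      | inl a => exact h₁ a
      | inr x => exact h₂ x
    | mul a b ha hb => rw [map_mul, map_mul, map_mul, ha, hb]
    | add a b ha hb => rw [map_add, map_add, map_add, ha, hb]
  exact RingHom.ext key

/-- Functoriality of the enveloping algebra in morphisms of Lie algebroids. -/
def map {A' L' : Type u} [CommRing A'] [LieRing L'] [Module A' L'] [LieRingModule L' A']
    (φ : A →+* A') (ψ : L →+ L') (hsmul : ∀ a x, ψ (a • x) = φ a • ψ x)
    (hact : ∀ a x, φ ⁅x, a⁆ = ⁅ψ x, φ a⁆) (hlie : ∀ x y, ψ ⁅x, y⁆ = ⁅ψ x, ψ y⁆) :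
    Envelope A L →+* Envelope A' L' :=
  lift ((ofFun A' L').comp φ) ((ofVec A' L').comp ψ)
    (fun a x ↦ by simp [ofFun_mul_ofVec, hsmul])
    (fun a x ↦ by simp [ofVec_comm_ofFun, hact])
    (fun x y ↦ by simp [ofVec_comm_ofVec, hlie])

end Envelope

end Envelope

/-! ### Vector fields -/

/-- The Leibniz rule for iterates of a derivation. -/
lemma iterate_leibniz {R : Type u} [CommRing R] (d : R →+ R)
    (h : ∀ a b, d (a * b) = a * d b + b * d a) (n : ℕ) (a b : R) :
    d^[n] (a * b) = ∑ ij ∈ Finset.HasAntidiagonal.antidiagonal n, n.choose ij.1 • (d^[ij.1] a * d^[ij.2] b) := by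
  induction n with
  | zero => simp
  | succ n ih =>
    rw [Finset.sum_antidiagonal_choose_succ_nsmul (M := R) (fun i j ↦ d^[i] a * d^[j] b) n]
    simp only [Function.iterate_succ_apply', ih, map_sum, map_nsmul, h, smul_add,
      Finset.sum_add_distrib]
    congr 1
    refine Finset.sum_congr rfl fun ij hij ↦ ?_
    rw [n.choose_symm_of_eq_add (Finset.HasAntidiagonal.mem_antidiagonal.1 hij).symm, mul_comm]

/-- The Leibniz rule for the `p`-th iterate of a derivation in characteristic `p`. -/
lemma iterate_prime_leibniz {R : Type u} [CommRing R] (d : R →+ R)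
    (h : ∀ a b, d (a * b) = a * d b + b * d a) (p : ℕ) (hp : p.Prime) (h0 : (p : R) = 0)
    (a b : R) : d^[p] (a * b) = a * d^[p] b + b * d^[p] a := by
  rw [iterate_leibniz d h, Finset.Nat.sum_antidiagonal_eq_sum_range_succ_mk]
  obtain ⟨m, rfl⟩ := Nat.exists_eq_succ_of_ne_zero hp.ne_zero
  rw [Finset.sum_range_succ, Finset.sum_range_succ', Finset.sum_eq_zero]
  · simp [mul_comm]
  · intro i hi
    rw [Finset.mem_range] at hi
    obtain ⟨c, hc⟩ := hp.dvd_choose_self (Nat.succ_ne_zero i) (Nat.succ_lt_succ hi)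
    rw [nsmul_eq_mul, hc, Nat.cast_mul, h0, zero_mul, zero_mul]

section VectorField

variable {k : Type u} [Field k] {X : Scheme.{u}} (s : X ⟶ Spec (.of k))

/-- The constant functions on an open subset of a `k`-scheme. -/
def constFun (V : X.Opens) : k →+* Γ(X, V) :=
  (s.appLE ⊤ V (show V ≤ s ⁻¹ᵁ ⊤ from le_top)).hom.comp (Scheme.ΓSpecIso (.of k)).inv.hom

lemma constFun_res {V W : X.Opens} (h : W ≤ V) (c : k) :
    X.presheaf.map (homOfLE h).op (constFun s V c) = constFun s W c := by
  have e := Scheme.Hom.appLE_map s (U := ⊤) (V := V) (show V ≤ s ⁻¹ᵁ ⊤ from le_top) (homOfLE h).op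
  exact ConcreteCategory.congr_hom e ((Scheme.ΓSpecIso (.of k)).inv.hom c)

/-- A vector field on an open subset `U` of the `k`-scheme `X`: a `k`-linear derivation of the
sheaf of rings `𝒪_U` to itself. -/
@[ext]
structure VectorField (U : X.Opens) : Type u where
  /-- the action on the functions on `V ⊆ U` -/
  app : ∀ V : X.Opens, V ≤ U → Γ(X, V) →+ Γ(X, V)
  leibniz : ∀ V hV f g, app V hV (f * g) = f * app V hV g + g * app V hV f
  app_const : ∀ V hV c, app V hV (constFun s V c) = 0
  res : ∀ V hV W (h : W ≤ V) f, X.presheaf.map (homOfLE h).op (app V hV f) =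
    app W (h.trans hV) (X.presheaf.map (homOfLE h).op f)

namespace VectorField

variable {s} {U : X.Opens}

lemma app_one (D : VectorField s U) (V : X.Opens) (hV : V ≤ U) : D.app V hV 1 = 0 := by
  simpa using D.app_const V hV 1

instance : Zero (VectorField s U) where
  zero := ⟨fun _ _ ↦ 0, by simp, by simp, by simp⟩

instance : Add (VectorField s U) where
  add D E := ⟨fun V h ↦ D.app V h + E.app V h,
    fun V h f g ↦ by simp only [AddMonoidHom.add_apply, leibniz]; ring,
    fun V h c ↦ by simp [app_const], fun V hV W h f ↦ by simp [res]⟩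

instance : Neg (VectorField s U) where
  neg D := ⟨fun V h ↦ -D.app V h,
    fun V h f g ↦ by simp only [AddMonoidHom.neg_apply, leibniz]; ring,
    fun V h c ↦ by simp [app_const], fun V hV W h f ↦ by simp [res]⟩

@[simp] lemma zero_app (V : X.Opens) (hV : V ≤ U) (f : Γ(X, V)) :
    (0 : VectorField s U).app V hV f = 0 := rfl

@[simp] lemma add_app (D E : VectorField s U) (V : X.Opens) (hV : V ≤ U) (f : Γ(X, V)) :
    (D + E).app V hV f = D.app V hV f + E.app V hV f := rfl

@[simp] lemma neg_app (D : VectorField s U) (V : X.Opens) (hV : V ≤ U) (f : Γ(X, V)) :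
    (-D).app V hV f = -D.app V hV f := rfl

lemma ext_apply {D E : VectorField s U} (h : ∀ V hV f, D.app V hV f = E.app V hV f) : D = E := by
  ext V hV f
  exact h V hV f

instance : AddCommGroup (VectorField s U) where
  add_assoc D E F := ext_apply fun V hV f ↦ by simp [add_assoc]
  zero_add D := ext_apply fun V hV f ↦ by simp
  add_zero D := ext_apply fun V hV f ↦ by simp
  add_comm D E := ext_apply fun V hV f ↦ by simp [add_comm]
  neg_add_cancel D := ext_apply fun V hV f ↦ by simp
  nsmul := nsmulRec
  zsmul := zsmulRec

@[simp] lemma sub_app (D E : VectorField s U) (V : X.Opens) (hV : V ≤ U) (f : Γ(X, V)) :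
    (D - E).app V hV f = D.app V hV f - E.app V hV f := by
  rw [sub_eq_add_neg, add_app, neg_app, sub_eq_add_neg]

/-- Multiplication of vector fields by functions. -/
instance : Module Γ(X, U) (VectorField s U) where
  smul a D := ⟨fun V h ↦ (AddMonoidHom.mulLeft (X.presheaf.map (homOfLE h).op a)).comp (D.app V h),
    fun V h f g ↦ by simp only [AddMonoidHom.comp_apply, AddMonoidHom.coe_mulLeft, leibniz]; ring,
    fun V h c ↦ by simp [app_const], fun V hV W h f ↦ by
      simp only [AddMonoidHom.comp_apply, AddMonoidHom.coe_mulLeft, map_mul, res]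
      rw [← CommRingCat.comp_apply, ← Functor.map_comp]
      rfl⟩
  one_smul D := ext_apply fun V hV f ↦ by
    change X.presheaf.map (homOfLE hV).op 1 * _ = _
    rw [map_one, one_mul]
  mul_smul a b D := ext_apply fun V hV f ↦ by
    change X.presheaf.map (homOfLE hV).op (a * b) * _ = _ * (_ * _)
    rw [map_mul, mul_assoc]
  smul_zero a := ext_apply fun V hV f ↦ mul_zero _
  smul_add a D E := ext_apply fun V hV f ↦ mul_add _ _ _
  add_smul a b D := ext_apply fun V hV f ↦ by
    change X.presheaf.map (homOfLE hV).op (a + b) * _ = _ * _ + _ * _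
    rw [map_add, add_mul]
  zero_smul D := ext_apply fun V hV f ↦ by
    change X.presheaf.map (homOfLE hV).op 0 * _ = 0
    rw [map_zero, zero_mul]

@[simp] lemma smul_app (a : Γ(X, U)) (D : VectorField s U) (V : X.Opens) (hV : V ≤ U)
    (f : Γ(X, V)) : (a • D).app V hV f = X.presheaf.map (homOfLE hV).op a * D.app V hV f := rfl

/-- The commutator of vector fields. -/
instance : Bracket (VectorField s U) (VectorField s U) where
  bracket D E := ⟨fun V h ↦ (D.app V h).comp (E.app V h) - (E.app V h).comp (D.app V h),
    fun V h f g ↦ by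
      simp only [AddMonoidHom.sub_apply, AddMonoidHom.comp_apply, leibniz, map_add]; ring,
    fun V h c ↦ by simp [app_const], fun V hV W h f ↦ by simp [res]⟩

@[simp] lemma lie_app (D E : VectorField s U) (V : X.Opens) (hV : V ≤ U) (f : Γ(X, V)) :
    ⁅D, E⁆.app V hV f = D.app V hV (E.app V hV f) - E.app V hV (D.app V hV f) := rfl

instance : LieRing (VectorField s U) where
  add_lie D E F := ext_apply fun V hV f ↦ by simp; abel
  lie_add D E F := ext_apply fun V hV f ↦ by simp; abel
  lie_self D := ext_apply fun V hV f ↦ by simp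
  leibniz_lie D E F := ext_apply fun V hV f ↦ by simp; abel

/-- The action of vector fields on functions. -/
instance : LieRingModule (VectorField s U) Γ(X, U) where
  bracket D f := D.app U le_rfl f
  add_lie D E f := rfl
  lie_add D f g := map_add _ _ _
  leibniz_lie D E f := by
    change D.app U le_rfl (E.app U le_rfl f) = ⁅D, E⁆.app U le_rfl f + E.app U le_rfl _
    simp

lemma lie_fun (D : VectorField s U) (f : Γ(X, U)) : ⁅D, f⁆ = D.app U le_rfl f := rfl

/-- Restriction of vector fields to a smaller open subset. -/
def restrict {V : X.Opens} (h : V ≤ U) : VectorField s U →+ VectorField s V where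
  toFun D := ⟨fun W hW ↦ D.app W (hW.trans h), fun W _ ↦ D.leibniz W _,
    fun W _ ↦ D.app_const W _, fun W _ ↦ D.res W _⟩
  map_zero' := rfl
  map_add' _ _ := rfl

@[simp] lemma restrict_app {V : X.Opens} (h : V ≤ U) (D : VectorField s U) (W : X.Opens)
    (hW : W ≤ V) (f : Γ(X, W)) : (restrict h D).app W hW f = D.app W (hW.trans h) f := rfl

lemma restrict_smul {V : X.Opens} (h : V ≤ U) (a : Γ(X, U)) (D : VectorField s U) :
    restrict h (a • D) = X.presheaf.map (homOfLE h).op a • restrict h D :=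
  ext_apply fun W hW f ↦ by
    simp only [restrict_app, smul_app]
    rw [← CommRingCat.comp_apply, ← Functor.map_comp]
    rfl

/-- In characteristic `p`, the `p`-th iterate `∂^{[p]}` of a vector field is a vector field. -/
def pPow (p : ℕ) [Fact p.Prime] [CharP k p] (D : VectorField s U) : VectorField s U where
  app V h := AddMonoidHom.mk' (D.app V h)^[p] (iterate_map_add (D.app V h) p)
  leibniz V h f g := iterate_prime_leibniz (D.app V h) (D.leibniz V h) p Fact.out
    (by rw [← map_natCast (constFun s V), CharP.cast_eq_zero, map_zero]) f g
  app_const V h c := by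
    obtain ⟨n, hn⟩ := Nat.exists_eq_succ_of_ne_zero (Fact.out : p.Prime).ne_zero
    simp [hn, app_const, iterate_map_zero]
  res V hV W h f :=
    Function.Semiconj.iterate_right (f := X.presheaf.map (homOfLE h).op)
      (fun f ↦ D.res V hV W h f) p f

end VectorField

end VectorField

/-! ### The sheaf of crystalline differential operators -/

section Sheaf

variable {k : Type u} [Field k] {X : Scheme.{u}} (s : X ⟶ Spec (.of k))

/-- The presheaf of enveloping algebras `U ↦ U_{𝒪(U)}(𝒯(U))` of the tangent Lie algebroid. -/
def diffOpPresheaf : TopCat.Presheaf RingCat.{u} X where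
  obj U := .of (Envelope Γ(X, U.unop) (VectorField s U.unop))
  map {U V} i := RingCat.ofHom <| Envelope.map (X.presheaf.map i).hom
    (VectorField.restrict i.unop.le) (fun a D ↦ VectorField.restrict_smul _ a D)
    (fun a D ↦ D.res _ _ _ i.unop.le a) (fun _ _ ↦ rfl)
  map_id U := by
    ext1
    apply Envelope.hom_ext
    · intro a; simp [Envelope.map]
    · intro a; simp [Envelope.map]; rfl
  map_comp i j := by
    ext1
    apply Envelope.hom_ext
    · intro a; simp [Envelope.map]
    · intro a; simp [Envelope.map]; rfl

/-- The sheaf `𝒟_X` of crystalline differential operators: the enveloping algebra of the tangent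
Lie algebroid, i.e. the sheaf associated with the presheaf of enveloping algebras. -/
def diffOp : TopCat.Sheaf RingCat.{u} X :=
  (presheafToSheaf (Opens.grothendieckTopology X) RingCat.{u}).obj (diffOpPresheaf s)

/-- The map of the presheaf of enveloping algebras to `𝒟_X`. -/
def toDiffOp : diffOpPresheaf s ⟶ (diffOp s).presheaf :=
  toSheafify (Opens.grothendieckTopology X) (diffOpPresheaf s)

/-- A function as a differential operator. -/
def funOp (U : X.Opens) (f : Γ(X, U)) : (diffOp s).presheaf.obj (op U) :=
  (toDiffOp s).app (op U) (Envelope.ofFun Γ(X, U) (VectorField s U) f)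

/-- A vector field as a differential operator. -/
def vecOp (U : X.Opens) (D : VectorField s U) : (diffOp s).presheaf.obj (op U) :=
  (toDiffOp s).app (op U) (Envelope.ofVec Γ(X, U) (VectorField s U) D)

end Sheaf
/-! ### Localization of derivations -/

section DerivationLocalization

variable {k A B : Type u} [CommRing k] [CommRing A] [CommRing B] [Algebra k A] [Algebra k B]
  [Algebra A B] [IsScalarTower k A B]

lemma exists_derivation_extension (M : Submonoid A) [IsLocalization M B] (d : Derivation k A A) :
    ∃ d' : Derivation k B B, ∀ a, d' (algebraMap A B a) = algebraMap A B (d a) := by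
  have : Algebra.FormallyEtale A B := Algebra.FormallyEtale.of_isLocalization M
  let l : Ω[A⁄k] →ₗ[A] B := (Algebra.linearMap A B).comp d.liftKaehlerDifferential
  have hb := KaehlerDifferential.isBaseChange_of_formallyEtale k A B
  let l' : Ω[B⁄k] →ₗ[B] B := hb.lift l
  refine ⟨l'.compDer (KaehlerDifferential.D k B), fun a ↦ ?_⟩
  have := hb.lift_eq l (KaehlerDifferential.D k A a)
  simpa [l, l'] using this

lemma exists_derivation_lift [Module.FinitePresentation A Ω[A⁄k]] (M : Submonoid A)
    [IsLocalization M B] (E : Derivation k B B) :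
    ∃ m ∈ M, ∃ d : Derivation k A A,
      ∀ a, algebraMap A B (d a) = algebraMap A B m * E (algebraMap A B a) := by
  let r := KaehlerDifferential.map k k A B
  have h1 : IsLocalizedModule M r := KaehlerDifferential.isLocalizedModule_map k A B M
  let e : Ω[B⁄k] →ₗ[A] B := E.liftKaehlerDifferential.restrictScalars A
  obtain ⟨⟨l, m⟩, hl⟩ := IsLocalizedModule.surj M (IsLocalizedModule.map M r
    (Algebra.linearMap A B)) e
  refine ⟨m, m.2, l.compDer (KaehlerDifferential.D k A), fun a ↦ ?_⟩
  have h2 := congr($hl (r (KaehlerDifferential.D k A a)))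
  rw [IsLocalizedModule.map_apply] at h2
  simp only [LinearMap.smul_apply, e, r, LinearMap.restrictScalars_apply,
    KaehlerDifferential.map_D, Derivation.liftKaehlerDifferential_comp_D] at h2
  rw [← Algebra.smul_def]
  exact h2.symm

end DerivationLocalization

lemma exists_smul_derivation_eq_zero {k A B : Type u} [CommRing k] [CommRing A] [CommRing B]
    [Algebra k A] [Algebra A B] [Module.Finite A Ω[A⁄k]] (M : Submonoid A)
    [IsLocalization M B] (d : Derivation k A A) (h : ∀ a, algebraMap A B (d a) = 0) :
    ∃ m ∈ M, ∀ a, m * d a = 0 := by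
  obtain ⟨S, hS⟩ := Module.Finite.fg_top (R := A) (M := Ω[A⁄k])
  have h1 : ∀ x : Ω[A⁄k], algebraMap A B (d.liftKaehlerDifferential x) = 0 := by
    intro x
    have : x ∈ Submodule.span A (Set.range (KaehlerDifferential.D k A)) := by
      rw [KaehlerDifferential.span_range_derivation]; trivial
    induction this using Submodule.span_induction with
    | mem x hx => obtain ⟨a, rfl⟩ := hx; simpa using h a
    | zero => simp
    | add x y _ _ hx hy => simp [hx, hy]
    | smul a x _ hx => simp [hx]
  have h2 : ∀ x : Ω[A⁄k], ∃ m : M, m * d.liftKaehlerDifferential x = 0 := fun x ↦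
    (IsLocalization.map_eq_zero_iff M B _).1 (h1 x)
  choose m hm using h2
  refine ⟨∏ x ∈ S, (m x : A), Submonoid.prod_mem _ fun x _ ↦ (m x).2, fun a ↦ ?_⟩
  have h3 : ∀ x ∈ Submodule.span A (S : Set Ω[A⁄k]),
      (∏ x ∈ S, (m x : A)) * d.liftKaehlerDifferential x = 0 := by
    intro x hx
    induction hx using Submodule.span_induction with
    | mem x hx =>
      classical
      rw [← Finset.prod_erase_mul _ _ hx, mul_assoc, hm, mul_zero]
    | zero => simp
    | add x y _ _ hx hy => simp [mul_add, hx, hy]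
    | smul a x _ hx => rw [map_smul, smul_eq_mul, mul_left_comm, hx, mul_zero]
  simpa using h3 (KaehlerDifferential.D k A a) (hS ▸ trivial)
/-! ### Symmetric algebras -/

section SymmetricAlgebra

open TensorProduct

/-- Functoriality of the symmetric algebra in semilinear maps. -/
def symMap {A B L L' : Type u} [CommRing A] [CommRing B] [AddCommGroup L] [AddCommGroup L']
    [Module A L] [Module B L'] (φ : A →+* B) (ψ : L →+ L') (h : ∀ a x, ψ (a • x) = φ a • ψ x) :
    SymmetricAlgebra A L →+* SymmetricAlgebra B L' :=
  letI : Algebra A (SymmetricAlgebra B L') :=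
    ((algebraMap B (SymmetricAlgebra B L')).comp φ).toAlgebra
  (SymmetricAlgebra.lift (R := A) (A := SymmetricAlgebra B L')
    { toFun := fun x ↦ SymmetricAlgebra.ι B L' (ψ x)
      map_add' := fun x y ↦ by simp
      map_smul' := fun a x ↦ by
        rw [h, map_smul, Algebra.smul_def, RingHom.id_apply, Algebra.smul_def]
        rfl }).toRingHom

section

variable {A B L L' : Type u} [CommRing A] [CommRing B] [AddCommGroup L] [AddCommGroup L']
    [Module A L] [Module B L'] (φ : A →+* B) (ψ : L →+ L') (h : ∀ a x, ψ (a • x) = φ a • ψ x)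

@[simp] lemma symMap_algebraMap (a : A) :
    symMap φ ψ h (algebraMap A _ a) = algebraMap B _ (φ a) := by
  let _ : Algebra A (SymmetricAlgebra B L') :=
    ((algebraMap B (SymmetricAlgebra B L')).comp φ).toAlgebra
  exact AlgHom.commutes (SymmetricAlgebra.lift (R := A) (A := SymmetricAlgebra B L') _) a

@[simp] lemma symMap_ι (x : L) :
    symMap φ ψ h (SymmetricAlgebra.ι A L x) = SymmetricAlgebra.ι B L' (ψ x) := by
  let _ : Algebra A (SymmetricAlgebra B L') :=
    ((algebraMap B (SymmetricAlgebra B L')).comp φ).toAlgebra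
  exact SymmetricAlgebra.lift_ι_apply (R := A) (A := SymmetricAlgebra B L') _ x

lemma sym_hom_ext {R : Type u} [CommRing R] {f g : SymmetricAlgebra A L →+* R}
    (h₁ : ∀ a, f (algebraMap A _ a) = g (algebraMap A _ a))
    (h₂ : ∀ x, f (SymmetricAlgebra.ι A L x) = g (SymmetricAlgebra.ι A L x)) : f = g := by
  refine RingHom.ext fun t ↦ ?_
  induction t using SymmetricAlgebra.induction with
  | algebraMap a => exact h₁ a
  | ι x => exact h₂ x
  | mul a b ha hb => rw [map_mul, map_mul, ha, hb]
  | add a b ha hb => rw [map_add, map_add, ha, hb]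

end

/-- The symmetric algebra commutes with localization. -/
lemma symmetricAlgebra_isLocalization {A B L L' S S' : Type u} [CommRing A] [CommRing B]
    [AddCommGroup L] [AddCommGroup L'] [Module A L] [Module B L'] [CommRing S] [CommRing S']
    [Algebra A B] [Module A L'] [IsScalarTower A B L'] [Algebra A S] [Algebra B S'] [Algebra A S']
    [IsScalarTower A B S'] [Algebra S S'] [IsScalarTower A S S'] (M : Submonoid A)
    [IsLocalization M B] (r : L →ₗ[A] L') (hr : IsLocalizedModule M r)
    {i : L →ₗ[A] S} (hi : IsSymmetricAlgebra i) {i' : L' →ₗ[B] S'} (hi' : IsSymmetricAlgebra i')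
    (hc : ∀ x, algebraMap S S' (i x) = i' (r x)) :
    IsLocalization (Algebra.algebraMapSubmonoid S M) S' := by
  rw [Algebra.isLocalization_iff_isPushout M B]
  have hb : IsBaseChange B r := (isLocalizedModule_iff_isBaseChange M B r).1 hr
  let g : L' →ₗ[B] B ⊗[A] S := hb.lift ((Algebra.TensorProduct.includeRight :
    S →ₐ[A] B ⊗[A] S).toLinearMap.comp i)
  let G : S' →ₐ[B] B ⊗[A] S := hi'.lift g
  let H : B ⊗[A] S →ₐ[B] S' := Algebra.TensorProduct.lift (Algebra.ofId B S')
    (IsScalarTower.toAlgHom A S S') (fun _ _ ↦ mul_comm _ _)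
  have hH : ∀ b t, H (b ⊗ₜ t) = algebraMap B S' b * algebraMap S S' t := fun b t ↦
    Algebra.TensorProduct.lift_tmul _ _ _ b t
  have hG : ∀ x, G (i' (r x)) = 1 ⊗ₜ i x := fun x ↦ by
    simp only [G, IsSymmetricAlgebra.lift_eq, g, hb.lift_eq]
    simp
  have hGS : ∀ t : S, G (algebraMap S S' t) = 1 ⊗ₜ t := by
    intro t
    have : (G.restrictScalars A).comp (IsScalarTower.toAlgHom A S S') =
        (Algebra.TensorProduct.includeRight : S →ₐ[A] B ⊗[A] S) := by
      apply hi.algHom_ext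
      ext x
      simp [hc, hG]
    exact congr($this t)
  have hHG : H.comp G = AlgHom.id B S' := by
    apply hi'.algHom_ext
    apply hb.algHom_ext
    intro x
    simp [hG, hH, hc]
  have hGH : G.comp H = AlgHom.id B _ := by
    apply Algebra.TensorProduct.ext
    · ext
    · ext t
      simp [hH, hGS]
  have hbij : Function.Bijective H := by
    refine ⟨fun x y hxy ↦ ?_, fun y ↦ ⟨G y, congr($hHG y)⟩⟩
    have h1 := congr($hGH x)
    have h2 := congr($hGH y)
    simp only [AlgHom.comp_apply, AlgHom.id_apply] at h1 h2
    rw [← h1, ← h2, hxy]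
  apply Algebra.IsPushout.symm
  refine ⟨?_⟩
  change Function.Bijective _
  convert hbij using 1
  ext x
  induction x with
  | zero => simp
  | add x y hx hy => simp only [map_add, hx, hy]
  | tmul b t => simp [hH, Algebra.smul_def]

end SymmetricAlgebra
/-! ### Vector fields on affine open subsets -/

section AffineVectorField

lemma eq_of_leibniz_of_isLocalization {A B R : Type u} [CommRing A] [CommRing B] [CommRing R]
    [Algebra A B] (M : Submonoid A) [IsLocalization M B] (φ : B →+* R) (δ ε : B →+ R)
    (hδ : ∀ x y, δ (x * y) = φ x * δ y + φ y * δ x)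
    (hε : ∀ x y, ε (x * y) = φ x * ε y + φ y * ε x)
    (h : ∀ a, δ (algebraMap A B a) = ε (algebraMap A B a)) (x : B) : δ x = ε x := by
  obtain ⟨⟨a, m⟩, hx⟩ := IsLocalization.surj M x
  have hu : IsUnit (φ (algebraMap A B m)) := (IsLocalization.map_units B m).map φ
  have h1 := hδ x (algebraMap A B m)
  have h2 := hε x (algebraMap A B m)
  rw [hx, h, h] at h1
  rw [hx] at h2
  exact hu.mul_left_cancel (add_left_cancel (h1.symm.trans h2))

variable {k : Type u} [Field k] {X : Scheme.{u}} {s : X ⟶ Spec (.of k)} {U : X.Opens}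

lemma res_res {V W W' : X.Opens} (h : W ≤ V) (h' : W' ≤ W) (f : Γ(X, V)) :
    X.presheaf.map (homOfLE h').op (X.presheaf.map (homOfLE h).op f) =
      X.presheaf.map (homOfLE (h'.trans h)).op f := by
  rw [← CommRingCat.comp_apply, ← Functor.map_comp]
  rfl

/-- A vector field on an affine open subset is determined by its action on the functions there. -/
lemma VectorField.ext_of_isAffineOpen (hU : IsAffineOpen U) {D E : VectorField s U}
    (h : ∀ f, D.app U le_rfl f = E.app U le_rfl f) : D = E := by
  refine VectorField.ext_apply fun V hV x ↦ ?_
  have hc : ∀ y : V, ∃ g : Γ(X, U), X.basicOpen g ≤ V ∧ y.1 ∈ X.basicOpen g :=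
    fun y ↦ hU.exists_basicOpen_le y (hV y.2)
  choose g hg hy using hc
  refine X.sheaf.eq_of_locally_eq' (fun y : V ↦ X.basicOpen (g y)) V (fun y ↦ homOfLE (hg y))
    (fun y hyV ↦ Opens.mem_iSup.2 ⟨⟨y, hyV⟩, hy _⟩) _ _ fun y ↦ ?_
  refine (D.res V hV _ (hg y) x).trans (.trans ?_ (E.res V hV _ (hg y) x).symm)
  have := hU.isLocalization_basicOpen (g y)
  exact eq_of_leibniz_of_isLocalization (Submonoid.powers (g y)) (RingHom.id _)
    (D.app _ ((hg y).trans hV)) (E.app _ ((hg y).trans hV)) (D.leibniz _ _) (E.leibniz _ _)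
    (fun a ↦ (D.res U le_rfl _ ((hg y).trans hV) a).symm.trans
      ((congrArg _ (h a)).trans (E.res U le_rfl _ ((hg y).trans hV) a))) _

/-- A derivation of the functions on an affine open subset extends to a vector field. -/
lemma VectorField.exists_of_isAffineOpen (hU : IsAffineOpen U) (d : Γ(X, U) →+ Γ(X, U))
    (hd : ∀ f g, d (f * g) = f * d g + g * d f) (hc : ∀ c, d (constFun s U c) = 0) :
    ∃ D : VectorField s U, D.app U le_rfl = d := by
  have key : ∀ g : Γ(X, U), ∃ e : Γ(X, X.basicOpen g) →+ Γ(X, X.basicOpen g),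
      (∀ x y, e (x * y) = x * e y + y * e x) ∧ (∀ c, e (constFun s _ c) = 0) ∧
      ∀ a, e (X.presheaf.map (homOfLE (X.basicOpen_le g)).op a) =
        X.presheaf.map (homOfLE (X.basicOpen_le g)).op (d a) := by
    intro g
    let _ : Algebra k Γ(X, U) := (constFun s U).toAlgebra
    let _ : Algebra k Γ(X, X.basicOpen g) := (constFun s (X.basicOpen g)).toAlgebra
    have : IsScalarTower k Γ(X, U) Γ(X, X.basicOpen g) :=
      .of_algebraMap_eq fun c ↦ (constFun_res s (X.basicOpen_le g) c).symm
    have := hU.isLocalization_basicOpen g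
    let d' : Derivation k Γ(X, U) Γ(X, U) :=
      .mk' { d with
        map_smul' := fun c x ↦ by
          change d (c • x) = c • d x
          rw [Algebra.smul_def, hd, Algebra.smul_def]
          erw [hc]
          simp } fun x y ↦ hd x y
    obtain ⟨e, he⟩ := exists_derivation_extension (B := Γ(X, X.basicOpen g)) (.powers g) d'
    exact ⟨e, fun x y ↦ e.leibniz x y, fun c ↦ e.map_algebraMap c, he⟩
  choose e heL hec hea using key
  have compat : ∀ (g : Γ(X, U)) (h : Γ(X, U)) (hgh : X.basicOpen h ≤ X.basicOpen g) x,
      X.presheaf.map (homOfLE hgh).op (e g x) = e h (X.presheaf.map (homOfLE hgh).op x) := by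
    intro g h hgh x
    have := hU.isLocalization_basicOpen g
    refine eq_of_leibniz_of_isLocalization (Submonoid.powers g)
      (X.presheaf.map (homOfLE hgh).op).hom
      ((X.presheaf.map (homOfLE hgh).op).hom.toAddMonoidHom.comp (e g))
      ((e h).comp (X.presheaf.map (homOfLE hgh).op).hom.toAddMonoidHom) ?_ ?_ ?_ x
    · intro x y
      change X.presheaf.map (homOfLE hgh).op (e g (x * y)) = _
      rw [heL, map_add, map_mul, map_mul]
      rfl
    · intro x y
      change e h (X.presheaf.map (homOfLE hgh).op (x * y)) = _
      rw [map_mul, heL]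
      rfl
    · intro a
      change X.presheaf.map (homOfLE hgh).op (e g (X.presheaf.map (homOfLE (X.basicOpen_le g)).op a))
        = e h (X.presheaf.map (homOfLE hgh).op (X.presheaf.map (homOfLE (X.basicOpen_le g)).op a))
      rw [hea, res_res, res_res, hea]
  have glue : ∀ (V : X.Opens) (hV : V ≤ U) (x : Γ(X, V)), ∃! y : Γ(X, V), ∀ (g : Γ(X, U))
      (hg : X.basicOpen g ≤ V), X.presheaf.map (homOfLE hg).op y =
        e g (X.presheaf.map (homOfLE hg).op x) := by
    intro V hV x
    have hcov : V ≤ iSup fun g : {g : Γ(X, U) // X.basicOpen g ≤ V} ↦ X.basicOpen g.1 := by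
      intro y hy
      obtain ⟨g, hg, hyg⟩ := hU.exists_basicOpen_le ⟨y, hy⟩ (hV hy)
      exact Opens.mem_iSup.2 ⟨⟨g, hg⟩, hyg⟩
    have := X.sheaf.existsUnique_gluing'
      (fun g : {g : Γ(X, U) // X.basicOpen g ≤ V} ↦ X.basicOpen g.1) V (fun g ↦ homOfLE g.2) hcov
      (fun g ↦ e g.1 (X.presheaf.map (homOfLE g.2).op x)) (by
        rintro ⟨g, hg⟩ ⟨h, hh⟩
        have hgh : X.basicOpen g ⊓ X.basicOpen h = X.basicOpen (g * h) := (X.basicOpen_mul g h).symm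
        have inj : ∀ u v : Γ(X, X.basicOpen g ⊓ X.basicOpen h),
            X.presheaf.map (homOfLE hgh.ge).op u = X.presheaf.map (homOfLE hgh.ge).op v → u = v := by
          intro u v huv
          have := congrArg (X.presheaf.map (homOfLE hgh.le).op) huv
          rw [res_res, res_res] at this
          simpa using this
        apply inj
        change X.presheaf.map (homOfLE hgh.ge).op (X.presheaf.map (homOfLE inf_le_left).op (e g _)) =
          X.presheaf.map (homOfLE hgh.ge).op (X.presheaf.map (homOfLE inf_le_right).op (e h _))
        rw [res_res, res_res, compat g (g * h) (hgh.ge.trans inf_le_left),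
          compat h (g * h) (hgh.ge.trans inf_le_right), res_res, res_res])
    obtain ⟨y, hy, hy'⟩ := this
    exact ⟨y, fun g hg ↦ hy ⟨g, hg⟩, fun z hz ↦ hy' z fun g ↦ hz g.1 g.2⟩
  choose a ha ha' using glue
  let D : VectorField s U :=
    { app := fun V hV ↦ AddMonoidHom.mk' (a V hV) fun x y ↦
        (ha' V hV (x + y) _ fun g hg ↦ by
          simp only [map_add, ha V hV x g hg, ha V hV y g hg]).symm
      leibniz := fun V hV x y ↦ (ha' V hV (x * y) _ fun g hg ↦ by
          simp only [AddMonoidHom.mk'_apply, map_add, map_mul, ha V hV x g hg, ha V hV y g hg,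
            heL]).symm
      app_const := fun V hV c ↦ (ha' V hV _ 0 fun g hg ↦ by
          rw [constFun_res, hec, map_zero]).symm
      res := fun V hV W h x ↦ ha' W (h.trans hV) _ _ fun g hg ↦ by
          rw [AddMonoidHom.mk'_apply, res_res, res_res, ha V hV x g (hg.trans h)] }
  refine ⟨D, AddMonoidHom.ext fun x ↦ (ha' U le_rfl x _ fun g hg ↦ ?_).symm⟩
  exact (hea g x).symm

/-- Restricting vector fields from an affine open subset to a basic open subset is a localization
of modules. -/
lemma VectorField.isLocalizedModule_restrict [Smooth s] (hU : IsAffineOpen U) (f : Γ(X, U)) :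
    (∀ D : VectorField s U, VectorField.restrict (X.basicOpen_le f) D = 0 → ∃ n : ℕ, f ^ n • D = 0) ∧
    (∀ E : VectorField s (X.basicOpen f), ∃ (n : ℕ) (D : VectorField s U),
      VectorField.restrict (X.basicOpen_le f) D =
        X.presheaf.map (homOfLE (X.basicOpen_le f)).op f ^ n • E) := by
  let _ : Algebra k Γ(X, U) := (constFun s U).toAlgebra
  let _ : Algebra k Γ(X, X.basicOpen f) := (constFun s (X.basicOpen f)).toAlgebra
  have : IsScalarTower k Γ(X, U) Γ(X, X.basicOpen f) :=
    .of_algebraMap_eq fun c ↦ (constFun_res s (X.basicOpen_le f) c).symm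
  have := hU.isLocalization_basicOpen f
  have hs : Algebra.Smooth k Γ(X, U) := by
    have h1 := s.smooth_appLE (isAffineOpen_top (Spec (.of k))) hU
      (show U ≤ s ⁻¹ᵁ ⊤ from le_top)
    have h2 : (constFun s U).Smooth := (RingHom.Smooth.respectsIso.2 (s.appLE ⊤ U _).hom
      (Scheme.ΓSpecIso (.of k)).symm.commRingCatIsoToRingEquiv h1)
    exact h2
  have : Module.FinitePresentation Γ(X, U) Ω[Γ(X, U)⁄k] := inferInstance
  constructor
  · intro D hD
    let d : Derivation k Γ(X, U) Γ(X, U) :=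
      .mk' { D.app U le_rfl with
        map_smul' := fun c x ↦ by
          change D.app U le_rfl (c • x) = c • D.app U le_rfl x
          rw [Algebra.smul_def, D.leibniz, Algebra.smul_def]
          erw [D.app_const]
          simp } fun x y ↦ D.leibniz U le_rfl x y
    obtain ⟨m, ⟨n, rfl⟩, hm⟩ := exists_smul_derivation_eq_zero (B := Γ(X, X.basicOpen f))
      (.powers f) d fun a ↦ by
        refine (D.res U le_rfl _ (X.basicOpen_le f) a).trans ?_
        exact congr(($hD).app _ le_rfl (X.presheaf.map (homOfLE (X.basicOpen_le f)).op a))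
    refine ⟨n, VectorField.ext_of_isAffineOpen hU fun a ↦ ?_⟩
    simpa using! hm a
  · intro E
    let e : Derivation k Γ(X, X.basicOpen f) Γ(X, X.basicOpen f) :=
      .mk' { E.app _ le_rfl with
        map_smul' := fun c x ↦ by
          change E.app _ le_rfl (c • x) = c • E.app _ le_rfl x
          rw [Algebra.smul_def, E.leibniz, Algebra.smul_def]
          erw [E.app_const]
          simp } fun x y ↦ E.leibniz _ le_rfl x y
    obtain ⟨m, ⟨n, rfl⟩, d, hm⟩ := exists_derivation_lift (A := Γ(X, U)) (.powers f) e
    obtain ⟨D, hD⟩ := VectorField.exists_of_isAffineOpen (s := s) hU d.toLinearMap.toAddMonoidHom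
      (fun x y ↦ d.leibniz x y) (fun c ↦ d.map_algebraMap c)
    refine ⟨n, D, VectorField.ext_of_isAffineOpen (hU.basicOpen f) fun a ↦ ?_⟩
    refine eq_of_leibniz_of_isLocalization (A := Γ(X, U)) (Submonoid.powers f) (RingHom.id _)
      ((VectorField.restrict (X.basicOpen_le f) D).app _ le_rfl)
      ((X.presheaf.map (homOfLE (X.basicOpen_le f)).op f ^ n • E).app _ le_rfl)
      (VectorField.leibniz _ _ _) (VectorField.leibniz _ _ _) (fun b ↦ ?_) a
    refine (D.res U le_rfl _ (X.basicOpen_le f) b).symm.trans ?_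
    rw [hD]
    refine (hm b).trans ?_
    rw [VectorField.smul_app, map_pow]
    simp
    rfl

end AffineVectorField
/-! ### The cotangent bundle -/

section CotangentBundle

variable {k : Type u} [Field k] {X : Scheme.{u}} (s : X ⟶ Spec (.of k))

/-- The symmetric algebra of the tangent sheaf, on affine open subsets. -/
def symTangent : X.AffineZariskiSiteᵒᵖ ⥤ CommRingCat.{u} where
  obj U := .of (SymmetricAlgebra Γ(X, U.unop.toOpens) (VectorField s U.unop.toOpens))
  map i := CommRingCat.ofHom <| symMap
    (X.presheaf.map (homOfLE (Scheme.AffineZariskiSite.toOpens_mono i.unop.le)).op).hom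
    (VectorField.restrict (Scheme.AffineZariskiSite.toOpens_mono i.unop.le))
    (fun a D ↦ VectorField.restrict_smul _ a D)
  map_id U := by
    ext1
    apply sym_hom_ext
    · intro a
      simp
    · intro a
      simp
      rfl
  map_comp i j := by
    ext1
    apply sym_hom_ext
    · intro a
      simp [res_res]
    · intro a
      simp
      rfl

/-- The structure map from `𝒪_X` to the symmetric algebra of the tangent sheaf. -/
def toSymTangent : (Scheme.AffineZariskiSite.toOpensFunctor X).op ⋙ X.presheaf ⟶ symTangent s where
  app U := CommRingCat.ofHom (algebraMap Γ(X, U.unop.toOpens)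
    (SymmetricAlgebra Γ(X, U.unop.toOpens) (VectorField s U.unop.toOpens)))
  naturality U V i := by
    ext a
    exact (symMap_algebraMap (A := Γ(X, U.unop.toOpens)) (B := Γ(X, V.unop.toOpens))
      (L := VectorField s U.unop.toOpens) (L' := VectorField s V.unop.toOpens)
      (X.presheaf.map (homOfLE (Scheme.AffineZariskiSite.toOpens_mono i.unop.le)).op).hom
      (VectorField.restrict (Scheme.AffineZariskiSite.toOpens_mono i.unop.le))
      (fun a D ↦ VectorField.restrict_smul _ a D) a).symm

lemma coequifibered_toSymTangent [Smooth s] : (toSymTangent s).Coequifibered := by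
  rw [Scheme.AffineZariskiSite.coequifibered_iff_forall_isLocalizationAway]
  intro U f
  have hle := X.basicOpen_le f
  let A := Γ(X, U.toOpens)
  let B := Γ(X, X.basicOpen f)
  let L := VectorField s U.toOpens
  let L' := VectorField s (X.basicOpen f)
  have := U.2.isLocalization_basicOpen f
  let F : SymmetricAlgebra A L →+* SymmetricAlgebra B L' :=
    symMap (X.presheaf.map (homOfLE hle).op).hom (VectorField.restrict hle)
      (fun a D ↦ VectorField.restrict_smul _ a D)
  let _ : Algebra (SymmetricAlgebra A L) (SymmetricAlgebra B L') := F.toAlgebra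
  let _ : Module A L' := Module.compHom L' (algebraMap A B)
  have : IsScalarTower A B L' := .of_algebraMap_smul fun _ _ ↦ rfl
  have : IsScalarTower A (SymmetricAlgebra A L) (SymmetricAlgebra B L') :=
    .of_algebraMap_eq fun a ↦ (symMap_algebraMap _ _ _ a).symm
  let r : L →ₗ[A] L' :=
    { toFun := VectorField.restrict hle
      map_add' := map_add _
      map_smul' := fun a D ↦ VectorField.restrict_smul _ a D }
  obtain ⟨h1, h2⟩ := VectorField.isLocalizedModule_restrict (s := s) U.2 f
  have hr : IsLocalizedModule (Submonoid.powers f) r := by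
    refine ⟨?_, ?_, ?_⟩
    · rintro ⟨_, n, rfl⟩
      have hu : IsUnit (algebraMap A B (f ^ n)) :=
        IsLocalization.map_units B (⟨f ^ n, n, rfl⟩ : Submonoid.powers f)
      rw [Module.End.isUnit_iff]
      exact MulAction.bijective (β := L') hu.unit
    · intro E
      obtain ⟨n, D, hD⟩ := h2 E
      refine ⟨⟨D, ⟨f ^ n, n, rfl⟩⟩, ?_⟩
      rw [← map_pow] at hD
      exact hD.symm
    · intro D E hDE
      obtain ⟨n, hn⟩ := h1 (D - E) ((map_sub r D E).trans (sub_eq_zero.2 hDE))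
      refine ⟨⟨f ^ n, n, rfl⟩, ?_⟩
      rw [smul_sub, sub_eq_zero] at hn
      exact hn
  have := symmetricAlgebra_isLocalization (A := A) (B := B) (L := L) (L' := L') (S := SymmetricAlgebra A L) (S' := SymmetricAlgebra B L')
    (Submonoid.powers f) r hr (SymmetricAlgebra.isSymmetricAlgebra_ι (R := A) (M := L))
    (SymmetricAlgebra.isSymmetricAlgebra_ι (R := B) (M := L')) (fun x ↦ symMap_ι _ _ _ x)
  rw [Algebra.algebraMapSubmonoid_powers] at this
  exact this

/-- The cotangent bundle `T^*X` of a smooth `k`-scheme: the relative spectrum of the symmetric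
algebra of the tangent sheaf. -/
def cotangentBundle [Smooth s] : Scheme.{u} :=
  (Scheme.AffineZariskiSite.relativeGluingData (coequifibered_toSymTangent s)).glued

/-- The projection `T^*X ⟶ X`. -/
def cotangentProj [Smooth s] : cotangentBundle s ⟶ X :=
  (Scheme.AffineZariskiSite.relativeGluingData (coequifibered_toSymTangent s)).toBase

/-- The open immersion of the spectrum of the symmetric algebra of vector fields on an affine
open subset `U` onto the part of the cotangent bundle above `U`. -/
def cotangentChart [Smooth s] (U : X.AffineZariskiSite) :
    Spec (.of (SymmetricAlgebra Γ(X, U.toOpens) (VectorField s U.toOpens))) ⟶ cotangentBundle s :=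
  (Scheme.AffineZariskiSite.relativeGluingData (coequifibered_toSymTangent s)).cover.f U

instance [Smooth s] (U : X.AffineZariskiSite) : IsOpenImmersion (cotangentChart s U) :=
  (Scheme.AffineZariskiSite.relativeGluingData
    (coequifibered_toSymTangent s)).cover.map_prop U

lemma opensRange_cotangentChart [Smooth s] (U : X.AffineZariskiSite) :
    cotangentProj s ⁻¹ᵁ U.toOpens = (cotangentChart s U).opensRange := by
  have := (Scheme.AffineZariskiSite.relativeGluingData
    (coequifibered_toSymTangent s)).toBase_preimage_eq_opensRange_ι U
  simpa using! this

/-- The functions on the part of the cotangent bundle above an affine open subset `U` are the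
symmetric algebra of the vector fields on `U`. -/
def cotangentSections [Smooth s] (U : X.AffineZariskiSite) :
    SymmetricAlgebra Γ(X, U.toOpens) (VectorField s U.toOpens) →+*
      Γ(cotangentBundle s, cotangentProj s ⁻¹ᵁ U.toOpens) :=
  ((Scheme.ΓSpecIso (.of (SymmetricAlgebra Γ(X, U.toOpens) (VectorField s U.toOpens)))).inv ≫
    (IsOpenImmersion.ΓIsoTop (cotangentChart s U)).hom ≫
    (cotangentBundle s).presheaf.map (eqToHom (opensRange_cotangentChart s U)).op).hom

lemma cotangentSections_bijective [Smooth s] (U : X.AffineZariskiSite) :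
    Function.Bijective (cotangentSections s U) :=
  ConcreteCategory.bijective_of_isIso
    ((Scheme.ΓSpecIso (.of (SymmetricAlgebra Γ(X, U.toOpens) (VectorField s U.toOpens)))).inv ≫
    (IsOpenImmersion.ΓIsoTop (cotangentChart s U)).hom ≫
    (cotangentBundle s).presheaf.map (eqToHom (opensRange_cotangentChart s U)).op)

/-- On the cotangent bundle, a vector field `∂` on `U` viewed as a fibrewise linear function. -/
def linearFunction [Smooth s] (U : X.AffineZariskiSite) (D : VectorField s U.toOpens) :
    Γ(cotangentBundle s, cotangentProj s ⁻¹ᵁ U.toOpens) :=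
  cotangentSections s U (SymmetricAlgebra.ι Γ(X, U.toOpens) (VectorField s U.toOpens) D)

end CotangentBundle
/-! ### Azumaya algebras on schemes -/

section Azumaya

variable {Y : Scheme.{u}} {𝒜 : TopCat.Sheaf RingCat.{u} Y} (ψ : Y.ringCatSheaf ⟶ 𝒜)

/-- The structure map of a sheaf of `𝒪_Y`-algebras, on sections. -/
def structureMap (W : Y.Opens) : Γ(Y, W) →+* 𝒜.presheaf.obj (op W) :=
  (ψ.hom.app (op W)).hom

/-- A sheaf of rings `𝒜` on the scheme `Y` with a central homomorphism `ψ` from `𝒪_Y` is an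
Azumaya algebra over `Y` if, in a neighbourhood of every point, it is the quasi-coherent sheaf of
algebras on an affine open subset `W` given by an Azumaya algebra over the ring `Γ(Y, W)`. -/
structure IsAzumayaAlgebra : Prop where
  /-- `𝒪_Y` maps to the center. -/
  central : ∀ (W : Y.Opens) (f : Γ(Y, W)) (a : 𝒜.presheaf.obj (op W)),
    structureMap ψ W f * a = a * structureMap ψ W f
  exists_affine : ∀ y : Y, ∃ W : Y.Opens, y ∈ W ∧ IsAffineOpen W ∧
    -- quasi-coherence on `W`: the sections on `D(f)` are the localization at `f`
    (∀ f : Γ(Y, W),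
      (∀ a : 𝒜.presheaf.obj (op W), 𝒜.presheaf.map (homOfLE (Y.basicOpen_le f)).op a = 0 →
        ∃ n : ℕ, structureMap ψ W f ^ n * a = 0) ∧
      (∀ b : 𝒜.presheaf.obj (op (Y.basicOpen f)), ∃ (n : ℕ) (a : 𝒜.presheaf.obj (op W)),
        𝒜.presheaf.map (homOfLE (Y.basicOpen_le f)).op a =
          𝒜.presheaf.map (homOfLE (Y.basicOpen_le f)).op (structureMap ψ W f) ^ n * b)) ∧
    letI : Algebra Γ(Y, W) (𝒜.presheaf.obj (op W)) :=
      (structureMap ψ W).toAlgebra' (central W)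
    IsAzumaya Γ(Y, W) (𝒜.presheaf.obj (op W))

/-- A vector bundle on a scheme: a sheaf of modules which has a finite frame in a neighbourhood of
every point. -/
def IsVectorBundle (V : Y.Modules) : Prop :=
  ∀ y : Y, ∃ (W : Y.Opens) (n : ℕ) (b : Fin n → Γ(V, W)), y ∈ W ∧
    ∀ (W' : Y.Opens) (h : W' ≤ W) (v : Γ(V, W')), ∃! c : Fin n → Γ(Y, W'),
      v = ∑ i, c i • V.presheaf.map (homOfLE h).op (b i)

/-- The sections on `W` of the sheaf of rings `ℰnd(V)`: the endomorphisms of the sheaf of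
modules `V|_W`. -/
def sheafEnd (V : Y.Modules) (W : Y.Opens) :
    Subring (∀ W' : {W' : Y.Opens // W' ≤ W}, Module.End Γ(Y, W'.1) Γ(V, W'.1)) where
  carrier := {φ | ∀ (W₁ W₂ : {W' : Y.Opens // W' ≤ W}) (h : W₂.1 ≤ W₁.1) (v : Γ(V, W₁.1)),
    V.presheaf.map (homOfLE h).op (φ W₁ v) = φ W₂ (V.presheaf.map (homOfLE h).op v)}
  zero_mem' := fun W₁ W₂ h v ↦ by simp
  one_mem' := fun W₁ W₂ h v ↦ by simp
  add_mem' := fun {φ χ} hφ hχ W₁ W₂ h v ↦ by simp [hφ W₁ W₂ h, hχ W₁ W₂ h]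
  mul_mem' := fun {φ χ} hφ hχ W₁ W₂ h v ↦ by simp [hφ W₁ W₂ h, hχ W₁ W₂ h]
  neg_mem' := fun {φ} hφ W₁ W₂ h v ↦ by simp [hφ W₁ W₂ h]

/-- An Azumaya algebra `𝒜` over `Y` is trivial (splits) if it is isomorphic, as a sheaf of
`𝒪_Y`-algebras, to `ℰnd(V)` for a vector bundle `V` on `Y`. -/
def IsTrivialAzumaya : Prop :=
  ∃ V : Y.Modules, IsVectorBundle V ∧
    ∃ e : ∀ W : Y.Opens, 𝒜.presheaf.obj (op W) ≃+* sheafEnd V W,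
      -- `e` is compatible with restriction
      (∀ (W W' : Y.Opens) (h : W' ≤ W) (a : 𝒜.presheaf.obj (op W))
        (W'' : {W'' : Y.Opens // W'' ≤ W'}),
        (e W' (𝒜.presheaf.map (homOfLE h).op a)).1 W'' = (e W a).1 ⟨W''.1, W''.2.trans h⟩) ∧
      -- `e` is `𝒪_Y`-linear
      (∀ (W : Y.Opens) (f : Γ(Y, W)) (v : Γ(V, W)),
        (e W (structureMap ψ W f)).1 ⟨W, le_rfl⟩ v = f • v)

end Azumaya

/-! ### The Frobenius twist, and differential operators on the twisted cotangent bundle -/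

section Twist

variable (k : Type u) [Field k] (p : ℕ) [Fact p.Prime] [CharP k p] [PerfectRing k p]

/-- The Frobenius twist `Y ↦ Y^{(1)}` of `k`-schemes: the scheme is the same, but `a ∈ k` acts on
functions as `a^{1/p}` does on `Y`. -/
def frobeniusTwist : Over (Spec (.of k)) ⥤ Over (Spec (.of k)) :=
  Over.map (Spec.map (CommRingCat.ofHom (frobeniusEquiv k p).symm.toRingHom))

variable {k} {X : Scheme.{u}} (s : X ⟶ Spec (.of k)) [Smooth s]

/-- The Frobenius twist `T^*X^{(1)}` of the cotangent bundle, as a `k`-scheme. -/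
def cotangentTwist : Over (Spec (.of k)) :=
  (frobeniusTwist k p).obj (Over.mk (cotangentProj s ≫ s))

/-- The projection `T^*X^{(1)} ⟶ X^{(1)}`. -/
def cotangentTwistHom : cotangentTwist p s ⟶ (frobeniusTwist k p).obj (Over.mk s) :=
  (frobeniusTwist k p).map (Over.homMk (cotangentProj s))

/-- The morphism of schemes underlying the projection `T^*X^{(1)} ⟶ X^{(1)}`; recall
that `X^{(1)} = X` as a scheme. -/
def cotangentTwistProj : (cotangentTwist p s).left ⟶ X :=
  (cotangentTwistHom p s).left

variable {p s}

/-- A homomorphism of sheaves of rings on `X^{(1)}` from the functions on `T^*X^{(1)}` to `𝒟_X`, on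
sections. -/
def onSections (θ : (TopCat.Sheaf.pushforward RingCat.{u} (cotangentTwistProj p s).base).obj
      (cotangentTwist p s).left.ringCatSheaf ⟶ diffOp s) (U : X.Opens) :
    Γ((cotangentTwist p s).left, cotangentTwistProj p s ⁻¹ᵁ U) →+*
      (diffOp s).presheaf.obj (op U) :=
  (θ.hom.app (op U)).hom

/-- The conditions that determine the canonical homomorphism from the functions on `T^*X^{(1)}`
to `𝒟_X`. -/
structure IsFrobeniusHom (θ : (TopCat.Sheaf.pushforward RingCat.{u} (cotangentTwistProj p s).base).obj
      (cotangentTwist p s).left.ringCatSheaf ⟶ diffOp s) : Prop where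
  /-- It is `k`-linear, for the twisted `k`-structure on `T^*X^{(1)}`. -/
  map_const : ∀ (U : X.Opens) (c : k),
    onSections θ U (constFun (cotangentTwist p s).hom (cotangentTwistProj p s ⁻¹ᵁ U) c) =
      funOp s U (constFun s U c)
  /-- A function `f` on `X^{(1)}` is mapped to `f ^ p`. -/
  map_fun : ∀ (U : X.Opens) (f : Γ(X, U)),
    onSections θ U ((cotangentTwistProj p s).app U f) = funOp s U (f ^ p)
  /-- A vector field `∂`, as a fibrewise linear function, is mapped to `∂ ^ p - ∂^{[p]}`. -/
  map_vec : ∀ (U : X.AffineZariskiSite) (D : VectorField s U.toOpens),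
    onSections θ U.toOpens (linearFunction s U D) =
      vecOp s U.toOpens D ^ p - vecOp s U.toOpens (D.pPow p)

/-- The homomorphism is an isomorphism to the center of the sheaf of rings `𝒟_X`. -/
def IsIsoToCenter (θ : (TopCat.Sheaf.pushforward RingCat.{u} (cotangentTwistProj p s).base).obj
      (cotangentTwist p s).left.ringCatSheaf ⟶ diffOp s) : Prop :=
  ∀ U : X.Opens, Function.Injective (onSections θ U) ∧
    ∀ d : (diffOp s).presheaf.obj (op U), d ∈ Set.range (onSections θ U) ↔
      ∀ (V : X.Opens) (h : V ≤ U) (d' : (diffOp s).presheaf.obj (op V)),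
        (diffOp s).presheaf.map (homOfLE h).op d * d' = d' * (diffOp s).presheaf.map (homOfLE h).op d

end Twist

end CrystallineDiff

end

/-! Locally on `X` there are coordinates `x i` with dual vector fields `d i`: a smooth algebra is
locally standard smooth, so its differentials have a basis of the form `dx i` (`exists_chart`). Over
such a chart everything is explicit. The enveloping algebra acts on polynomials `A[ξ]`, a vector
field acting as multiplication by its symbol plus differentiation of coefficients. Evaluation at `1`
is inverse to normal ordering, so differential operators are polynomials in the `d i` with
coefficients on the left (`LieCoordinates.app_op`, `LieCoordinates.op_app_one`).

Every operator is linear over `p`-th powers of polynomials, hence `n ↦ op (n ^ p)` is a ring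
homomorphism (`FrobeniusCoordinates.frob`). Its image is the joint centralizer of the `x i` and `d
i`. Commuting with `x i` means that the derivative in `ξ i` vanishes, which forces exponents
divisible by `p`. Commuting with `d i` means that `d i` kills the coefficients, which are then
`p`-th powers by the Cartier property of smooth algebras over a perfect field. The value at the
symbol of `∂` is `∂ ^ p - ∂^{[p]}` (`FrobeniusCoordinates.frob_symbol`), so the map does not depend
on the coordinates and glues to `frobeniusHom`.

The Azumaya property is deduced from the Weyl relations alone, in the form `WeylOver`: the `x i` and
`d i` have central `p`-th powers and joint centralizer `S`. In characteristic `p` the inner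
derivations by `d i` and `-x i` are then commuting nilpotent operators, dual to left multiplication
by `x i` and right multiplication by `d i`. A truncated Taylor expansion writes the identity as `∑ a
γ * Φ * θ γ`, where `Φ` projects onto the common kernel `S` of the derivations. On the algebra this
gives a finite dual basis over `S`; in the tensor product with the opposite algebra it gives the
isomorphism with the endomorphism ring (`WeylOver.isAzumaya`). All operators involved are universal
noncommutative polynomials with integer coefficients, so they commute with ring homomorphisms, and
`WeylOver` survives base change of the center.

The projection `π` of the cotangent bundle is open and surjective. The algebra on `T^*X^{(1)}` is
therefore the sheaf associated with `W ↦ 𝒪(W) ⊗ 𝒟(π W)`, tensored over the functions on `π⁻¹(π W)`.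
Over a chart the Taylor coordinates show that this presheaf is already a quasi-coherent sheaf.

For non-triviality, leading symbols multiply, so the enveloping algebra of a reduced ring with
coordinates is reduced (`LieCoordinates.isReduced`). If the algebra were `ℰnd(V)`, then `V` would
have rank at most one, as larger matrix rings contain nilpotents. The algebra would thus be
commutative on a small nonempty open subset. In positive dimension some chart has a coordinate, and
`d i * x i = x i * d i + 1` contradicts this. -/

noncomputable section

namespace CrystallineDiff


/-! ### Weyl relations in characteristic `p` -/

section Weyl

/-- Elements `U j`, `Δ j` of a ring of characteristic `p` which satisfy the relations of the
multiplication operators and the partial derivatives on truncated polynomials. -/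
structure IsWeylFamily (p : ℕ) {J : Type} {R : Type*} [Ring R] (U Δ : J → R) : Prop where
  commU : ∀ i j, Commute (U i) (U j)
  commD : ∀ i j, Commute (Δ i) (Δ j)
  rel : ∀ i j, i ≠ j → Commute (Δ i) (U j)
  rel_self : ∀ i, Δ i * U i = U i * Δ i + 1
  pow : ∀ i, Δ i ^ p = 0
  char : (p : R) = 0

/-- Stands in for `1 / n!` with `n < p`. The inverses modulo `p` are taken as integers, independent
of the ring, so that the divided powers below can be written in the free algebra over `ℤ` once and
for all. -/
lemma exists_inverse_factorial (p : ℕ) [Fact p.Prime] :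
    ∃ c : ℕ → ℤ, ∀ (R : Type*) [Ring R], (p : R) = 0 → c 0 = (1 : R) ∧
      (∀ n < p, (c n : R) * (n.factorial : R) = 1) := by
  have h : ∀ n : ℕ, ∃ c : ℤ, (n = 0 → c = 1) ∧ (n < p → ∃ m : ℤ, c * n.factorial = 1 + p * m) := by
    intro n
    rcases eq_or_ne n 0 with rfl | hn
    · exact ⟨1, by simp, fun _ ↦ ⟨0, by simp⟩⟩
    by_cases hp : n < p
    · have hc : Nat.Coprime n.factorial p :=
        ((Nat.Prime.coprime_iff_not_dvd Fact.out).2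
          fun h ↦ hp.not_ge ((Nat.Prime.dvd_factorial Fact.out).1 h)).symm
      have := Nat.gcd_eq_gcd_ab n.factorial p
      rw [hc] at this
      -- Bézout coefficients for the coprime pair `n!`, `p`.
      refine ⟨Nat.gcdA n.factorial p, by simp [hn], fun _ ↦ ⟨-Nat.gcdB n.factorial p, ?_⟩⟩
      push_cast at this
      linarith
    · exact ⟨0, by simp [hn], fun h ↦ (hp h).elim⟩
  choose c hc0 hc using h
  refine ⟨c, fun R _ hR ↦ ⟨by simp [hc0 0 rfl], fun n hn ↦ ?_⟩⟩
  obtain ⟨m, hm⟩ := hc n hn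
  have := congr((($hm : ℤ) : R))
  push_cast at this
  rw [this, hR]
  simp

section OneVariable

variable {R : Type*} [Ring R] {p : ℕ} [Fact p.Prime] {x δ : R} {c : ℕ → ℤ}

lemma mul_neg_pow_of_weyl (h : δ * x = x * δ + 1) (n : ℕ) :
    δ * (-x) ^ (n + 1) = (-x) ^ (n + 1) * δ - (n + 1) * (-x) ^ n := by
  induction n with
  | zero => simp [h, mul_neg]; abel
  | succ n ih =>
    have hc : (-x) ^ (n + 1) * x = x * (-x) ^ (n + 1) := ((Commute.refl x).neg_left.pow_left _).eq
    rw [pow_succ _ (n + 1), ← mul_assoc, ih, sub_mul, mul_assoc _ δ, mul_neg, h]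
    rw [pow_succ (-x) n]
    push_cast
    noncomm_ring

/-- The projection to the kernel of the derivation `δ`. -/
def weylProj {R : Type*} [Ring R] (p : ℕ) (c : ℕ → ℤ) (x δ : R) : R :=
  ∑ n ∈ Finset.range p, (c n : R) * ((-x) ^ n * δ ^ n)

-- The projection is `∑ (-x)^n δ^n / n!`. Multiplying by `δ` on the left makes the sum telescope,
-- and the one surviving term contains `δ ^ p`.
omit [Fact p.Prime] in
lemma mul_weylProj (h : δ * x = x * δ + 1) (hδ : δ ^ p = 0)
    (hc : ∀ n < p, (c n : R) * (n.factorial : R) = 1) :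
    δ * weylProj p c x δ = 0 := by
  have hn : ∀ n, n + 1 < p → (c (n + 1) : R) * (n + 1) = c n := by
    intro n hn
    have h1 := hc (n + 1) hn
    have h2 := hc n (by omega)
    rw [Nat.factorial_succ] at h1
    push_cast at h1
    calc (c (n + 1) : R) * (n + 1) = (c (n + 1) : R) * (n + 1) * ((c n : R) * n.factorial) := by
          rw [h2, mul_one]
      _ = ((c (n + 1) : R) * ((n + 1) * n.factorial)) * c n := by
          have e1 : ((c n : R) * n.factorial) = n.factorial * c n := (Int.cast_commute _ _).eq
          rw [e1]; simp only [mul_assoc]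
      _ = c n := by rw [h1, one_mul]
  -- The telescoping identity for partial sums: only the boundary term of the last summand remains.
  have key : ∀ m, m ≤ p → δ * ∑ n ∈ Finset.range m, (c n : R) * ((-x) ^ n * δ ^ n) =
      if m = 0 then 0 else (c (m - 1) : R) * ((-x) ^ (m - 1) * δ ^ m) := by
    intro m
    induction m with
    | zero => simp
    | succ m ih =>
      intro hm
      rw [Finset.sum_range_succ, mul_add, ih (by omega)]
      have e1 : δ * ((c m : R) * ((-x) ^ m * δ ^ m)) = c m * (δ * (-x) ^ m * δ ^ m) := by
        rw [← mul_assoc, ← (Int.cast_commute (c m) δ).eq]; simp only [mul_assoc]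
      rcases m with _ | m
      · simp [← (Int.cast_commute (c 0) δ).eq]
      · rw [e1, mul_neg_pow_of_weyl h]
        simp only [Nat.add_eq_zero_iff, one_ne_zero, and_false, if_false, Nat.add_sub_cancel]
        rw [sub_mul, mul_sub, mul_assoc _ δ, ← pow_succ', ← mul_assoc, ← mul_assoc (c (m+1) : R),
          ← mul_assoc (c (m+1) : R) (_ * _), ← mul_assoc (c (m+1) : R) (_ + _), hn m (by omega)]
        simp only [mul_assoc]
        abel
  rw [weylProj, key p le_rfl, hδ]
  simp

/-- Taylor's formula in one variable. Inserting the projection gives a double sum in `x ^ (m + n) *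
δ ^ (m + n)`; for fixed `s = m + n` the coefficient is an alternating sum of binomial coefficients
over `s!`, which vanishes unless `s = 0`. -/
lemma sum_weylProj (hδ : δ ^ p = 0) (hc0 : (c 0 : R) = 1)
    (hc : ∀ n < p, (c n : R) * (n.factorial : R) = 1) :
    ∑ m ∈ Finset.range p, (c m : R) * (x ^ m * weylProj p c x δ * δ ^ m) = 1 := by
  have hcc : ∀ m n, m + n < p → (c m : R) * c n = c (m + n) * (m + n).choose m := by
    intro m n hmn
    have h1 := hc m (by omega)
    have h2 := hc n (by omega)
    have h3 := hc (m + n) hmn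
    rw [← Nat.add_choose_mul_factorial_mul_factorial m n, Nat.choose_symm_add.symm] at h3
    push_cast at h3
    have com : ∀ (a : ℤ) (r : R), a * r = r * a := fun a r ↦ (Int.cast_commute a r).eq
    calc (c m : R) * c n = (c (m+n) * (((m + n).choose m : ℕ) * m.factorial * n.factorial)) * ((c m : R) * c n) := by
          rw [h3, one_mul]
      _ = c (m + n) * (m + n).choose m * (c m * m.factorial) * (c n * n.factorial) := by
          rw [com (c m) (m.factorial : R), com (c n) (n.factorial : R), com (c m) (c n : R)]
          simp only [mul_assoc]
          rw [← mul_assoc (n.factorial : R) (c n : R), ← com (c m)]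
      _ = _ := by rw [h1, h2, mul_one, mul_one]
  let f : ℕ → ℕ → R := fun m n ↦ (c m * c n : R) * ((-1) ^ n * (x ^ (m + n) * δ ^ (m + n)))
  have e1 : ∀ m, (c m : R) * (x ^ m * weylProj p c x δ * δ ^ m) =
      ∑ n ∈ Finset.range p, f m n := by
    intro m
    rw [weylProj, Finset.mul_sum, Finset.sum_mul, Finset.mul_sum]
    refine Finset.sum_congr rfl fun n _ ↦ ?_
    have : x ^ m * ((c n : R) * ((-x) ^ n * δ ^ n)) * δ ^ m =
        c n * ((-1) ^ n * (x ^ (m + n) * δ ^ (m + n))) := by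
      rw [← mul_assoc, ← (Int.cast_commute (c n) (x ^ m)).eq, neg_pow, pow_add x, add_comm m n, pow_add δ]
      have : x ^ m * (-1) ^ n = (-1) ^ n * x ^ m :=
        ((Commute.neg_one_left (x ^ m)).pow_left n).eq.symm
      simp only [mul_assoc]
      congr 1
      rw [← mul_assoc (x ^ m), this, mul_assoc]
    rw [this]
    simp only [f, mul_assoc]
  -- Terms with `m + n ≥ p` vanish because `δ ^ p = 0`; the remaining ones lie in the range where
  -- `c` inverts factorials.
  have e2 : ∀ m ∈ Finset.range p, ∑ n ∈ Finset.range p, f m n = ∑ n ∈ Finset.range (p - m), f m n := by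
    intro m hm
    symm
    apply Finset.sum_subset
    · intro n; simp; omega
    · intro n hn hn'
      simp only [Finset.mem_range, not_lt] at hn hn' hm
      have : δ ^ (m + n) = 0 := pow_eq_zero_of_le (by omega) hδ
      simp [f, this]
  rw [Finset.sum_congr rfl fun m _ ↦ e1 m, Finset.sum_congr rfl e2, ← Finset.sum_range_diag_flip]
  have e3 : ∀ s ∈ Finset.range p, ∑ k ∈ Finset.range (s + 1), f k (s - k) = if s = 0 then 1 else 0 := by
    intro s hs
    rw [Finset.mem_range] at hs
    rcases s with _ | s
    · simp [f, hc0]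
    have : ∀ k ∈ Finset.range (s + 1 + 1), f k (s + 1 - k) = c (s + 1) *
        ((((-1) ^ (s + 1) * ((-1) ^ k * ((s + 1).choose k : ℤ)) : ℤ) : R) * (x ^ (s + 1) * δ ^ (s + 1))) := by
      intro k hk
      rw [Finset.mem_range] at hk
      have hk' : k + (s + 1 - k) = s + 1 := by omega
      have hsgn : (-1 : R) ^ (s + 1 - k) = (-1) ^ (s + 1) * (-1) ^ k := by
        rw [← pow_add, show s + 1 + k = (s + 1 - k) + 2 * k by omega, pow_add, pow_mul]
        simp
      simp only [f]
      rw [hcc k _ (by omega), hk', hsgn]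
      push_cast
      rw [mul_assoc (c (s+1) : R), mul_assoc ((-1 : R) ^ (s + 1)), mul_assoc ((-1 : R) ^ (s + 1)),
        mul_assoc ((-1 : R) ^ k), (Nat.cast_commute _ ((-1 : R) ^ (s+1) * _)).eq, mul_assoc,
        mul_assoc ((-1 : R) ^ k)]
      congr 3
      rw [(Nat.cast_commute _ (x ^ (s + 1) * δ ^ (s + 1))).eq]
    rw [Finset.sum_congr rfl this, ← Finset.mul_sum, ← Finset.sum_mul, ← Int.cast_sum,
      ← Finset.mul_sum, Int.alternating_sum_range_choose]
    simp
  rw [Finset.sum_congr rfl e3]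
  simp [(Fact.out : p.Prime).pos]

end OneVariable


/-- The evaluation of noncommutative polynomials at the elements `U j` and `Δ j`. -/
def weylEval {J R : Type*} [Ring R] (U Δ : J → R) : FreeAlgebra ℤ (J ⊕ J) →ₐ[ℤ] R :=
  FreeAlgebra.lift ℤ (Sum.elim U Δ)

/-- Universal noncommutative polynomials that decompose the unit: `1 = ∑ a γ * Φ * θ γ`, where `Φ`
is a projection to the kernel of the derivations and `a γ` is a polynomial in the multiplication
operators. -/
lemma exists_weyl_resolution (p : ℕ) [Fact p.Prime] {J : Type} (t : Finset J) :
    ∃ (Γ : Type) (_ : Fintype Γ) (a θ : Γ → FreeAlgebra ℤ (J ⊕ J)) (Φ : FreeAlgebra ℤ (J ⊕ J)),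
      ∀ (R : Type u) [Ring R] (U Δ : J → R), IsWeylFamily p U Δ →
        (∀ r : R, (∀ j ∈ t, Commute r (U j)) → ∀ γ, Commute r (weylEval U Δ (a γ))) ∧
        (∀ r : R, (∀ j ∈ t, Commute r (U j) ∧ Commute r (Δ j)) → Commute r (weylEval U Δ Φ)) ∧
        (∀ (M : Type u) [AddCommGroup M] [Module R M] (N : AddSubgroup M),
          (∀ j, ∀ m ∈ N, U j • m ∈ N) → ∀ γ, ∀ m ∈ N, weylEval U Δ (a γ) • m ∈ N) ∧
        (∀ (M : Type u) [AddCommGroup M] [Module R M] (m : M),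
          (∀ j ∈ t, Δ j • m = 0) → weylEval U Δ Φ • m = m) ∧
        (∀ j ∈ t, Δ j * weylEval U Δ Φ = 0) ∧
        ∑ γ, weylEval U Δ (a γ) * weylEval U Δ Φ * weylEval U Δ (θ γ) = 1 := by
  classical
  obtain ⟨c, hc⟩ := exists_inverse_factorial.{u} p
  induction t using Finset.induction_on with
  | empty =>
    refine ⟨Unit, inferInstance, fun _ ↦ 1, fun _ ↦ 1, 1, fun R _ U Δ _ ↦ ?_⟩
    simp
  | insert j t hj ih =>
    obtain ⟨Γ, _, a, θ, Φ, ih⟩ := ih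
    let u : FreeAlgebra ℤ (J ⊕ J) := FreeAlgebra.ι ℤ (Sum.inl j)
    let δ : FreeAlgebra ℤ (J ⊕ J) := FreeAlgebra.ι ℤ (Sum.inr j)
    -- The one-variable expansion in the new index `j` is wrapped around the expansion already
    -- found: powers of `u` go to the far left, powers of `δ` to the far right, and the two
    -- projections are multiplied.
    refine ⟨Fin p × Γ, inferInstance, fun γ ↦ c γ.1 * (u ^ γ.1.1 * a γ.2),
      fun γ ↦ θ γ.2 * δ ^ γ.1.1, weylProj p c u δ * Φ, fun R _ U Δ h ↦ ?_⟩
    obtain ⟨hc0, hcp⟩ := hc R h.char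
    obtain ⟨h1, h2, h3, h4, h5, h6⟩ := ih R U Δ h
    have hu : weylEval U Δ u = U j := by simp [weylEval, u]
    have hδ : weylEval U Δ δ = Δ j := by simp [weylEval, δ]
    have hπ : weylEval U Δ (weylProj p c u δ) = weylProj p c (U j) (Δ j) := by
      simp [weylProj, hu, hδ]
    have hcomm : ∀ r, Commute r (U j) → Commute r (Δ j) →
        Commute r (weylProj p c (U j) (Δ j)) := fun r h h' ↦
      Commute.sum_right _ _ _ fun n _ ↦ (Int.cast_commute _ _).symm.mul_right
        ((h.neg_right.pow_right n).mul_right (h'.pow_right n))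
    simp only [map_mul, map_pow, map_intCast, hu, hδ, hπ]
    refine ⟨fun r hr γ ↦ ?_, fun r hr ↦ ?_, ?_, ?_, ?_, ?_⟩
    · exact (Int.cast_commute _ _).symm.mul_right (((hr j (by simp)).pow_right _).mul_right
        (h1 r (fun i hi ↦ hr i (by simp [hi])) _))
    · exact (hcomm r (hr j (by simp)).1 (hr j (by simp)).2).mul_right
        (h2 r fun i hi ↦ hr i (by simp [hi]))
    · intro M _ _ N hN γ m hm
      have e : ∀ n, ∀ m ∈ N, U j ^ n • m ∈ N := by
        intro n
        induction n with
        | zero => simp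
        | succ n ih => intro m hm; rw [pow_succ, mul_smul]; exact ih _ (hN j m hm)
      rw [mul_smul, mul_smul, Int.cast_smul_eq_zsmul]
      exact N.zsmul_mem (e _ _ (h3 M N hN _ m hm)) _
    · intro M _ _ m hm
      rw [mul_smul, h4 M m fun i hi ↦ hm i (by simp [hi]), weylProj, Finset.sum_smul,
        Finset.sum_eq_single 0]
      · simp [hc0]
      · intro n _ hn
        obtain ⟨n, rfl⟩ := Nat.exists_eq_succ_of_ne_zero hn
        rw [pow_succ (Δ j), mul_smul, mul_smul, mul_smul, hm j (by simp)]
        simp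
      · simp [(Fact.out : p.Prime).pos]
    · intro i hi
      rcases Finset.mem_insert.1 hi with rfl | hi
      · rw [← mul_assoc, mul_weylProj (h.rel_self i) (h.pow i) hcp, zero_mul]
      · have hij : i ≠ j := fun h ↦ hj (h ▸ hi)
        rw [← mul_assoc, (hcomm (Δ i) (h.rel i j hij) (h.commD i j)).eq, mul_assoc, h5 i hi,
          mul_zero]
    · rw [Fintype.sum_prod_type, ← sum_weylProj (x := U j) (h.pow j) hc0 hcp,
        Finset.sum_range]
      refine Finset.sum_congr rfl fun n _ ↦ ?_
      -- `a γ` involves only the `U i` with `i ∈ t`, and these commute with `U j` and `Δ j` since `j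
      -- ∉ t`. The new projection can thus be moved past it.
      have hπa : ∀ γ, Commute (weylProj p c (U j) (Δ j)) (weylEval U Δ (a γ)) := fun γ ↦
        h1 _ (fun i hi ↦ (hcomm (U i) (h.commU i j)
          (h.rel j i fun h ↦ hj (h ▸ hi)).symm).symm) γ
      calc _ = ∑ γ, (c n : R) * (U j ^ n.1 * weylProj p c (U j) (Δ j) *
              (weylEval U Δ (a γ) * weylEval U Δ Φ * weylEval U Δ (θ γ)) * Δ j ^ n.1) := by
            refine Finset.sum_congr rfl fun γ _ ↦ ?_
            have := (hπa γ).eq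
            simp only [mul_assoc]
            rw [← mul_assoc (weylProj p c (U j) (Δ j)) (weylEval U Δ (a γ)), this]
            simp only [mul_assoc]
        _ = _ := by
            rw [← Finset.mul_sum, ← Finset.sum_mul, ← Finset.mul_sum, h6, mul_one]

/-- Elements `x i` and `d i` of a ring of characteristic `p` that satisfy the relations of the Weyl
algebra and whose `p`-th powers are central. -/
structure WeylRel (p : ℕ) {E : Type*} [Ring E] {ι : Type} (x d : ι → E) : Prop where
  x_comm : ∀ i j, Commute (x i) (x j)
  d_comm : ∀ i j, Commute (d i) (d j)
  rel : ∀ i j, i ≠ j → Commute (d i) (x j)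
  rel_self : ∀ i, d i * x i = x i * d i + 1
  char : (p : E) = 0
  x_pow : ∀ i e, Commute (x i ^ p) e
  d_pow : ∀ i e, Commute (d i ^ p) e

/-- Elements `x i` and `d i` satisfying Weyl relations, whose centralizer is the central
subring `S`. -/
structure WeylOver (p : ℕ) {S E : Type*} [CommRing S] [Ring E] (ψ : S →+* E) {ι : Type}
    (x d : ι → E) : Prop extends WeylRel p x d where
  central : ∀ s e, Commute (ψ s) e
  inj : Function.Injective ψ
  centralizer : ∀ e, (∀ i, Commute (x i) e) → (∀ i, Commute (d i) e) → e ∈ Set.range ψ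

section Bimodule

open MulOpposite

variable {E Q : Type*} [Ring E] [Ring Q] {ι : Type}

/-- Multiplication operators on a bimodule: left by `x i` and right by `d i`. -/
def biU (l : E →+* Q) (r : Eᵐᵒᵖ →+* Q) (x d : ι → E) : ι ⊕ ι → Q :=
  Sum.elim (fun i ↦ l (x i)) (fun i ↦ r (op (d i)))

/-- Inner derivations on a bimodule: by `d i` and by `-x i`. -/
def biD (l : E →+* Q) (r : Eᵐᵒᵖ →+* Q) (x d : ι → E) : ι ⊕ ι → Q :=
  Sum.elim (fun i ↦ l (d i) - r (op (d i))) (fun i ↦ r (op (x i)) - l (x i))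

/-- Frobenius is additive on the commuting elements `a - b` and `b`. -/
lemma sub_pow_prime_eq_zero {Q : Type*} [Ring Q] (p : ℕ) [Fact p.Prime] (hQ : (p : Q) = 0) {a b : Q}
    (h : Commute a b) (hab : a ^ p = b ^ p) : (a - b) ^ p = 0 := by
  obtain ⟨r, hr⟩ := (h.symm.sub_right (Commute.refl b)).exists_add_pow_prime_eq
    (Fact.out : p.Prime)
  rw [add_sub_cancel, hQ, zero_mul, zero_mul, zero_mul, add_zero, hab] at hr
  exact left_eq_add.1 hr

/-- Left and right multiplications commute, and the right ones satisfy the opposite relations, so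
the inner derivations are dual to the chosen multiplications. Their `p`-th powers are differences of
left and right multiplication by the central elements `d i ^ p` and `x i ^ p`, hence zero by `hs`.
-/
lemma WeylRel.isWeylFamily {p : ℕ} [Fact p.Prime]
    {x d : ι → E} (h : WeylRel p x d) (l : E →+* Q) (r : Eᵐᵒᵖ →+* Q)
    (hlr : ∀ a b, Commute (l a) (r b)) (hs : ∀ z, (∀ e, Commute z e) → l z = r (op z)) :
    IsWeylFamily p (biU l r x d) (biD l r x d) := by
  have hQ : (p : Q) = 0 := by rw [← map_natCast l, h.char, map_zero]
  have hop : ∀ a b : E, Commute a b → Commute (r (op a)) (r (op b)) := fun a b hab ↦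
    (hab.op).map r
  have hx : ∀ i, l (x i) ^ p = r (op (x i)) ^ p := fun i ↦ by
    rw [← map_pow, ← map_pow, ← op_pow, hs _ (h.x_pow i)]
  have hd : ∀ i, l (d i) ^ p = r (op (d i)) ^ p := fun i ↦ by
    rw [← map_pow, ← map_pow, ← op_pow, hs _ (h.d_pow i)]
  refine ⟨?_, ?_, ?_, ?_, ?_, hQ⟩
  · rintro (i | i) (j | j)
    · exact (h.x_comm i j).map l
    · exact hlr _ _
    · exact (hlr _ _).symm
    · exact hop _ _ (h.d_comm i j)
  -- For `i = j` the constant `1` arises once from the left and once from the right multiplications,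
  -- with opposite signs.
  · have hmix : ∀ i j, Commute (l (d i) - r (op (d i))) (r (op (x j)) - l (x j)) := by
      intro i j
      rcases eq_or_ne i j with rfl | hij
      · have e1 : l (d i) * l (x i) = l (x i) * l (d i) + 1 := by
          rw [← map_mul, h.rel_self]; simp
        have e2 : r (op (x i)) * r (op (d i)) = r (op (d i)) * r (op (x i)) + 1 := by
          rw [← map_mul, ← op_mul, h.rel_self]; simp
        have e3 := (hlr (d i) (op (x i))).eq
        have e4 := (hlr (x i) (op (d i))).eq
        rw [Commute, SemiconjBy, sub_mul, mul_sub, mul_sub, sub_mul, mul_sub, mul_sub, e1, e2, e3, e4]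
        abel
      · exact (((hlr _ _).sub_right ((h.rel i j hij).map l))).sub_left
          ((hop _ _ (h.rel i j hij)).sub_right (hlr _ _).symm)
    rintro (i | i) (j | j)
    · exact (((h.d_comm i j).map l).sub_right (hlr _ _)).sub_left
        ((hlr _ _).symm.sub_right (hop _ _ (h.d_comm i j)))
    · exact hmix i j
    · exact (hmix j i).symm
    · exact ((hop _ _ (h.x_comm i j)).sub_right (hlr _ _).symm).sub_left
        ((hlr _ _).sub_right ((h.x_comm i j).map l))
  · rintro (i | i) (j | j) hij
    · exact ((h.rel i j fun e ↦ hij (e ▸ rfl)).map l).sub_left (hlr _ _).symm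
    · exact (hlr _ _).sub_left (hop _ _ (h.d_comm i j))
    · exact (hlr _ _).symm.sub_left ((h.x_comm i j).map l)
    · exact (hop _ _ (h.rel j i fun e ↦ hij (e ▸ rfl)).symm).sub_left (hlr _ _)
  · rintro (i | i)
    · simp only [biU, biD, Sum.elim_inl, sub_mul, ← map_mul l, h.rel_self]
      simp only [map_add, map_mul, map_one, mul_sub, (hlr (x i) (op (d i))).eq]
      abel
    · have e : r (op (x i)) * r (op (d i)) = r (op (d i)) * r (op (x i)) + 1 := by
        rw [← map_mul, ← op_mul, h.rel_self]; simp
      simp only [biU, biD, Sum.elim_inr, sub_mul, mul_sub, e, (hlr (x i) (op (d i))).eq]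
      abel
  · rintro (i | i)
    · exact sub_pow_prime_eq_zero p hQ (hlr _ _) (hd i)
    · exact sub_pow_prime_eq_zero p hQ (hlr _ _).symm (hx i).symm

/-- The action of noncommutative polynomials on `E` through multiplications and inner
derivations. -/
def weylAct {E : Type*} [Ring E] (x d : ι → E) :
    FreeAlgebra ℤ ((ι ⊕ ι) ⊕ (ι ⊕ ι)) →ₐ[ℤ] AddMonoid.End E :=
  weylEval (biU (Module.toAddMonoidEnd E E) (Module.toAddMonoidEnd Eᵐᵒᵖ E) x d)
    (biD (Module.toAddMonoidEnd E E) (Module.toAddMonoidEnd Eᵐᵒᵖ E) x d)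

/-- Holds because the operators are noncommutative polynomials over `ℤ` in multiplications by `x i`
and `d i`. This is what makes Taylor coefficients compatible with restriction of sections and with
base change. -/
lemma weylAct_map {E E' : Type*} [Ring E] [Ring E'] (f : E →+* E') (x d : ι → E)
    (w : FreeAlgebra ℤ ((ι ⊕ ι) ⊕ (ι ⊕ ι))) (e : E) :
    f (weylAct x d w e) = weylAct (f ∘ x) (f ∘ d) w (f e) := by
  induction w generalizing e with
  | grade0 r => simp
  | grade1 i =>
    rcases i with (i | i) | (i | i) <;> simp only [weylAct, weylEval, biU, biD,
      FreeAlgebra.lift_ι_apply, Sum.elim_inl, Sum.elim_inr]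
    · exact map_mul f (x i) e
    · exact map_mul f e (d i)
    · change f (d i * e - e * d i) = f (d i) * f e - f e * f (d i)
      simp
    · change f (e * x i - x i * e) = f e * f (x i) - f (x i) * f e
      simp
  | mul a b ha hb => rw [map_mul, map_mul]; exact (ha _).trans (congrArg _ (hb _))
  | add a b ha hb =>
    rw [map_add, map_add]
    exact (map_add f _ _).trans (congrArg₂ _ (ha _) (hb _))

lemma weylAct_mul_of_central {E : Type*} [Ring E] (x d : ι → E) {z : E} (hz : ∀ e, Commute z e)
    (w : FreeAlgebra ℤ ((ι ⊕ ι) ⊕ (ι ⊕ ι))) (e : E) :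
    weylAct x d w (z * e) = z * weylAct x d w e := by
  induction w generalizing e with
  | grade0 r =>
    simp only [algebraMap_int_eq, eq_intCast, map_intCast, AddMonoid.End.intCast_apply,
      zsmul_eq_mul]
    rw [← mul_assoc, (Int.cast_commute r z).eq, mul_assoc]
  | grade1 i =>
    rcases i with (i | i) | (i | i) <;> simp only [weylAct, weylEval, biU, biD,
      FreeAlgebra.lift_ι_apply, Sum.elim_inl, Sum.elim_inr]
    · change x i * (z * e) = z * (x i * e)
      rw [← mul_assoc, ← mul_assoc, (hz _).eq]
    · change (z * e) * d i = z * (e * d i)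
      rw [mul_assoc]
    · change d i * (z * e) - (z * e) * d i = z * (d i * e - e * d i)
      rw [← mul_assoc, ← (hz _).eq, mul_sub]
      simp only [mul_assoc]
    · change (z * e) * x i - x i * (z * e) = z * (e * x i - x i * e)
      rw [← mul_assoc, ← (hz _).eq, mul_sub]
      simp only [mul_assoc]
  | mul a b ha hb => rw [map_mul (weylAct x d)]; exact (congrArg _ (hb _)).trans (ha _)
  | add a b ha hb => rw [map_add (weylAct x d)]; exact (congrArg₂ _ (ha _) (hb _)).trans (mul_add _ _ _).symm

end Bimodule

end Weyl


/-! ### Taylor expansion over the center and the Azumaya property -/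

section WeylOver

variable {p : ℕ} [Fact p.Prime] {ι : Type}

lemma WeylRel.isWeylFamily_end {E : Type u} [Ring E] {x d : ι → E} (h : WeylRel p x d) :
    IsWeylFamily p (biU (Module.toAddMonoidEnd E E) (Module.toAddMonoidEnd Eᵐᵒᵖ E) x d)
      (biD (Module.toAddMonoidEnd E E) (Module.toAddMonoidEnd Eᵐᵒᵖ E) x d) :=
  h.isWeylFamily _ _ (fun a b ↦ AddMonoidHom.ext fun e ↦ (mul_assoc a e b.unop).symm)
    (fun _ hz ↦ AddMonoidHom.ext fun e ↦ hz e)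

omit [Fact p.Prime] in
/-- Elements in the kernel of all inner derivations are central. -/
lemma WeylOver.mem_range_of_biD {S E : Type u} [CommRing S] [Ring E] {ψ : S →+* E} {x d : ι → E}
    (h : WeylOver p ψ x d) {e : E} (he : ∀ j, biD (Module.toAddMonoidEnd E E)
      (Module.toAddMonoidEnd Eᵐᵒᵖ E) x d j e = 0) : e ∈ Set.range ψ :=
  h.centralizer e (fun i ↦ (sub_eq_zero.1 (he (.inr i))).symm)
    (fun i ↦ sub_eq_zero.1 (he (.inl i)))

variable (p ι) in
/-- Taylor expansion in the coordinates `x` and `d`, with universal coefficient operators. -/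
lemma exists_weyl_coordinates [Finite ι] :
    ∃ (Γ : Type) (_ : Fintype Γ) (a c : Γ → FreeAlgebra ℤ ((ι ⊕ ι) ⊕ (ι ⊕ ι)))
      (Φ : FreeAlgebra ℤ ((ι ⊕ ι) ⊕ (ι ⊕ ι))),
      (∀ (E : Type u) [Ring E] (x d : ι → E), WeylRel p x d →
        ∀ e, (∀ i, Commute (x i) e) → (∀ i, Commute (d i) e) → weylAct x d Φ e = e) ∧
      ∀ (S E : Type u) [CommRing S] [Ring E] (ψ : S →+* E) (x d : ι → E), WeylOver p ψ x d →
        (∀ e γ, weylAct x d (c γ) e ∈ Set.range ψ) ∧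
        (∀ e, e = ∑ γ, weylAct x d (c γ) e * weylAct x d (a γ) 1) ∧
        (∀ e, weylAct x d Φ e ∈ Set.range ψ) := by
  have := Fintype.ofFinite ι
  obtain ⟨Γ, hΓ, a, θ, Φ, h⟩ := exists_weyl_resolution.{u} p (Finset.univ : Finset (ι ⊕ ι))
  refine ⟨Γ, hΓ, a, fun γ ↦ Φ * θ γ, Φ, fun E _ x d hE e hx hd ↦ ?_,
    fun S E _ _ ψ x d hψ ↦ ?_⟩
  · obtain ⟨-, -, -, h4, -, -⟩ := h (AddMonoid.End E) _ _ hE.isWeylFamily_end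
    refine h4 E e ?_
    rintro (i | i) -
    · exact sub_eq_zero.2 (hd i).eq
    · exact sub_eq_zero.2 (hx i).eq.symm
  obtain ⟨h1, -, -, h4, h5, h6⟩ := h (AddMonoid.End E) _ _ hψ.isWeylFamily_end
  have hΦ : ∀ e, weylAct x d Φ e ∈ Set.range ψ := fun e ↦ hψ.mem_range_of_biD fun j ↦
    congr($(h5 j (Finset.mem_univ j)) e)
  refine ⟨fun e γ ↦ ?_, fun e ↦ ?_, hΦ⟩
  · rw [map_mul]; exact hΦ _
  · have e1 : e = ∑ γ, weylAct x d (a γ) (weylAct x d Φ (weylAct x d (θ γ) e)) := by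
      let eval : AddMonoid.End E →+ E :=
        { toFun := fun f ↦ f e, map_zero' := rfl, map_add' := fun _ _ ↦ rfl }
      have := congrArg eval h6
      rw [map_sum] at this
      exact this.symm
    refine e1.trans (Finset.sum_congr rfl fun γ _ ↦ ?_)
    rw [map_mul]
    change _ = weylAct x d Φ (weylAct x d (θ γ) e) * _
    obtain ⟨s, hs⟩ := hΦ (weylAct x d (θ γ) e)
    rw [← hs]
    -- The operator `a γ` is built from left multiplications by `x i` and right multiplications by
    -- `d i`, both linear over `S`, so its value at `ψ s` is `ψ s` times its value at `1`.
    have := h1 (Module.toAddMonoidEnd E E (ψ s)) (by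
      rintro (i | i) -
      · exact ((hψ.central s (x i)).map (Module.toAddMonoidEnd E E))
      · exact AddMonoidHom.ext fun e ↦ (mul_assoc (ψ s) e (d i)).symm) γ
    have := congr($(this.eq) 1)
    change ψ s * weylAct x d (a γ) 1 = weylAct x d (a γ) (ψ s * 1) at this
    rw [this, mul_one]

open TensorProduct MulOpposite in
/-- An algebra generated by Weyl relations over its center is Azumaya. -/
theorem WeylOver.isAzumaya {S E : Type u} [CommRing S] [Ring E] [Algebra S E] [Finite ι]
    {x d : ι → E} (h : WeylOver p (algebraMap S E) x d) : IsAzumaya S E := by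
  obtain ⟨Γ₁, hΓ₁, a₁, c₁, Φ₁, -, h₁⟩ := exists_weyl_coordinates.{u} p ι
  obtain ⟨hc, hsum, -⟩ := h₁ S E _ x d h
  have : Fintype ι := Fintype.ofFinite ι
  choose f hf using hc
  have hfaith : FaithfulSMul S E := (faithfulSMul_iff_algebraMap_injective S E).2 h.inj
  have hinj := h.inj
  have hact : ∀ (w : FreeAlgebra ℤ ((ι ⊕ ι) ⊕ (ι ⊕ ι))) (s : S) (e : E),
      weylAct x d w (s • e) = s • weylAct x d w e := by
    intro w s e
    rw [Algebra.smul_def, Algebra.smul_def, weylAct_mul_of_central x d (h.central s)]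
  -- The Taylor coefficients are `S`-linear functionals. With the elements `weylAct x d (a₁ γ) 1`
  -- they form a finite dual basis of `E` over `S`.
  let F : Γ₁ → (E →ₗ[S] S) := fun γ ↦
    { toFun := fun e ↦ f e γ
      map_add' := fun e e' ↦ hinj (by simp only [map_add, hf])
      map_smul' := fun s e ↦ hinj (by
        simp only [hf, hact, RingHom.id_apply, smul_eq_mul, map_mul]; rw [Algebra.smul_def]) }
  have hF : ∀ e, e = ∑ γ, F γ e • weylAct x d (a₁ γ) 1 := fun e ↦ by
    conv_lhs => rw [hsum e]
    exact Finset.sum_congr rfl fun γ _ ↦ by rw [Algebra.smul_def]; exact congrArg (· * _) (hf e γ).symm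
  have hproj : Module.Projective S E := by
    refine Module.Projective.of_split (P := E) (M := Γ₁ → S) (LinearMap.pi F)
      (Fintype.linearCombination S fun γ ↦ weylAct x d (a₁ γ) 1) (LinearMap.ext fun e ↦ ?_)
    rw [LinearMap.comp_apply, Fintype.linearCombination_apply]
    exact (hF e).symm
  have hfin : Module.Finite S E := by
    refine Module.Finite.of_surjective (M := Γ₁ → S)
      (Fintype.linearCombination S fun γ ↦ weylAct x d (a₁ γ) 1) fun e ↦ ⟨fun γ ↦ F γ e, ?_⟩
    rw [Fintype.linearCombination_apply]
    exact (hF e).symm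
  refine ⟨?_⟩
  obtain ⟨Γ, hΓ, a, θ, Φ, hΓΦ⟩ := exists_weyl_resolution.{u} p (Finset.univ : Finset (ι ⊕ ι))
  let l : E →+* (E ⊗[S] Eᵐᵒᵖ) := (Algebra.TensorProduct.includeLeft : E →ₐ[S] (E ⊗[S] Eᵐᵒᵖ)).toRingHom
  let r : Eᵐᵒᵖ →+* (E ⊗[S] Eᵐᵒᵖ) := (Algebra.TensorProduct.includeRight : Eᵐᵒᵖ →ₐ[S] (E ⊗[S] Eᵐᵒᵖ)).toRingHom
  have hl : ∀ a, l a = a ⊗ₜ 1 := fun _ ↦ rfl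
  have hr : ∀ b, r b = 1 ⊗ₜ b := fun _ ↦ rfl
  have hlrt : ∀ a b, l a * r b = a ⊗ₜ b := fun a b ↦ by
    change (a ⊗ₜ[S] (1 : Eᵐᵒᵖ)) * ((1 : E) ⊗ₜ[S] b) = _
    rw [Algebra.TensorProduct.tmul_mul_tmul, mul_one, one_mul]
  have hlr : ∀ a b, Commute (l a) (r b) := fun a b ↦ by
    change (a ⊗ₜ[S] (1 : Eᵐᵒᵖ)) * ((1 : E) ⊗ₜ[S] b) = ((1 : E) ⊗ₜ[S] b) * (a ⊗ₜ[S] (1 : Eᵐᵒᵖ))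
    rw [Algebra.TensorProduct.tmul_mul_tmul, Algebra.TensorProduct.tmul_mul_tmul, mul_one, one_mul,
      mul_one, one_mul]
  have hs : ∀ s : S, l (algebraMap S E s) = r (op (algebraMap S E s)) := fun s ↦ by
    rw [hl, hr, Algebra.algebraMap_eq_smul_one, ← TensorProduct.smul_tmul', MulOpposite.op_smul,
      TensorProduct.tmul_smul]
    rfl
  obtain ⟨-, -, h3, -, h5, h6⟩ := hΓΦ (E ⊗[S] Eᵐᵒᵖ) _ _ (h.isWeylFamily l r hlr fun z hz ↦ by
    obtain ⟨s, rfl⟩ := h.centralizer z (fun i ↦ (hz _).symm) (fun i ↦ (hz _).symm)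
    exact hs s)
  set U := biU l r x d with hU
  set Δ := biD l r x d with hΔ
  set ev := weylEval U Δ
  let m := AlgHom.mulLeftRight S E
  let _ : Module (E ⊗[S] Eᵐᵒᵖ) E := Module.compHom E m.toRingHom
  have hsmul : ∀ (t : (E ⊗[S] Eᵐᵒᵖ)) (e : E), t • e = m t e := fun _ _ ↦ rfl
  have hml : ∀ b e, m (l b) e = b * e := fun b e ↦ by simp [m, hl]
  have hmr : ∀ b e, m (r b) e = e * b.unop := fun b e ↦ by simp [m, hr]
  have hcent : ∀ e, m (ev Φ) e ∈ Set.range (algebraMap S E) := by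
    intro e
    have key : ∀ j, m (Δ j) (m (ev Φ) e) = 0 := fun j ↦ by
      rw [← Module.End.mul_apply, ← map_mul, h5 j (Finset.mem_univ j), map_zero]; rfl
    refine h.centralizer _ (fun i ↦ ?_) (fun i ↦ ?_)
    · have := key (.inr i)
      simp only [hΔ, biD, Sum.elim_inr, map_sub, LinearMap.sub_apply, hml, hmr] at this
      exact (sub_eq_zero.1 this).symm
    · have := key (.inl i)
      simp only [hΔ, biD, Sum.elim_inl, map_sub, LinearMap.sub_apply, hml, hmr] at this
      exact sub_eq_zero.1 this
  have hm1 : ∀ e, e = ∑ γ, m (ev (a γ)) (m (ev Φ) (m (ev (θ γ)) e)) := by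
    intro e
    have := congr(m $h6 e)
    simpa [map_sum] using this.symm
  -- The elements whose left and right multiplications agree on `Φ`. They are closed under products
  -- and contain `x i`, `d i` and `S`; Taylor expansion then shows that they are all of `E`.
  let N : AddSubgroup E :=
    { carrier := {b | l b * ev Φ = r (op b) * ev Φ}
      zero_mem' := by simp
      add_mem' := fun {b b'} hb hb' ↦ by
        simp only [Set.mem_ofPred_eq, map_add, MulOpposite.op_add, add_mul] at hb hb' ⊢
        rw [hb, hb']
      neg_mem' := fun {b} hb ↦ by
        simp only [Set.mem_ofPred_eq, map_neg, MulOpposite.op_neg] at hb ⊢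
        exact (neg_mul _ _).trans ((congrArg Neg.neg hb).trans (neg_mul _ _).symm) }
  have hNmul : ∀ b b', b ∈ N → b' ∈ N → b * b' ∈ N := fun b b' hb hb' ↦ by
    change l (b * b') * ev Φ = r (op (b * b')) * ev Φ
    change l b * ev Φ = r (op b) * ev Φ at hb
    change l b' * ev Φ = r (op b') * ev Φ at hb'
    rw [map_mul, mul_assoc, hb', ← mul_assoc, (hlr _ _).eq, mul_assoc, hb, MulOpposite.op_mul, map_mul, mul_assoc]
  have hNx : ∀ i, x i ∈ N := fun i ↦ by
    have := h5 (.inr i) (Finset.mem_univ _)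
    simp only [hΔ, biD, Sum.elim_inr, sub_mul] at this
    exact (sub_eq_zero.1 this).symm
  have hNd : ∀ i, d i ∈ N := fun i ↦ by
    have := h5 (.inl i) (Finset.mem_univ _)
    simp only [hΔ, biD, Sum.elim_inl, sub_mul] at this
    exact sub_eq_zero.1 this
  have hNs : ∀ s : S, algebraMap S E s ∈ N := fun s ↦ congrArg (· * _) (hs s)
  have hN : ∀ b, b ∈ N := by
    intro b
    rw [hm1 b]
    refine sum_mem fun γ _ ↦ ?_
    obtain ⟨s, hs'⟩ := hcent (m (ev (θ γ)) b)
    rw [← hs']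
    refine h3 E N ?_ γ _ (hNs s)
    rintro (i | i) b hb
    · rw [hsmul]; simp only [hU, biU, Sum.elim_inl, hml]; exact hNmul _ _ (hNx i) hb
    · rw [hsmul]; simp only [hU, biU, Sum.elim_inr, hmr]; exact hNmul _ _ hb (hNd i)
  -- On the left ideal generated by `Φ`, right multiplications can be traded for left ones. So `t *
  -- Φ` depends only on the value at `1` of the endomorphism given by `t`, which yields injectivity
  -- after inserting the resolution of `1`.
  have htΦ : ∀ t : (E ⊗[S] Eᵐᵒᵖ), t * ev Φ = l (m t 1) * ev Φ := by
    intro t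
    induction t with
    | zero => simp
    | add t t' ht ht' => rw [add_mul, ht, ht', map_add, LinearMap.add_apply, map_add, add_mul]
    | tmul b b' =>
      have e1 : m (b ⊗ₜ[S] b') 1 = b * b'.unop := by simp [m]
      rw [e1, ← hlrt, mul_assoc, map_mul, mul_assoc]
      congr 1
      exact (hN b'.unop).symm
  constructor
  · rw [injective_iff_map_eq_zero]
    intro t ht
    change m t = 0 at ht
    calc t = t * 1 := (mul_one t).symm
      _ = ∑ γ, (t * ev (a γ)) * ev Φ * ev (θ γ) := by
        rw [← h6, Finset.mul_sum]; simp only [mul_assoc]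
      _ = 0 := Finset.sum_eq_zero fun γ _ ↦ by
        rw [htΦ, map_mul, ht]; simp
  · intro g
    -- Expand `e` as a combination of the values `a γ` at `1` with scalar coefficients `Φ (θ γ e)`,
    -- and apply the `S`-linear map `g` termwise.
    refine ⟨∑ γ, l (g (m (ev (a γ)) 1)) * ev Φ * ev (θ γ), LinearMap.ext fun e ↦ ?_⟩
    change m _ e = g e
    conv_rhs => rw [hm1 e]
    rw [map_sum, LinearMap.sum_apply, map_sum]
    refine Finset.sum_congr rfl fun γ _ ↦ ?_
    obtain ⟨s, hs'⟩ := hcent (m (ev (θ γ)) e)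
    rw [map_mul, map_mul, Module.End.mul_apply, Module.End.mul_apply, hml, ← hs',
      Algebra.algebraMap_eq_smul_one, map_smul, map_smul, mul_smul_comm, mul_one]

end WeylOver

/-! ### Base change along a central homomorphism -/

section CentralTensor

open TensorProduct

variable {S B E : Type u} [CommRing S] [CommRing B] [Ring E] (φ : S →+* B) (ψ : S →+* E)
  (hψ : ∀ s e, Commute (ψ s) e)

/-- The base change `B ⊗ E` of a ring `E` over a central subring along a ring homomorphism. -/
def CentralTensor : Type u :=
  letI := φ.toAlgebra
  letI := ψ.toAlgebra' hψ
  B ⊗[S] E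

namespace CentralTensor

instance : Ring (CentralTensor φ ψ hψ) :=
  letI := φ.toAlgebra
  letI := ψ.toAlgebra' hψ
  (Algebra.TensorProduct.instRing : Ring (B ⊗[S] E))

/-- The map from the new coefficients to the base change. -/
def inl : B →+* CentralTensor φ ψ hψ :=
  letI := φ.toAlgebra
  letI := ψ.toAlgebra' hψ
  (Algebra.TensorProduct.includeLeft : B →ₐ[S] B ⊗[S] E).toRingHom

/-- The map from the ring to its base change. -/
def inr : E →+* CentralTensor φ ψ hψ :=
  letI := φ.toAlgebra
  letI := ψ.toAlgebra' hψ
  (Algebra.TensorProduct.includeRight : E →ₐ[S] B ⊗[S] E).toRingHom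

lemma inl_inr (s : S) : inl φ ψ hψ (φ s) = inr φ ψ hψ (ψ s) := by
  letI := φ.toAlgebra
  letI := ψ.toAlgebra' hψ
  exact (Algebra.TensorProduct.includeLeft : B →ₐ[S] B ⊗[S] E).commutes s |>.trans
    ((Algebra.TensorProduct.includeRight : E →ₐ[S] B ⊗[S] E).commutes s).symm

lemma commute (b : B) (e : CentralTensor φ ψ hψ) : Commute (inl φ ψ hψ b) e := by
  letI := φ.toAlgebra
  letI := ψ.toAlgebra' hψ
  change B ⊗[S] E at e
  induction e with
  | zero => exact Commute.zero_right _
  | add e e' h h' => exact Commute.add_right h h'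
  | tmul b' e =>
    change (b ⊗ₜ[S] (1 : E)) * (b' ⊗ₜ[S] e) = (b' ⊗ₜ[S] e) * (b ⊗ₜ[S] (1 : E))
    simp [mul_comm]

variable {φ ψ hψ} in
lemma induction {P : CentralTensor φ ψ hψ → Prop}
    (tmul : ∀ b e, P (inl φ ψ hψ b * inr φ ψ hψ e)) (add : ∀ x y, P x → P y → P (x + y)) (x) :
    P x := by
  letI := φ.toAlgebra
  letI := ψ.toAlgebra' hψ
  refine TensorProduct.induction_on (R := S) (M := B) (N := E) (motive := P) x ?_ ?_ add
  · have : P (0 : CentralTensor φ ψ hψ) := by simpa using tmul 0 0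
    exact this
  · intro b e
    have := tmul b e
    change P ((b ⊗ₜ[S] (1 : E)) * ((1 : B) ⊗ₜ[S] e)) at this
    simpa using this

variable {φ ψ} in
/-- The universal property of the base change. -/
def lift {R : Type u} [Ring R] (f : B →+* R) (g : E →+* R) (hc : ∀ b r, Commute (f b) r)
    (h : ∀ s, f (φ s) = g (ψ s)) : CentralTensor φ ψ hψ →+* R :=
  letI := φ.toAlgebra
  letI := ψ.toAlgebra' hψ
  letI : Algebra S R := (f.comp φ).toAlgebra' fun s r ↦ hc (φ s) r
  (Algebra.TensorProduct.lift (A := B) (B := E) (C := R) (R := S) (S := S)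
    { f with commutes' := fun _ ↦ rfl } { g with commutes' := fun s ↦ (h s).symm }
    fun b e ↦ hc b (g e) : B ⊗[S] E →ₐ[S] R).toRingHom

section

variable {R : Type u} [Ring R] (f : B →+* R) (g : E →+* R) (hc : ∀ b r, Commute (f b) r)
    (h : ∀ s, f (φ s) = g (ψ s))

@[simp] lemma lift_inl (b : B) : lift hψ f g hc h (inl φ ψ hψ b) = f b := by
  letI := φ.toAlgebra
  letI := ψ.toAlgebra' hψ
  letI : Algebra S R := (f.comp φ).toAlgebra' fun s r ↦ hc (φ s) r
  refine (Algebra.TensorProduct.lift_tmul (A := B) (B := E) (C := R) (R := S) (S := S)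
    { f with commutes' := fun _ ↦ rfl } { g with commutes' := fun s ↦ (h s).symm }
    (fun b e ↦ hc b (g e)) b 1).trans ?_
  change f b * g 1 = f b
  simp

@[simp] lemma lift_inr (e : E) : lift hψ f g hc h (inr φ ψ hψ e) = g e := by
  letI := φ.toAlgebra
  letI := ψ.toAlgebra' hψ
  letI : Algebra S R := (f.comp φ).toAlgebra' fun s r ↦ hc (φ s) r
  refine (Algebra.TensorProduct.lift_tmul (A := B) (B := E) (C := R) (R := S) (S := S)
    { f with commutes' := fun _ ↦ rfl } { g with commutes' := fun s ↦ (h s).symm }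
    (fun b e ↦ hc b (g e)) 1 e).trans ?_
  change f 1 * g e = g e
  simp

end

variable {φ ψ hψ} in
lemma hom_ext {R : Type*} [Ring R] {f g : CentralTensor φ ψ hψ →+* R}
    (h₁ : ∀ b, f (inl φ ψ hψ b) = g (inl φ ψ hψ b)) (h₂ : ∀ e, f (inr φ ψ hψ e) = g (inr φ ψ hψ e)) :
    f = g :=
  RingHom.ext fun x ↦ induction (P := fun x ↦ f x = g x) (fun b e ↦ by rw [map_mul, map_mul, h₁, h₂])
    (fun x y hx hy ↦ by rw [map_add, map_add, hx, hy]) x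

/-- A retraction to the coefficients extends to the base change. -/
lemma inl_injective (τ : E →+ S) (hτ : ∀ s e, τ (ψ s * e) = s * τ e) (h1 : τ 1 = 1) :
    Function.Injective (inl φ ψ hψ) := by
  letI := φ.toAlgebra
  letI := ψ.toAlgebra' hψ
  let τ' : E →ₗ[S] S := { τ with map_smul' := fun s e ↦ (congrArg τ (Algebra.smul_def s e)).trans (hτ s e) }
  let m : B ⊗[S] E →ₗ[S] B := (TensorProduct.rid S B).toLinearMap ∘ₗ TensorProduct.map LinearMap.id τ'
  have : ∀ b, m (inl φ ψ hψ b) = b := fun b ↦ by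
    change TensorProduct.rid S B (b ⊗ₜ τ 1) = b
    simp [h1]
  exact Function.LeftInverse.injective (g := m) this

end CentralTensor

/-- Weyl relations over the center are preserved by base change of the center. -/
lemma WeylOver.baseChange {p : ℕ} [Fact p.Prime] {ι : Type} [Finite ι] {ψ : S →+* E} {x d : ι → E}
    (h : WeylOver p ψ x d) {T : Type u} [Ring T] (l : B →+* T) (r : E →+* T)
    (hl : ∀ b t, Commute (l b) t) (hlr : ∀ s, l (φ s) = r (ψ s)) (hinj : Function.Injective l)
    (hgen : ∀ N : AddSubgroup T, (∀ b e, l b * r e ∈ N) → ∀ t, t ∈ N) :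
    WeylOver p l (r ∘ x) (r ∘ d) := by
  obtain ⟨Γ, hΓ, a, c, Φ, hΦ', hΦ⟩ := exists_weyl_coordinates.{u} p ι
  obtain ⟨h1, h2, h3⟩ := hΦ S E ψ x d h
  have hpow : ∀ e, (∀ e', Commute e e') → ∀ e', Commute (r e) e' := fun e he e' ↦ by
    have := hgen (AddMonoidHom.ker (AddMonoidHom.mulLeft (r e) - AddMonoidHom.mulRight (r e)))
      (fun b e' ↦ sub_eq_zero.2 ((hl b _).symm.mul_right ((he e').map r)).eq) e'
    exact sub_eq_zero.1 this
  have hrel : WeylRel p (r ∘ x) (r ∘ d) := by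
    refine ⟨fun i j ↦ (h.x_comm i j).map r, fun i j ↦ (h.d_comm i j).map r,
      fun i j hij ↦ (h.rel i j hij).map r, fun i ↦ ?_, ?_, fun i e ↦ ?_, fun i e ↦ ?_⟩
    · simp only [Function.comp_apply, ← map_mul, h.rel_self]; simp
    · rw [← map_natCast r, h.char, map_zero]
    · simp only [Function.comp_apply, ← map_pow]; exact hpow _ (h.x_pow i) e
    · simp only [Function.comp_apply, ← map_pow]; exact hpow _ (h.d_pow i) e
  refine ⟨hrel, hl, hinj, fun e hx hd ↦ ?_⟩
  -- An element commuting with all coordinates is fixed by `Φ`, so it suffices that `Φ` maps `T`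
  -- into the range of `l`. By additivity and linearity over the center this may be checked on
  -- products `l b * r e'`, where it follows from the property of `Φ` on `E`. Only `WeylRel` is
  -- available for `T` at this point, which is why the fixing property of `Φ` was established under
  -- that weaker assumption.
  rw [← hΦ' _ _ _ hrel e hx hd]
  refine hgen (l.range.toAddSubgroup.comap (weylAct (r ∘ x) (r ∘ d) Φ)) (fun b e' ↦ ?_) e
  obtain ⟨s, hs⟩ := h3 e'
  refine ⟨b * φ s, Eq.trans ?_ (weylAct_mul_of_central (r ∘ x) (r ∘ d) (hl b) Φ (r e')).symm⟩
  rw [← weylAct_map r, ← hs, map_mul, hlr]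

/-- The projection to the center. -/
lemma WeylOver.exists_retraction {p : ℕ} [Fact p.Prime] {ι : Type} [Finite ι] {ψ : S →+* E}
    {x d : ι → E} (h : WeylOver p ψ x d) :
    ∃ τ : E →+ S, (∀ s e, τ (ψ s * e) = s * τ e) ∧ τ 1 = 1 := by
  obtain ⟨Γ, hΓ, a, c, Φ, hΦ', hΦ⟩ := exists_weyl_coordinates.{u} p ι
  obtain ⟨h1, h2, h3⟩ := hΦ S E ψ x d h
  choose τ hτ using h3
  have hinj := h.inj
  refine ⟨AddMonoidHom.mk' τ fun e e' ↦ hinj ?_, fun s e ↦ hinj ?_, hinj ?_⟩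
  · rw [map_add, hτ, hτ, hτ, map_add]
  · change ψ (τ (ψ s * e)) = ψ (s * τ e)
    rw [map_mul, hτ, hτ,
      weylAct_mul_of_central x d (h.central s)]
  · change ψ (τ 1) = ψ 1
    rw [hτ, map_one ψ]
    exact hΦ' E x d h.toWeylRel 1 (fun _ ↦ Commute.one_right _) (fun _ ↦ Commute.one_right _)

lemma WeylOver.centralTensor {p : ℕ} [Fact p.Prime] {ι : Type} [Finite ι] {ψ : S →+* E} {x d : ι → E}
    (h : WeylOver p ψ x d) :
    WeylOver p (CentralTensor.inl φ ψ h.central) (CentralTensor.inr φ ψ h.central ∘ x)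
      (CentralTensor.inr φ ψ h.central ∘ d) := by
  obtain ⟨τ, hτ, h1⟩ := h.exists_retraction
  exact h.baseChange φ _ _ (CentralTensor.commute φ ψ h.central) (CentralTensor.inl_inr φ ψ h.central)
    (CentralTensor.inl_injective φ ψ h.central τ hτ h1)
    fun N hN t ↦ CentralTensor.induction (P := (· ∈ N)) hN (fun _ _ ↦ add_mem) t

end CentralTensor


/-! ### Enveloping algebras in local coordinates -/

section PBW

/-- A Lie algebroid `L` over `A` which acts on `A` by derivations and has coordinates `x` with dual
vector fields `d`. -/
structure LieCoordinates (A L : Type u) [CommRing A] [LieRing L] [Module A L] [LieRingModule L A]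
    {ι : Type} (x : ι → A) (d : ι → L) : Prop where
  leibniz : ∀ (D : L) (a b : A), ⁅D, a * b⁆ = a * ⁅D, b⁆ + b * ⁅D, a⁆
  smul_lie : ∀ (a : A) (D : L) (b : A), ⁅a • D, b⁆ = a * ⁅D, b⁆
  dual_self : ∀ i, ⁅d i, x i⁆ = 1
  dual_ne : ∀ i j, i ≠ j → ⁅d i, x j⁆ = 0
  ext : ∀ D : L, (∀ i, ⁅D, x i⁆ = 0) → D = 0

namespace LieCoordinates

open MvPolynomial

variable {A L : Type u} [CommRing A] [LieRing L] [Module A L] [LieRingModule L A]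
  {ι : Type} [Fintype ι] {x : ι → A} {d : ι → L}

lemma dual [DecidableEq ι] (h : LieCoordinates A L x d) (i j : ι) :
    ⁅d i, x j⁆ = if i = j then 1 else 0 := by
  split_ifs with hij
  · rw [← hij, h.dual_self]
  · exact h.dual_ne i j hij

lemma lie_one (h : LieCoordinates A L x d) (D : L) : ⁅D, (1 : A)⁆ = 0 := by
  have := h.leibniz D 1 1
  simpa using this

/-- Both sides act in the same way on the coordinates. -/
lemma eq_sum (h : LieCoordinates A L x d) (D : L) : D = ∑ i, ⁅D, x i⁆ • d i := by
  classical
  rw [← sub_eq_zero]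
  refine h.ext _ fun j ↦ ?_
  rw [sub_lie, sum_lie]
  simp [h.smul_lie, h.dual]

lemma d_comm (h : LieCoordinates A L x d) (i j : ι) : ⁅d i, d j⁆ = 0 := by
  classical
  refine h.ext _ fun l ↦ ?_
  rw [lie_lie, h.dual, h.dual]
  split_ifs <;> simp [h.lie_one]

/-- The derivation of `A` given by an element of the Lie algebroid. -/
def der (h : LieCoordinates A L x d) (D : L) : Derivation ℤ A A :=
  .mk' (AddMonoidHom.toIntLinearMap ⟨⟨fun a ↦ ⁅D, a⁆, lie_zero D⟩, lie_add D⟩) (h.leibniz D)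

@[simp] lemma der_apply (h : LieCoordinates A L x d) (D : L) (a : A) : h.der D a = ⁅D, a⁆ := rfl

/-- The coefficientwise action on polynomials. -/
def coeffDer (h : LieCoordinates A L x d) (D : L) : MvPolynomial ι A →+ MvPolynomial ι A where
  toFun m := .ofCoeff (Finsupp.mapRange (fun a ↦ ⁅D, a⁆) (lie_zero D) (AddMonoidAlgebra.coeff m))
  map_zero' := AddMonoidAlgebra.coeff_injective (Finsupp.mapRange_zero (hf := lie_zero D))
  map_add' m n := AddMonoidAlgebra.coeff_injective
    (Finsupp.mapRange_add (hf := lie_zero D) (lie_add D) (AddMonoidAlgebra.coeff m) (AddMonoidAlgebra.coeff n))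

@[simp] lemma coeff_coeffDer (h : LieCoordinates A L x d) (D : L) (m : MvPolynomial ι A) (α : ι →₀ ℕ) :
    (h.coeffDer D m).coeff α = ⁅D, m.coeff α⁆ := rfl

lemma coeffDer_mul (h : LieCoordinates A L x d) (D : L) (m n : MvPolynomial ι A) :
    h.coeffDer D (m * n) = m * h.coeffDer D n + n * h.coeffDer D m := by
  classical
  ext α
  rw [mul_comm n]
  simp only [coeff_coeffDer, coeff_mul, coeff_add]
  rw [← Finset.sum_add_distrib]
  change h.der D _ = _
  rw [map_sum]
  exact Finset.sum_congr rfl fun _ _ ↦ by rw [der_apply, h.leibniz]; ring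

@[simp] lemma coeffDer_C (h : LieCoordinates A L x d) (D : L) (a : A) :
    h.coeffDer D (C a) = C ⁅D, a⁆ := by
  classical
  ext α
  simp only [coeff_coeffDer, coeff_C]
  split_ifs <;> simp

@[simp] lemma coeffDer_X (h : LieCoordinates A L x d) (D : L) (i : ι) :
    h.coeffDer D (X i) = 0 := by
  classical
  ext α
  simp only [coeff_coeffDer, coeff_X]
  split_ifs <;> simp [h.lie_one]

/-- The symbol of an element of the Lie algebroid. -/
def symbol (x : ι → A) (D : L) : MvPolynomial ι A := ∑ i, C ⁅D, x i⁆ * X i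

lemma symbol_add (D E : L) : symbol x (D + E) = symbol x D + symbol x E := by
  simp [symbol, add_mul, Finset.sum_add_distrib]

lemma symbol_smul (h : LieCoordinates A L x d) (a : A) (D : L) :
    symbol x (a • D) = C a * symbol x D := by
  simp [symbol, h.smul_lie, Finset.mul_sum, mul_assoc]

lemma symbol_d (h : LieCoordinates A L x d) (i : ι) : symbol x (d i) = X i := by
  classical
  simp only [symbol, h.dual]
  rw [Finset.sum_eq_single i (fun j _ hj ↦ by simp [hj.symm]) (by simp)]
  simp

lemma coeffDer_symbol (h : LieCoordinates A L x d) (D E : L) :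
    h.coeffDer D (symbol x E) = ∑ i, C ⁅D, ⁅E, x i⁆⁆ * X i := by
  simp only [symbol, map_sum, coeffDer_mul, coeffDer_C, coeffDer_X]
  exact Finset.sum_congr rfl fun i _ ↦ by ring

/-- The action of the Lie algebroid on polynomials: multiplication by the symbol plus the
coefficientwise action. -/
def vecAct (h : LieCoordinates A L x d) : L →+ AddMonoid.End (MvPolynomial ι A) where
  toFun D := AddMonoidHom.mulLeft (symbol x D) + h.coeffDer D
  map_zero' := by
    ext1 m
    change symbol x (0 : L) * m + h.coeffDer 0 m = 0
    have : h.coeffDer 0 m = 0 := by ext α; simp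
    rw [this]; simp [symbol]
  map_add' D E := by
    ext1 m
    change symbol x (D + E) * m + h.coeffDer (D + E) m =
      (symbol x D * m + h.coeffDer D m) + (symbol x E * m + h.coeffDer E m)
    have : h.coeffDer (D + E) m = h.coeffDer D m + h.coeffDer E m := by ext α; simp
    rw [this, symbol_add]
    ring

/-- The enveloping algebra acts on polynomials. -/
def act (h : LieCoordinates A L x d) : Envelope A L →+* AddMonoid.End (MvPolynomial ι A) :=
  Envelope.lift ((Module.toAddMonoidEnd (MvPolynomial ι A) (MvPolynomial ι A)).comp C) h.vecAct
    (fun a D ↦ AddMonoidHom.ext fun m ↦ by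
      change C a * (symbol x D * m + h.coeffDer D m) = symbol x (a • D) * m + h.coeffDer (a • D) m
      have : h.coeffDer (a • D) m = C a * h.coeffDer D m := by ext α; simp [h.smul_lie]
      rw [this, h.symbol_smul]; ring)
    (fun a D ↦ AddMonoidHom.ext fun m ↦ by
      change (symbol x D * (C a * m) + h.coeffDer D (C a * m)) -
        C a * (symbol x D * m + h.coeffDer D m) = C ⁅D, a⁆ * m
      rw [coeffDer_mul, coeffDer_C]; ring)
    (fun D E ↦ AddMonoidHom.ext fun m ↦ by
      change (symbol x D * (symbol x E * m + h.coeffDer E m) +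
          h.coeffDer D (symbol x E * m + h.coeffDer E m)) -
        (symbol x E * (symbol x D * m + h.coeffDer D m) +
          h.coeffDer E (symbol x D * m + h.coeffDer D m)) =
        symbol x ⁅D, E⁆ * m + h.coeffDer ⁅D, E⁆ m
      have e1 : h.coeffDer ⁅D, E⁆ m = h.coeffDer D (h.coeffDer E m) - h.coeffDer E (h.coeffDer D m) := by
        ext α; simp
      have e2 : symbol x ⁅D, E⁆ = h.coeffDer D (symbol x E) - h.coeffDer E (symbol x D) := by
        rw [coeffDer_symbol, coeffDer_symbol]
        simp only [symbol, lie_lie, map_sub, sub_mul, Finset.sum_sub_distrib]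
      rw [e1, e2, map_add, map_add, coeffDer_mul, coeffDer_mul]; ring)

/-- The additive map by which an element of the enveloping algebra acts on polynomials. -/
def app (h : LieCoordinates A L x d) (P : Envelope A L) : MvPolynomial ι A →+ MvPolynomial ι A :=
  h.act P

lemma app_ofFun (h : LieCoordinates A L x d) (a : A) (m : MvPolynomial ι A) :
    h.app (Envelope.ofFun A L a) m = C a * m :=
  DFunLike.congr_fun (F := MvPolynomial ι A →+ MvPolynomial ι A)
    (Envelope.lift_ofFun (R := AddMonoid.End (MvPolynomial ι A)) _ _ _ _ _ a) m

lemma app_ofVec (h : LieCoordinates A L x d) (D : L) (m : MvPolynomial ι A) :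
    h.app (Envelope.ofVec A L D) m = symbol x D * m + h.coeffDer D m :=
  DFunLike.congr_fun (F := MvPolynomial ι A →+ MvPolynomial ι A)
    (Envelope.lift_ofVec (R := AddMonoid.End (MvPolynomial ι A)) _ _ _ _ _ D) m

lemma app_mul (h : LieCoordinates A L x d) (P Q : Envelope A L) (m : MvPolynomial ι A) :
    h.app (P * Q) m = h.app P (h.app Q m) :=
  DFunLike.congr_fun (F := MvPolynomial ι A →+ MvPolynomial ι A) (map_mul h.act P Q) m

lemma app_add (h : LieCoordinates A L x d) (P Q : Envelope A L) (m : MvPolynomial ι A) :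
    h.app (P + Q) m = h.app P m + h.app Q m :=
  DFunLike.congr_fun (F := MvPolynomial ι A →+ MvPolynomial ι A) (map_add h.act P Q) m

lemma app_sub (h : LieCoordinates A L x d) (P Q : Envelope A L) (m : MvPolynomial ι A) :
    h.app (P - Q) m = h.app P m - h.app Q m :=
  DFunLike.congr_fun (F := MvPolynomial ι A →+ MvPolynomial ι A) (map_sub h.act P Q) m

lemma app_one (h : LieCoordinates A L x d) (m : MvPolynomial ι A) : h.app 1 m = m :=
  DFunLike.congr_fun (F := MvPolynomial ι A →+ MvPolynomial ι A) (map_one h.act) m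

lemma app_zero (h : LieCoordinates A L x d) (m : MvPolynomial ι A) : h.app 0 m = 0 :=
  DFunLike.congr_fun (F := MvPolynomial ι A →+ MvPolynomial ι A) (map_zero h.act) m

/-- Polynomials in the commuting elements `d i` of the enveloping algebra. -/
def monomials (h : LieCoordinates A L x d) : MvPolynomial ι ℤ →+* Envelope A L :=
  letI K := Subring.closure (Set.range fun i ↦ Envelope.ofVec A L (d i))
  letI : CommRing K := Subring.closureCommRingOfComm (by
    rintro _ ⟨i, rfl⟩ _ ⟨j, rfl⟩
    have := Envelope.ofVec_comm_ofVec A L (d i) (d j)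
    rw [h.d_comm, map_zero] at this
    exact sub_eq_zero.1 this)
  K.subtype.comp (MvPolynomial.aeval (R := ℤ) (S₁ := K)
    fun i ↦ ⟨Envelope.ofVec A L (d i), Subring.subset_closure ⟨i, rfl⟩⟩).toRingHom

lemma monomials_X (h : LieCoordinates A L x d) (i : ι) :
    h.monomials (X i) = Envelope.ofVec A L (d i) := by
  simp [monomials]

/-- The normally ordered differential operator given by a polynomial. -/
def op (h : LieCoordinates A L x d) : MvPolynomial ι A →+ Envelope A L :=
  (Finsupp.liftAddHom fun α ↦ (AddMonoidHom.mulRight (h.monomials (monomial α 1))).comp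
    (Envelope.ofFun A L).toAddMonoidHom).comp AddMonoidAlgebra.coeffAddEquiv.toAddMonoidHom

lemma op_monomial (h : LieCoordinates A L x d) (α : ι →₀ ℕ) (a : A) :
    h.op (monomial α a) = Envelope.ofFun A L a * h.monomials (monomial α 1) :=
  Finsupp.liftAddHom_apply_single _ _ _

lemma op_C_mul (h : LieCoordinates A L x d) (a : A) (m : MvPolynomial ι A) :
    h.op (C a * m) = Envelope.ofFun A L a * h.op m := by
  induction m using MvPolynomial.induction_on' with
  | monomial α b => rw [C_mul_monomial, op_monomial, op_monomial, map_mul, mul_assoc]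
  | add m n hm hn => rw [mul_add, map_add, map_add, hm, hn, mul_add]

lemma op_mul_X (h : LieCoordinates A L x d) (m : MvPolynomial ι A) (i : ι) :
    h.op (m * X i) = h.op m * Envelope.ofVec A L (d i) := by
  induction m using MvPolynomial.induction_on' with
  | monomial α b =>
    rw [X, monomial_mul, op_monomial, op_monomial, mul_one, mul_assoc, ← h.monomials_X, ← map_mul, X,
      monomial_mul, mul_one]
  | add m n hm hn => rw [add_mul, map_add, map_add, hm, hn, add_mul]

lemma op_one (h : LieCoordinates A L x d) : h.op 1 = 1 := by
  rw [MvPolynomial.one_def, op_monomial, ← MvPolynomial.one_def, map_one, map_one, one_mul]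

lemma op_C (h : LieCoordinates A L x d) (a : A) : h.op (C a) = Envelope.ofFun A L a := by
  rw [← mul_one (C a), op_C_mul, op_one, mul_one]

lemma commute_monomials (h : LieCoordinates A L x d) (i : ι) (m : MvPolynomial ι ℤ) :
    Envelope.ofVec A L (d i) * h.monomials m = h.monomials m * Envelope.ofVec A L (d i) := by
  rw [← h.monomials_X, ← map_mul, mul_comm, map_mul]

/-- The vector field `d i` is moved to the right: past a coefficient it leaves the derivative of
that coefficient, and it commutes with monomials in the `d j`. -/
lemma d_mul_op (h : LieCoordinates A L x d) (i : ι) (m : MvPolynomial ι A) :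
    Envelope.ofVec A L (d i) * h.op m = h.op (X i * m + h.coeffDer (d i) m) := by
  rw [mul_comm, map_add, op_mul_X]
  induction m using MvPolynomial.induction_on' with
  | monomial α b =>
    have e1 : h.coeffDer (d i) (monomial α b) = monomial α ⁅d i, b⁆ := by
      classical
      ext β
      simp only [coeff_coeffDer, coeff_monomial]
      split_ifs <;> simp
    have e2 := Envelope.ofVec_comm_ofFun A L b (d i)
    rw [sub_eq_iff_eq_add'] at e2
    rw [e1, op_monomial, op_monomial, ← mul_assoc, e2, add_mul, mul_assoc, commute_monomials, mul_assoc]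
  | add m n hm hn => rw [map_add, mul_add, hm, hn, map_add, map_add, add_mul]; abel

/-- The operator associated with a polynomial is linear for the action of the enveloping algebra. -/
lemma op_app (h : LieCoordinates A L x d) (P : Envelope A L) (m : MvPolynomial ι A) :
    h.op (h.app P m) = P * h.op m := by
  have key : ∀ t : FreeAlgebra ℤ (A ⊕ L), ∀ m, h.op (h.app (RingQuot.mkRingHom (EnvelopeRel A L) t) m) =
      RingQuot.mkRingHom (EnvelopeRel A L) t * h.op m := by
    intro t
    induction t with
    | grade0 r =>
      intro m
      have e : RingQuot.mkRingHom (EnvelopeRel A L) (algebraMap ℤ _ r) = Envelope.ofFun A L r := by simp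
      rw [e, app_ofFun, op_C_mul]
    | grade1 y =>
      intro m
      rcases y with a | D
      · exact (congrArg h.op (h.app_ofFun a m)).trans (h.op_C_mul a m)
      · refine (congrArg h.op (h.app_ofVec D m)).trans ?_
        change _ = Envelope.ofVec A L D * h.op m
        -- A general vector field is expanded in the `d i`, where `d_mul_op` applies.
        have e1 : h.coeffDer D m = ∑ i, C ⁅D, x i⁆ * h.coeffDer (d i) m := by
          ext α
          rw [coeff_sum, coeff_coeffDer]
          conv_lhs => rw [h.eq_sum D, sum_lie]
          exact Finset.sum_congr rfl fun i _ ↦ by rw [h.smul_lie, coeff_C_mul, coeff_coeffDer]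
        have e2 : Envelope.ofVec A L D = ∑ i, Envelope.ofFun A L ⁅D, x i⁆ * Envelope.ofVec A L (d i) := by
          conv_lhs => rw [h.eq_sum D, map_sum]
          exact Finset.sum_congr rfl fun i _ ↦ (Envelope.ofFun_mul_ofVec A L _ _).symm
        rw [e1, e2, symbol, Finset.sum_mul, ← Finset.sum_add_distrib, map_sum, Finset.sum_mul]
        refine Finset.sum_congr rfl fun i _ ↦ ?_
        rw [mul_assoc (Envelope.ofFun A L _), h.d_mul_op, ← op_C_mul]
        congr 1
        ring
    | mul a b ha hb =>
      intro m
      rw [map_mul, mul_assoc, ← hb, ← ha, app_mul]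
    | add a b ha hb =>
      intro m
      rw [map_add, app_add, map_add, add_mul, hb, ha]
  obtain ⟨t, rfl⟩ := RingQuot.mkRingHom_surjective _ P
  exact key t m

lemma app_monomials (h : LieCoordinates A L x d) (m : MvPolynomial ι ℤ) :
    h.app (h.monomials m) 1 = MvPolynomial.map (Int.castRingHom A) m := by
  induction m using MvPolynomial.induction_on with
  | C a =>
    have e : h.monomials (C a) = Envelope.ofFun A L a := by
      rw [← MvPolynomial.algebraMap_eq]; simp
    rw [e, app_ofFun]; simp
  | add m n hm hn => rw [map_add, map_add, ← hm, ← hn, app_add]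
  | mul_X m i hm =>
    have e : h.coeffDer (d i) (MvPolynomial.map (Int.castRingHom A) m) = 0 := by
      ext α
      rw [coeff_coeffDer, coeff_map, coeff_zero, ← h.der_apply]
      exact (h.der (d i)).map_algebraMap (m.coeff α)
    rw [mul_comm m, map_mul, monomials_X, app_mul, map_mul, app_ofVec, hm, h.symbol_d, e, map_X,
      add_zero]

/-- The linear independence half of the Poincaré–Birkhoff–Witt theorem: the `d i` act on polynomials
without denominators or corrections when applied to polynomials with integer coefficients, so an
operator in normal order can be read off from its value at `1`. -/
lemma app_op (h : LieCoordinates A L x d) (m : MvPolynomial ι A) : h.app (h.op m) 1 = m := by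
  induction m using MvPolynomial.induction_on' with
  | monomial α b =>
    rw [op_monomial, app_mul, app_ofFun, app_monomials, map_monomial, C_mul_monomial]
    simp
  | add m n hm hn => rw [map_add, app_add, hm, hn]

/-- Normal ordering is a bijection between polynomials and differential operators. -/
lemma op_app_one (h : LieCoordinates A L x d) (P : Envelope A L) : h.op (h.app P 1) = P := by
  rw [op_app, op_one, mul_one]

lemma op_injective (h : LieCoordinates A L x d) : Function.Injective h.op :=
  Function.LeftInverse.injective (g := fun P ↦ h.app P 1) h.app_op

/-- Coordinates commute with coefficients, and each factor `d i` contributes `1`, as in a Weyl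
algebra. Together with `op_comm_d` this turns the computation of centralizers into differential
equations for polynomials. -/
lemma op_comm_coord (h : LieCoordinates A L x d) (m : MvPolynomial ι A) (i : ι) :
    h.op m * Envelope.ofFun A L (x i) - Envelope.ofFun A L (x i) * h.op m = h.op (pderiv i m) := by
  classical
  induction m using MvPolynomial.induction_on with
  | C a => rw [op_C, ← map_mul, ← map_mul, mul_comm, pderiv_C, map_zero, sub_self]
  | add m n hm hn => rw [map_add, map_add, map_add, ← hm, ← hn]; noncomm_ring
  | mul_X m j hm =>
    have e := Envelope.ofVec_comm_ofFun A L (x i) (d j)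
    rw [sub_eq_iff_eq_add'] at e
    rw [Derivation.leibniz, op_mul_X, mul_assoc, e, mul_add, ← mul_assoc, ← mul_assoc, smul_eq_mul,
      smul_eq_mul, map_add, mul_comm (X j), op_mul_X, ← hm, pderiv_X, h.dual]
    rcases eq_or_ne i j with rfl | hij
    · simp [sub_mul]; abel
    · simp [hij, hij.symm, sub_mul, Pi.single_apply]

lemma op_comm_d (h : LieCoordinates A L x d) (m : MvPolynomial ι A) (i : ι) :
    Envelope.ofVec A L (d i) * h.op m - h.op m * Envelope.ofVec A L (d i) =
      h.op (h.coeffDer (d i) m) := by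
  rw [d_mul_op, map_add, mul_comm, op_mul_X]
  abel

end LieCoordinates

end PBW


/-! ### Degree filtration and symbols of operators -/

section Degree

open MvPolynomial

variable {A : Type u} [CommRing A] {ι : Type}

/-- The polynomials of degree less than `n`. -/
def degreeLT (ι : Type) (A : Type u) [CommRing A] (n : ℕ) : AddSubgroup (MvPolynomial ι A) where
  carrier := {m | ∀ α : ι →₀ ℕ, n ≤ α.degree → m.coeff α = 0}
  zero_mem' := fun α _ ↦ coeff_zero α
  add_mem' := fun {m n} hm hn α h ↦ by rw [coeff_add, hm α h, hn α h, add_zero]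
  neg_mem' := fun {m} hm α h ↦ by rw [coeff_neg, hm α h, neg_zero]

lemma degreeLT_mono {m n : ℕ} (h : m ≤ n) : degreeLT ι A m ≤ degreeLT ι A n :=
  fun _ hm α hα ↦ hm α (h.trans hα)

/-- The bounds are strict so that index `0` is the zero subgroup; degree at most `a` is therefore
encoded as `a + 1`. -/
lemma mul_mem_degreeLT {f g : MvPolynomial ι A} {a b : ℕ} (hf : f ∈ degreeLT ι A (a + 1))
    (hg : g ∈ degreeLT ι A b) : f * g ∈ degreeLT ι A (a + b) := by
  classical
  intro α hα
  rw [coeff_mul]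
  refine Finset.sum_eq_zero fun β hβ ↦ ?_
  rw [Finset.HasAntidiagonal.mem_antidiagonal] at hβ
  have hd : β.1.degree + β.2.degree = α.degree := by rw [← hβ, map_add]
  by_cases h : a + 1 ≤ β.1.degree
  · rw [hf _ h, zero_mul]
  · rw [hg _ (by omega), mul_zero]

lemma exists_mem_degreeLT (f : MvPolynomial ι A) : ∃ n, f ∈ degreeLT ι A (n + 1) :=
  ⟨f.totalDegree, fun α hα ↦ by
    by_contra h
    have := le_totalDegree (mem_support_iff.2 h)
    change _ ≤ f.totalDegree at this
    rw [Finsupp.degree_apply] at hα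
    change ∑ i ∈ α.support, α i ≤ _ at this
    omega⟩

lemma monomial_mem_degreeLT {α : ι →₀ ℕ} (a : A) {n : ℕ} (h : α.degree < n) :
    monomial α a ∈ degreeLT ι A n := by
  classical
  intro β hβ
  rw [coeff_monomial, if_neg]
  rintro rfl
  omega

/-- The component of `f` of degree `a` has square zero, being the component of `f * f` of degree
`2a`, and polynomials over a reduced ring have no nilpotents. -/
lemma mem_degreeLT_of_mul_self [IsReduced A] {f : MvPolynomial ι A} {a : ℕ}
    (hf : f ∈ degreeLT ι A (a + 1)) (hff : f * f ∈ degreeLT ι A (a + a)) : f ∈ degreeLT ι A a := by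
  let t := homogeneousComponent a f
  have ht : t.IsHomogeneous a := homogeneousComponent_isHomogeneous a f
  have hr : f - t ∈ degreeLT ι A a := by
    intro α hα
    rw [coeff_sub, coeff_homogeneousComponent]
    split_ifs with h
    · rw [sub_self]
    · rw [hf α (by omega), sub_zero]
  have htm : t ∈ degreeLT ι A (a + 1) := by
    have := sub_mem hf (degreeLT_mono (Nat.le_succ a) hr)
    rwa [sub_sub_cancel] at this
  have htt : t * t ∈ degreeLT ι A (a + a) := by
    have : t * t = f * f - f * (f - t) - t * (f - t) := by ring
    rw [this]
    exact sub_mem (sub_mem hff (mul_mem_degreeLT hf hr)) (mul_mem_degreeLT htm hr)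
  have ht0 : t * t = 0 := by
    ext α
    rw [coeff_zero]
    by_cases h : a + a ≤ α.degree
    · exact htt α h
    · by_contra h'
      have := (ht.mul ht).coeff_eq_zero (d := α) (by omega)
      exact h' this
  have : t = 0 := IsReduced.eq_zero t ⟨2, by rw [pow_two, ht0]⟩
  rwa [this, sub_zero] at hr

/-- The additive operator `T` on polynomials is of order at most `a`, with symbol `s`. -/
def HasSymbol (a : ℕ) (s : MvPolynomial ι A) (T : MvPolynomial ι A →+ MvPolynomial ι A) : Prop :=
  s ∈ degreeLT ι A (a + 1) ∧
    ∀ b, ∀ n ∈ degreeLT ι A (b + 1), T n - s * n ∈ degreeLT ι A (a + b)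

/-- The error splits into `T` applied to the error of `T'`, which drops in degree since `T` has
order at most `a`, and the error of `T` on `s' * n`. -/
lemma HasSymbol.comp {a a' : ℕ} {s s' : MvPolynomial ι A}
    {T T' : MvPolynomial ι A →+ MvPolynomial ι A} (h : HasSymbol a s T) (h' : HasSymbol a' s' T') :
    HasSymbol (a + a') (s * s') (T.comp T') := by
  refine ⟨by rw [add_assoc]; exact mul_mem_degreeLT h.1 h'.1, fun b n hn ↦ ?_⟩
  have e : T.comp T' n - s * s' * n = T (T' n - s' * n) + (T (s' * n) - s * (s' * n)) := by
    rw [map_sub, AddMonoidHom.comp_apply]; ring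
  rw [e]
  have h1 : s' * n ∈ degreeLT ι A (a' + b + 1) := by
    rw [add_assoc]; exact mul_mem_degreeLT h'.1 hn
  have h2 := h'.2 b n hn
  refine add_mem ?_ (add_assoc a a' b ▸ h.2 _ _ h1)
  -- The hypothesis on `T` needs a bound of the form `c + 1`. If `a' + b = 0`, the error of `T'` has
  -- degree less than `0` and is zero.
  rcases Nat.eq_zero_or_pos (a' + b) with h0 | h0
  · have : T' n - s' * n = 0 := by
      ext α
      exact h2 α (by omega)
    rw [this, map_zero]
    exact zero_mem _
  · obtain ⟨c, hc⟩ := Nat.exists_eq_succ_of_ne_zero h0.ne'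
    rw [hc] at h2
    have h3 := h.2 c _ h2
    have h4 := mul_mem_degreeLT h.1 h2
    have := add_mem (degreeLT_mono (by omega : a + c ≤ a + (c + 1)) h3) h4
    rw [sub_add_cancel] at this
    rwa [add_assoc, hc]

lemma HasSymbol.mono {a a' : ℕ} (haa : a ≤ a') {s : MvPolynomial ι A}
    {T : MvPolynomial ι A →+ MvPolynomial ι A} (h : HasSymbol a s T) : HasSymbol a' s T :=
  ⟨degreeLT_mono (by omega) h.1, fun b n hn ↦ degreeLT_mono (by omega) (h.2 b n hn)⟩

lemma HasSymbol.add {a : ℕ} {s s' : MvPolynomial ι A}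
    {T T' : MvPolynomial ι A →+ MvPolynomial ι A} (h : HasSymbol a s T) (h' : HasSymbol a s' T') :
    HasSymbol a (s + s') (T + T') :=
  ⟨add_mem h.1 h'.1, fun b n hn ↦ by
    have := add_mem (h.2 b n hn) (h'.2 b n hn)
    rwa [show (T + T') n - (s + s') * n = T n - s * n + (T' n - s' * n) by
      rw [AddMonoidHom.add_apply]; ring]⟩

lemma hasSymbol_zero (a : ℕ) : HasSymbol (ι := ι) (A := A) a 0 0 :=
  ⟨zero_mem _, fun b n _ ↦ by simp [zero_mem]⟩

end Degree

namespace LieCoordinates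

open MvPolynomial

variable {A L : Type u} [CommRing A] [LieRing L] [Module A L] [LieRingModule L A]
  {ι : Type} [Fintype ι] {x : ι → A} {d : ι → L}

lemma app_mul' (h : LieCoordinates A L x d) (P Q : Envelope A L) :
    h.app (P * Q) = (h.app P).comp (h.app Q) := AddMonoidHom.ext (h.app_mul P Q)

lemma coeffDer_mem_degreeLT (h : LieCoordinates A L x d) (D : L) {m : MvPolynomial ι A} {a : ℕ}
    (hm : m ∈ degreeLT ι A a) : h.coeffDer D m ∈ degreeLT ι A a := fun α hα ↦ by
  rw [coeff_coeffDer, hm α hα, lie_zero]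

lemma symbol_mem_degreeLT (x : ι → A) (D : L) : symbol x D ∈ degreeLT ι A 2 := by
  refine sum_mem fun i _ ↦ ?_
  rw [X, C_mul_monomial]
  exact monomial_mem_degreeLT _ (by simp)

lemma hasSymbol_ofFun (h : LieCoordinates A L x d) (a : A) :
    HasSymbol 0 (C a) (h.app (Envelope.ofFun A L a)) :=
  ⟨monomial_mem_degreeLT a (by simp), fun b n _ ↦ by rw [app_ofFun, sub_self]; exact zero_mem _⟩

lemma hasSymbol_ofVec (h : LieCoordinates A L x d) (D : L) :
    HasSymbol 1 (symbol x D) (h.app (Envelope.ofVec A L D)) :=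
  ⟨symbol_mem_degreeLT x D, fun b n hn ↦ by
    rw [app_ofVec, add_sub_cancel_left, add_comm]; exact h.coeffDer_mem_degreeLT D hn⟩

lemma hasSymbol_monomials (h : LieCoordinates A L x d) (α : ι →₀ ℕ) :
    HasSymbol α.degree (monomial α 1) (h.app (h.monomials (monomial α 1))) := by
  induction α using Finsupp.induction_linear with
  | zero =>
    rw [← MvPolynomial.one_def, ← MvPolynomial.one_def, map_one]
    have := h.hasSymbol_ofFun 1
    rw [map_one, map_one] at this
    simpa using this
  | add α β hα hβ =>
    have e : ∀ (R : Type u) [CommRing R], (monomial (α + β) (1 : R)) = monomial α 1 * monomial β 1 := by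
      intro R _; simp
    have e' : (monomial (α + β) (1 : ℤ)) = monomial α 1 * monomial β 1 := by simp
    rw [e, e', map_mul, app_mul', map_add]
    exact hα.comp hβ
  | single i n =>
    induction n with
    | zero =>
      have := h.hasSymbol_ofFun 1
      rw [map_one, map_one] at this
      simpa [← MvPolynomial.one_def] using this
    | succ n ih =>
      have e : ∀ (R : Type u) [CommRing R], (monomial (Finsupp.single i (n + 1)) (1 : R)) =
          monomial (Finsupp.single i n) 1 * X i := by
        intro R _; simp [X, Finsupp.single_add]
      have e' : (monomial (Finsupp.single i (n + 1)) (1 : ℤ)) =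
          monomial (Finsupp.single i n) 1 * X i := by simp [X, Finsupp.single_add]
      rw [e, e', map_mul, app_mul', monomials_X]
      have := ih.comp (h.hasSymbol_ofVec (d i))
      rw [h.symbol_d] at this
      simpa using this

/-- Coefficients have order `0` and each `d i` has order `1` with symbol `X i`; symbols multiply
under composition and add for operators of bounded order. -/
lemma hasSymbol_op (h : LieCoordinates A L x d) {m : MvPolynomial ι A} {a : ℕ}
    (hm : m ∈ degreeLT ι A (a + 1)) : HasSymbol a m (h.app (h.op m)) := by
  have key : ∀ s : Finset (ι →₀ ℕ), HasSymbol a (∑ α ∈ s, monomial α (m.coeff α))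
      (h.app (h.op (∑ α ∈ s, monomial α (m.coeff α)))) := by
    classical
    intro s
    induction s using Finset.induction_on with
    | empty =>
      rw [Finset.sum_empty, map_zero]
      have : h.app 0 = 0 := AddMonoidHom.ext h.app_zero
      rw [this]
      exact hasSymbol_zero a
    | insert α s hα ih =>
      rw [Finset.sum_insert hα, map_add]
      have : ∀ P Q, h.app (P + Q) = h.app P + h.app Q := fun P Q ↦ AddMonoidHom.ext (h.app_add P Q)
      rw [this]
      refine HasSymbol.add ?_ ih
      by_cases hd : a + 1 ≤ α.degree
      · rw [hm α hd, map_zero, map_zero]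
        have : h.app 0 = 0 := AddMonoidHom.ext h.app_zero
        rw [this]
        exact hasSymbol_zero a
      · rw [op_monomial, app_mul']
        have := ((h.hasSymbol_ofFun (m.coeff α)).comp (h.hasSymbol_monomials α)).mono
          (by omega : 0 + α.degree ≤ a)
        rwa [C_mul_monomial, mul_one] at this
  rw [MvPolynomial.as_sum m]
  exact key _

/-- The enveloping algebra over a reduced ring is reduced. -/
lemma isReduced [IsReduced A] (h : LieCoordinates A L x d) : IsReduced (Envelope A L) := by
  rw [isReduced_iff_pow_one_lt 2 one_lt_two]
  intro e he
  rw [pow_two] at he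
  set m := h.app e 1 with hm
  have hem : h.op m = e := h.op_app_one e
  have h0 : h.app e m = 0 := by rw [hm, ← app_mul, he, app_zero]
  -- Since `e * e = 0`, the operator `e` kills `m`. Its symbol is `m`, so `m * m` is congruent to
  -- `0` in degree `2a`, and the degree bound of `m` drops. Iterating down to the bound `0` gives `m
  -- = 0`.
  have step : ∀ a, m ∈ degreeLT ι A (a + 1) → m ∈ degreeLT ι A a := by
    intro a ha
    refine mem_degreeLT_of_mul_self ha ?_
    have := (h.hasSymbol_op ha).2 a m ha
    rw [hem, h0, zero_sub] at this
    simpa using neg_mem this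
  have all : ∀ a, m ∈ degreeLT ι A a → m ∈ degreeLT ι A 0 := by
    intro a
    induction a with
    | zero => exact id
    | succ a ih => exact fun ha ↦ ih (step a ha)
  obtain ⟨a, ha⟩ := exists_mem_degreeLT m
  have : m = 0 := by
    ext α
    exact all _ ha α (Nat.zero_le _)
  rw [← hem, this, map_zero]

end LieCoordinates


/-! ### Prime powers in characteristic `p` -/

section PrimePower

/-- The assumption is `(p : R) = 0` rather than `CharP R p`, so that the zero ring is allowed; it
occurs as sections on the empty set. -/
lemma add_pow_prime_of_cast_eq_zero {R : Type*} [CommRing R] {p : ℕ} (hp : p.Prime) (h0 : (p : R) = 0)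
    (a b : R) : (a + b) ^ p = a ^ p + b ^ p := by
  obtain ⟨r, hr⟩ := exists_add_pow_prime_eq hp a b
  rw [hr, h0, zero_mul, zero_mul, zero_mul, add_zero]

/-- In characteristic `p`, the inner derivation by `a ^ p` is the `p`-th iterate of that by `a`. -/
lemma commutator_pow_prime {R : Type*} [Ring R] {p : ℕ} (hp : p.Prime) (h0 : (p : R) = 0) (a b : R) :
    a ^ p * b - b * a ^ p = (fun y ↦ a * y - y * a)^[p] b := by
  let l : AddMonoid.End R := AddMonoidHom.mulLeft a
  let r : AddMonoid.End R := AddMonoidHom.mulRight a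
  -- Left multiplication is the sum of the commuting operators `l - r` and `r`, so Frobenius in the
  -- endomorphism ring gives `l ^ p = (l - r) ^ p + r ^ p`.
  have hlr : Commute (l - r) r := by
    refine Commute.sub_left (AddMonoidHom.ext fun y ↦ ?_) (Commute.refl r)
    exact (mul_assoc a y a).symm
  have h0' : (p : AddMonoid.End R) = 0 := AddMonoidHom.ext fun y ↦ by
    change (p : AddMonoid.End R) y = 0
    rw [AddMonoid.End.natCast_apply, nsmul_eq_mul, h0, zero_mul]
  obtain ⟨q, hq⟩ := hlr.exists_add_pow_prime_eq hp
  rw [sub_add_cancel, h0', zero_mul, zero_mul, zero_mul, add_zero] at hq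
  have hl : ∀ n y, (l ^ n) y = a ^ n * y := fun n y ↦ by
    induction n generalizing y with
    | zero => simp
    | succ n ih => rw [pow_succ, pow_succ, mul_assoc]; exact ih _
  have hr : ∀ n y, (r ^ n) y = y * a ^ n := fun n y ↦ by
    induction n generalizing y with
    | zero => simp
    | succ n ih => rw [pow_succ, pow_succ', ← mul_assoc]; exact ih _
  have hlr' : ∀ n y, ((l - r) ^ n) y = (fun y ↦ a * y - y * a)^[n] y := fun n y ↦ by
    induction n generalizing y with
    | zero => rfl
    | succ n ih => rw [pow_succ]; exact ih _
  have := DFunLike.congr_fun (F := R →+ R) hq b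
  have e : a ^ p * b = (fun y ↦ a * y - y * a)^[p] b + b * a ^ p :=
    (hl p b).symm.trans (this.trans (congrArg₂ (· + ·) (hlr' p b) (hr p b)))
  rw [e, add_sub_cancel_right]

end PrimePower

lemma WeylOver.comp_bijective {p : ℕ} {S S' E : Type*} [CommRing S] [CommRing S'] [Ring E]
    {ψ : S →+* E} {ι : Type} {x d : ι → E} (h : WeylOver p ψ x d) {f : S' →+* S}
    (hf : Function.Bijective f) : WeylOver p (ψ.comp f) x d where
  toWeylRel := h.toWeylRel
  central s := h.central (f s)
  inj := h.inj.comp hf.1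
  centralizer e hx hd := by
    obtain ⟨s, rfl⟩ := h.centralizer e hx hd
    obtain ⟨s, rfl⟩ := hf.2 s
    exact ⟨s, rfl⟩

/-! ### The center of the enveloping algebra in coordinates -/

section FrobeniusCoordinates

open MvPolynomial

/-- Coordinates in characteristic `p`: the Lie algebroid has a `p`-operation, and the functions killed
by the coordinate vector fields are the `p`-th powers. -/
structure FrobeniusCoordinates (p : ℕ) (A L : Type u) [CommRing A] [LieRing L] [Module A L]
    [LieRingModule L A] (pp : L → L) {ι : Type} (x : ι → A) (d : ι → L) : Prop
    extends LieCoordinates A L x d where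
  char : (p : A) = 0
  lie_pp : ∀ (D : L) (a : A), ⁅pp D, a⁆ = (fun b : A ↦ ⁅D, b⁆)^[p] a
  reduced : IsReduced A
  cartier : ∀ a : A, (∀ i, ⁅d i, a⁆ = 0) → ∃ b, a = b ^ p

namespace FrobeniusCoordinates

open LieCoordinates (symbol symbol_add symbol_mem_degreeLT)

variable {A L : Type u} [CommRing A] [LieRing L] [Module A L] [LieRingModule L A] {pp : L → L}
  {p : ℕ} {ι : Type} [Fintype ι] {x : ι → A} {d : ι → L}

lemma char_envelope (h : FrobeniusCoordinates p A L pp x d) : (p : Envelope A L) = 0 := by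
  rw [← map_natCast (Envelope.ofFun A L), h.char, map_zero]

lemma char_polynomial (h : FrobeniusCoordinates p A L pp x d) : (p : MvPolynomial ι A) = 0 := by
  rw [← map_natCast C, h.char, map_zero]

lemma coeffDer_pow_mul (h : FrobeniusCoordinates p A L pp x d) (D : L) (n m : MvPolynomial ι A) :
    h.coeffDer D (n ^ p * m) = n ^ p * h.coeffDer D m := by
  let δ : Derivation ℤ (MvPolynomial ι A) (MvPolynomial ι A) :=
    .mk' (h.coeffDer D).toIntLinearMap (h.coeffDer_mul D)
  have : h.coeffDer D (n ^ p) = 0 := by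
    have := δ.leibniz_pow n p
    rw [← Nat.cast_smul_eq_nsmul (MvPolynomial ι A), h.char_polynomial, zero_smul] at this
    exact this
  rw [h.coeffDer_mul, this, mul_zero, add_zero]

/-- Derivations kill `p`-th powers, so every generator of the enveloping algebra acts linearly over
them. This is the source of the multiplicativity of `frob`. -/
lemma app_pow_mul (h : FrobeniusCoordinates p A L pp x d) (P : Envelope A L) (n m : MvPolynomial ι A) :
    h.app P (n ^ p * m) = n ^ p * h.app P m := by
  have key : ∀ t : FreeAlgebra ℤ (A ⊕ L), ∀ m,
      h.app (RingQuot.mkRingHom (EnvelopeRel A L) t) (n ^ p * m) =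
        n ^ p * h.app (RingQuot.mkRingHom (EnvelopeRel A L) t) m := by
    intro t
    induction t with
    | grade0 r =>
      intro m
      have e : RingQuot.mkRingHom (EnvelopeRel A L) (algebraMap ℤ _ r) = Envelope.ofFun A L r := by simp
      rw [e, h.app_ofFun, h.app_ofFun]
      ring
    | grade1 y =>
      intro m
      rcases y with a | D
      · refine (h.app_ofFun a _).trans (Eq.trans ?_ (congrArg (n ^ p * ·) (h.app_ofFun a m)).symm)
        ring
      · refine (h.app_ofVec D _).trans (Eq.trans ?_ (congrArg (n ^ p * ·) (h.app_ofVec D m)).symm)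
        rw [h.coeffDer_pow_mul]
        ring
    | mul a b ha hb => intro m; rw [map_mul (RingQuot.mkRingHom _), h.app_mul, h.app_mul, hb, ha]
    | add a b ha hb => intro m; rw [map_add (RingQuot.mkRingHom _), h.app_add, h.app_add, hb, ha, mul_add]
  obtain ⟨t, rfl⟩ := RingQuot.mkRingHom_surjective _ P
  exact key t m

lemma mul_op_pow (h : FrobeniusCoordinates p A L pp x d) (P : Envelope A L) (n : MvPolynomial ι A) :
    P * h.op (n ^ p) = h.op (n ^ p * h.app P 1) := by
  rw [← h.app_pow_mul, mul_one, h.op_app]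

variable [Fact p.Prime]

/-- The homomorphism from polynomials to differential operators that maps a function to its `p`-th
power and a variable to the `p`-th power of the coordinate vector field. -/
def frob (h : FrobeniusCoordinates p A L pp x d) : MvPolynomial ι A →+* Envelope A L where
  toFun n := h.op (n ^ p)
  map_one' := by rw [one_pow, h.op_one]
  map_zero' := by rw [zero_pow (Fact.out : p.Prime).ne_zero, map_zero]
  map_mul' n m := by rw [h.mul_op_pow, h.app_op, ← mul_pow, mul_comm]
  map_add' n m := by
    rw [add_pow_prime_of_cast_eq_zero Fact.out h.char_polynomial, map_add]

lemma frob_apply (h : FrobeniusCoordinates p A L pp x d) (n : MvPolynomial ι A) :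
    h.frob n = h.op (n ^ p) := rfl

lemma ofFun_injective (h : FrobeniusCoordinates p A L pp x d) :
    Function.Injective (Envelope.ofFun A L) := fun a b hab ↦ by
  rw [← h.op_C, ← h.op_C] at hab
  exact C_injective _ _ (h.op_injective hab)

/-- The element `∂ ^ p - ∂^{[p]}` is central. -/
lemma commute_pow_sub (h : FrobeniusCoordinates p A L pp x d) (D : L) (P : Envelope A L) :
    Commute (Envelope.ofVec A L D ^ p - Envelope.ofVec A L (pp D)) P := by
  set z := Envelope.ofVec A L D ^ p - Envelope.ofVec A L (pp D) with hz
  -- Bracketing a function with `∂ ^ p` applies `∂` to it `p` times, which is also the effect of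
  -- bracketing with `∂^{[p]}`.
  have hf : ∀ a, Commute z (Envelope.ofFun A L a) := by
    intro a
    have h1 := commutator_pow_prime (Fact.out : p.Prime) h.char_envelope (Envelope.ofVec A L D)
      (Envelope.ofFun A L a)
    have h2 : ∀ n, (fun y ↦ Envelope.ofVec A L D * y - y * Envelope.ofVec A L D)^[n]
        (Envelope.ofFun A L a) = Envelope.ofFun A L ((fun b : A ↦ ⁅D, b⁆)^[n] a) := fun n ↦ by
      refine (Function.Semiconj.iterate_right (f := Envelope.ofFun A L) (ga := fun b : A ↦ ⁅D, b⁆)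
        (fun b ↦ ?_) n a).symm
      exact (Envelope.ofVec_comm_ofFun A L b D).symm
    rw [h2, ← h.lie_pp, ← Envelope.ofVec_comm_ofFun] at h1
    rw [hz]
    refine sub_eq_zero.1 ?_
    rw [sub_mul, mul_sub, sub_sub_sub_comm, h1, sub_self]
  have hv : ∀ E, Commute z (Envelope.ofVec A L E) := by
    intro E
    -- The commutator with a vector field is again a vector field, as an iterated Lie bracket. By
    -- the Jacobi identity it kills the coordinates, because `z` commutes with functions; hence it
    -- is zero.
    obtain ⟨F, hF⟩ : ∃ F, z * Envelope.ofVec A L E - Envelope.ofVec A L E * z = Envelope.ofVec A L F := by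
      have h1 := commutator_pow_prime (Fact.out : p.Prime) h.char_envelope (Envelope.ofVec A L D)
        (Envelope.ofVec A L E)
      have h2 : ∀ n, (fun y ↦ Envelope.ofVec A L D * y - y * Envelope.ofVec A L D)^[n]
          (Envelope.ofVec A L E) = Envelope.ofVec A L ((fun b : L ↦ ⁅D, b⁆)^[n] E) := fun n ↦ by
        refine (Function.Semiconj.iterate_right (f := Envelope.ofVec A L) (ga := fun b : L ↦ ⁅D, b⁆)
          (fun b ↦ ?_) n E).symm
        exact (Envelope.ofVec_comm_ofVec A L D b).symm
      rw [h2] at h1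
      refine ⟨(fun b : L ↦ ⁅D, b⁆)^[p] E - ⁅pp D, E⁆, ?_⟩
      rw [map_sub, ← Envelope.ofVec_comm_ofVec, ← h1, hz, sub_mul, mul_sub, sub_sub_sub_comm]
    have hF0 : F = 0 := by
      refine h.ext F fun i ↦ h.ofFun_injective ?_
      rw [map_zero, ← Envelope.ofVec_comm_ofFun, ← hF]
      have e := Envelope.ofVec_comm_ofFun A L (x i) E
      have e1 := (hf (x i)).eq
      have e2 := (hf ⁅E, x i⁆).eq
      rw [← e] at e2
      have : ∀ u v w : Envelope A L, z * v = v * z →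
          z * (u * v - v * u) = (u * v - v * u) * z → (z * u - u * z) * v - v * (z * u - u * z) = 0 := by
        intro u v _ h1 h2
        have : (z * u - u * z) * v - v * (z * u - u * z) =
          (z * (u * v - v * u) - (u * v - v * u) * z) - u * (z * v - v * z) + (z * v - v * z) * u := by
          simp only [mul_sub, sub_mul, mul_assoc]; abel
        rw [this, h1, h2]; simp
      exact this _ _ 0 e1 e2
    rw [hF0, map_zero] at hF
    exact sub_eq_zero.1 hF
  obtain ⟨t, rfl⟩ := RingQuot.mkRingHom_surjective _ P
  induction t with
  | grade0 r =>
    have e : RingQuot.mkRingHom (EnvelopeRel A L) (algebraMap ℤ _ r) = Envelope.ofFun A L r := by simp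
    rw [e]
    exact hf _
  | grade1 y =>
    rcases y with a | D
    · exact hf a
    · exact hv D
  | mul a b ha hb => rw [map_mul]; exact ha.mul_right hb
  | add a b ha hb => rw [map_add]; exact ha.add_right hb

/-- Already the second iterate of `d i` kills the coordinates, and `p ≥ 2`. -/
lemma pp_d (h : FrobeniusCoordinates p A L pp x d) (i : ι) : pp (d i) = 0 := by
  classical
  refine h.ext _ fun j ↦ ?_
  obtain ⟨n, hn⟩ := Nat.exists_eq_add_of_le (Fact.out : p.Prime).two_le
  rw [h.lie_pp, hn, add_comm, Function.iterate_add_apply]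
  have : (fun b : A ↦ ⁅d i, b⁆)^[2] (x j) = 0 := by
    change ⁅d i, ⁅d i, x j⁆⁆ = 0
    rw [h.dual]
    split_ifs <;> simp [h.lie_one]
  rw [this]
  exact Function.iterate_fixed (lie_zero (d i)) n

lemma frob_C (h : FrobeniusCoordinates p A L pp x d) (a : A) :
    h.frob (C a) = Envelope.ofFun A L (a ^ p) := by
  rw [frob_apply, ← map_pow, h.op_C]

lemma frob_X (h : FrobeniusCoordinates p A L pp x d) (i : ι) :
    h.frob (X i) = Envelope.ofVec A L (d i) ^ p := by
  have : ∀ n : ℕ, h.op (X i ^ n) = Envelope.ofVec A L (d i) ^ n := fun n ↦ by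
    induction n with
    | zero => rw [pow_zero, pow_zero, h.op_one]
    | succ n ih => rw [pow_succ, pow_succ, h.op_mul_X, ih]
  exact this p

lemma commute_ofFun_pow (h : FrobeniusCoordinates p A L pp x d) (a : A) (P : Envelope A L) :
    Commute (Envelope.ofFun A L (a ^ p)) P := by
  have hv : ∀ D, ⁅D, a ^ p⁆ = 0 := fun D ↦ by
    have := (h.der D).leibniz_pow a p
    rw [← Nat.cast_smul_eq_nsmul A, h.char, zero_smul] at this
    exact this
  obtain ⟨t, rfl⟩ := RingQuot.mkRingHom_surjective _ P
  induction t with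
  | grade0 r =>
    have e : RingQuot.mkRingHom (EnvelopeRel A L) (algebraMap ℤ _ r) = Envelope.ofFun A L r := by simp
    rw [e]
    exact (Commute.all _ _).map _
  | grade1 y =>
    rcases y with b | D
    · exact (Commute.all (a ^ p) b).map (Envelope.ofFun A L)
    · have := Envelope.ofVec_comm_ofFun A L (a ^ p) D
      rw [hv, map_zero] at this
      exact (sub_eq_zero.1 this).symm
  | mul a b ha hb => rw [map_mul]; exact ha.mul_right hb
  | add a b ha hb => rw [map_add]; exact ha.add_right hb

lemma commute_frob (h : FrobeniusCoordinates p A L pp x d) (n : MvPolynomial ι A) (P : Envelope A L) :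
    Commute (h.frob n) P := by
  induction n using MvPolynomial.induction_on with
  | C a => rw [frob_C]; exact h.commute_ofFun_pow a P
  | add m n hm hn => rw [map_add]; exact hm.add_left hn
  | mul_X m i hm =>
    rw [map_mul, frob_X]
    refine hm.mul_left ?_
    have := h.commute_pow_sub (d i) P
    rwa [h.pp_d, map_zero, sub_zero] at this

/-- Differentiation multiplies the coefficient at `α` by `α i`, which is invertible in `A` if it is
prime to `p`. -/
lemma dvd_of_pderiv_eq_zero (h : FrobeniusCoordinates p A L pp x d) {m : MvPolynomial ι A}
    (hm : ∀ i, pderiv i m = 0) (α : ι →₀ ℕ) (hα : m.coeff α ≠ 0) (i : ι) : p ∣ α i := by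
  by_contra hp
  have h1 : (pderiv i m).coeff (α - Finsupp.single i 1) = α i * m.coeff α := by
    have h0 : α i ≠ 0 := fun h ↦ hp (h ▸ dvd_zero p)
    have hle : Finsupp.single i 1 ≤ α := by
      rw [Finsupp.single_le_iff]; omega
    rw [coeff_pderiv, tsub_add_cancel_of_le hle, mul_comm]
    congr 1
    simp
    exact_mod_cast congrArg (Nat.cast (R := A)) (by omega : α i - 1 + 1 = α i)
  rw [hm, coeff_zero] at h1
  refine hα ?_
  have hc : IsCoprime ((α i : ℕ) : ℤ) (p : ℤ) :=
    Nat.isCoprime_iff_coprime.2 ((Nat.Prime.coprime_iff_not_dvd Fact.out).2 hp).symm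
  obtain ⟨u, v, huv⟩ := hc
  have := congr((($huv : ℤ) : A))
  push_cast at this
  rw [h.char, mul_zero, add_zero] at this
  rw [← one_mul (m.coeff α), ← this, mul_assoc, ← h1, mul_zero]

/-- Symbols have no constant term. On constant coefficients one therefore recovers the action of
vector fields on functions, under which `1` is killed. -/
lemma constantCoeff_app (h : FrobeniusCoordinates p A L pp x d) (D : L) (m : MvPolynomial ι A) :
    constantCoeff (h.app (Envelope.ofVec A L D) m) = ⁅D, constantCoeff m⁆ := by
  rw [h.app_ofVec, map_add, map_mul, symbol, map_sum]
  simp only [map_mul, constantCoeff_X, mul_zero, Finset.sum_const_zero, zero_mul, zero_add]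
  exact h.coeff_coeffDer D m 0

lemma hasSymbol_pow (h : FrobeniusCoordinates p A L pp x d) (D : L) (n : ℕ) :
    HasSymbol n (symbol x D ^ n) (h.app (Envelope.ofVec A L D ^ n)) := by
  induction n with
  | zero =>
    have := h.hasSymbol_ofFun 1
    rw [map_one, map_one] at this
    simpa using this
  | succ n ih =>
    rw [pow_succ, pow_succ, h.app_mul']
    exact ih.comp (h.hasSymbol_ofVec D)

/-- Let `r` be the difference of the polynomials of the two sides. Both operators commute with the
coordinates, so all derivatives of `r` vanish and its exponents are divisible by `p`. Its degree is
less than `p`, since `∂ ^ p` has the symbol of `∂` to the power `p` and `∂^{[p]}` has order `1`. Its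
constant term vanishes because vector fields kill `1`. Thus `r = 0`; additivity and `p`-linearity of
`∂ ↦ ∂ ^ p - ∂^{[p]}` come for free, without Jacobson's formula. -/
lemma frob_symbol (h : FrobeniusCoordinates p A L pp x d) (D : L) :
    h.frob (symbol x D) = Envelope.ofVec A L D ^ p - Envelope.ofVec A L (pp D) := by
  set z := Envelope.ofVec A L D ^ p - Envelope.ofVec A L (pp D) with hz
  set r := h.app z 1 - symbol x D ^ p with hr
  have hop : z = h.op (h.app z 1) := (h.op_app_one z).symm
  have hr1 : ∀ i, pderiv i r = 0 := by
    intro i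
    have h1 := h.op_comm_coord (h.app z 1) i
    rw [← hop, (h.commute_pow_sub D _).eq, sub_self] at h1
    have h2 : pderiv i (h.app z 1) = 0 := h.op_injective (h1.symm.trans (map_zero _).symm)
    have h3 := (pderiv i).leibniz_pow (symbol x D) p
    rw [← Nat.cast_smul_eq_nsmul (MvPolynomial ι A), h.char_polynomial, zero_smul] at h3
    rw [hr, map_sub, h2, h3, sub_zero]
  have hone : (1 : MvPolynomial ι A) ∈ degreeLT ι A (0 + 1) := monomial_mem_degreeLT 1 (by simp)
  have hr2 : r ∈ degreeLT ι A p := by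
    have h1 := (h.hasSymbol_pow D p).2 0 1 hone
    have h2 := (h.hasSymbol_ofVec (pp D)).2 0 1 hone
    have h3 : h.app (Envelope.ofVec A L (pp D)) 1 ∈ degreeLT ι A 2 := by
      have := add_mem (degreeLT_mono (by omega) h2) (symbol_mem_degreeLT x (pp D))
      simpa using this
    rw [hr, hz, h.app_sub, sub_right_comm]
    refine sub_mem ?_ (degreeLT_mono (Fact.out : p.Prime).two_le h3)
    simpa using h1
  have hr3 : constantCoeff r = 0 := by
    have h1 : ∀ n, constantCoeff (h.app (Envelope.ofVec A L D ^ (n + 1)) 1) = 0 := fun n ↦ by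
      have : ∀ n m, constantCoeff (h.app (Envelope.ofVec A L D ^ n) m) =
          (fun b : A ↦ ⁅D, b⁆)^[n] (constantCoeff m) := fun n ↦ by
        induction n with
        | zero => intro m; rw [pow_zero, h.app_one]; rfl
        | succ n ih => intro m; rw [pow_succ, h.app_mul, ih, h.constantCoeff_app]; rfl
      rw [this, map_one, Function.iterate_succ_apply, h.lie_one]
      exact Function.iterate_fixed (lie_zero D) n
    have h1' := h1 (p - 1)
    rw [Nat.sub_add_cancel (Fact.out : p.Prime).one_le] at h1'
    have h2 : constantCoeff (symbol x D) = 0 := by simp [symbol]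
    rw [hr, hz, h.app_sub, map_sub, map_sub, h.constantCoeff_app, map_one constantCoeff, h.lie_one, map_pow, h2,
      zero_pow (Fact.out : p.Prime).ne_zero, h1']
    simp
  have hr0 : r = 0 := by
    ext α
    rw [coeff_zero]
    by_contra hα
    have hlt : α.degree < p := by
      by_contra hlt
      exact hα (hr2 α (not_lt.1 hlt))
    have : α = 0 := by
      ext i
      have h1 : α i ≤ α.degree := Finsupp.le_degree i α
      exact Nat.eq_zero_of_dvd_of_lt (h.dvd_of_pderiv_eq_zero hr1 α hα i) (by omega)
    rw [this] at hα
    exact hα hr3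
  rw [frob_apply, hop, sub_eq_zero.1 hr0]

lemma frob_injective (h : FrobeniusCoordinates p A L pp x d) : Function.Injective h.frob := by
  have := h.reduced
  rw [injective_iff_map_eq_zero]
  intro n hn
  rw [frob_apply, ← map_zero h.op] at hn
  exact IsReduced.eq_zero n ⟨p, h.op_injective hn⟩

/-- In normal order, commuting with the `x i` leaves only exponents `p • β`, and commuting with the
`d i` leaves only coefficients killed by the `d i`, which are `p`-th powers. Each term is then the
`p`-th power of a monomial. -/
lemma mem_range_frob (h : FrobeniusCoordinates p A L pp x d) (P : Envelope A L)
    (hx : ∀ i, Commute (Envelope.ofFun A L (x i)) P) (hd : ∀ i, Commute (Envelope.ofVec A L (d i)) P) :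
    P ∈ Set.range h.frob := by
  obtain ⟨m, rfl⟩ : ∃ m, h.op m = P := ⟨_, h.op_app_one P⟩
  have h1 : ∀ i, pderiv i m = 0 := fun i ↦ h.op_injective (by
    rw [← h.op_comm_coord, (hx i).eq, sub_self, map_zero])
  have h2 : ∀ i, h.coeffDer (d i) m = 0 := fun i ↦ h.op_injective (by
    rw [← h.op_comm_d, (hd i).eq, sub_self, map_zero])
  change h.op m ∈ h.frob.range
  rw [MvPolynomial.as_sum m, map_sum]
  refine sum_mem fun α hα ↦ ?_
  have h3 : ∃ β : ι →₀ ℕ, α = p • β := by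
    refine ⟨Finsupp.equivFunOnFinite.symm fun i ↦ α i / p, ?_⟩
    ext i
    simp [Nat.mul_div_cancel' (h.dvd_of_pderiv_eq_zero h1 α (mem_support_iff.1 hα) i)]
  obtain ⟨β, hβ⟩ := h3
  obtain ⟨b, hb⟩ := h.cartier (m.coeff α) fun i ↦ by
    rw [← h.coeff_coeffDer, h2, coeff_zero]
  refine ⟨monomial β b, ?_⟩
  rw [frob_apply, monomial_pow, ← hb, ← hβ]

/-- The differential operators in coordinates are a Weyl algebra over the polynomial ring. -/
lemma weylOver_frob (h : FrobeniusCoordinates p A L pp x d) :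
    WeylOver p h.frob (fun i ↦ Envelope.ofFun A L (x i)) (fun i ↦ Envelope.ofVec A L (d i)) where
  x_comm i j := (Commute.all _ _).map _
  d_comm i j := by
    have := Envelope.ofVec_comm_ofVec A L (d i) (d j)
    rw [h.d_comm, map_zero] at this
    exact sub_eq_zero.1 this
  rel i j hij := by
    have := Envelope.ofVec_comm_ofFun A L (x j) (d i)
    rw [h.dual_ne i j hij, map_zero] at this
    exact sub_eq_zero.1 this
  rel_self i := by
    have := Envelope.ofVec_comm_ofFun A L (x i) (d i)
    rw [h.dual_self i, map_one] at this
    exact sub_eq_iff_eq_add'.1 this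
  char := h.char_envelope
  x_pow i e := by
    rw [← map_pow, ← h.frob_C]; exact h.commute_frob _ e
  d_pow i e := by rw [← h.frob_X]; exact h.commute_frob _ e
  central := h.commute_frob
  inj := h.frob_injective
  centralizer := h.mem_range_frob

/-- The symmetric algebra in coordinates. -/
def symPolynomial (h : LieCoordinates A L x d) : SymmetricAlgebra A L →ₐ[A] MvPolynomial ι A :=
  SymmetricAlgebra.lift (R := A) (A := MvPolynomial ι A)
    { toFun := symbol x
      map_add' := symbol_add
      map_smul' := fun a D ↦ by
        rw [h.symbol_smul, RingHom.id_apply, MvPolynomial.smul_eq_C_mul] }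

lemma symPolynomial_ι (h : LieCoordinates A L x d) (D : L) :
    symPolynomial h (SymmetricAlgebra.ι A L D) = symbol x D :=
  SymmetricAlgebra.lift_ι_apply (R := A) (A := MvPolynomial ι A) _ D

/-- The `d i` generate `L` and have symbols `X i`, so the inverse sends `X i` to `d i`. -/
lemma symPolynomial_bijective (h : LieCoordinates A L x d) : Function.Bijective (symPolynomial h) := by
  let g : MvPolynomial ι A →ₐ[A] SymmetricAlgebra A L :=
    MvPolynomial.aeval fun i ↦ SymmetricAlgebra.ι A L (d i)
  have h1 : g.comp (symPolynomial h) = AlgHom.id A _ := by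
    refine SymmetricAlgebra.algHom_ext (LinearMap.ext fun D ↦ ?_)
    change g (symPolynomial h (SymmetricAlgebra.ι A L D)) = SymmetricAlgebra.ι A L D
    rw [symPolynomial_ι, symbol, map_sum]
    conv_rhs => rw [h.eq_sum D, map_sum]
    refine Finset.sum_congr rfl fun i _ ↦ ?_
    rw [map_mul, map_smul, ← MvPolynomial.algebraMap_eq, AlgHom.commutes, Algebra.smul_def]
    congr 1
    exact MvPolynomial.aeval_X _ i
  have h2 : (symPolynomial h).comp g = AlgHom.id A _ := by
    refine MvPolynomial.algHom_ext fun i ↦ ?_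
    change symPolynomial h (g (X i)) = X i
    rw [show g (X i) = SymmetricAlgebra.ι A L (d i) from MvPolynomial.aeval_X _ i, symPolynomial_ι,
      h.symbol_d]
  exact Function.bijective_iff_has_inverse.2 ⟨g, fun t ↦ congr($h1 t), fun t ↦ congr($h2 t)⟩

/-- The homomorphism from the symmetric algebra to the center of the enveloping algebra. -/
def symFrob (h : FrobeniusCoordinates p A L pp x d) : SymmetricAlgebra A L →+* Envelope A L :=
  h.frob.comp (symPolynomial h.toLieCoordinates).toRingHom

lemma symFrob_algebraMap (h : FrobeniusCoordinates p A L pp x d) (a : A) :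
    h.symFrob (algebraMap A _ a) = Envelope.ofFun A L (a ^ p) := by
  rw [← h.frob_C]
  exact congrArg h.frob ((symPolynomial h.toLieCoordinates).commutes a)

lemma symFrob_ι (h : FrobeniusCoordinates p A L pp x d) (D : L) :
    h.symFrob (SymmetricAlgebra.ι A L D) = Envelope.ofVec A L D ^ p - Envelope.ofVec A L (pp D) := by
  rw [← h.frob_symbol]
  exact congrArg h.frob (symPolynomial_ι h.toLieCoordinates D)

lemma weylOver_symFrob (h : FrobeniusCoordinates p A L pp x d) :
    WeylOver p h.symFrob (fun i ↦ Envelope.ofFun A L (x i)) (fun i ↦ Envelope.ofVec A L (d i)) :=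
  h.weylOver_frob.comp_bijective (symPolynomial_bijective h.toLieCoordinates)

end FrobeniusCoordinates

end FrobeniusCoordinates


/-! ### Smooth algebras over a field are reduced -/

open TensorProduct Polynomial in
/-- A smooth algebra over a field is reduced. -/
lemma isReduced_of_smooth (k A : Type u) [Field k] [CommRing A] [Algebra k A] [Algebra.Smooth k A] :
    IsReduced A := by
  refine ⟨fun x hx ↦ ?_⟩
  let K := FractionRing k[X]
  let S := k[X] ⊗[k] A
  have : Algebra.Smooth k[X] S := inferInstance
  obtain ⟨hinj, hsurj⟩ := TensorProduct.toIntegralClosure_bijective_of_smooth (R := k[X]) (S := S) (B := K)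
  have hX : (algebraMap k[X] K X) ≠ 0 := by
    rw [map_ne_zero_iff _ (IsFractionRing.injective k[X] K)]; exact X_ne_zero
  let x' : S := 1 ⊗ₜ x
  have hx' : IsNilpotent x' := hx.map (Algebra.TensorProduct.includeRight : A →ₐ[k] k[X] ⊗[k] A)
  -- The element `x / X` is nilpotent, hence integral over `S = A[X]`. Integral closure commutes
  -- with smooth base change and `k[X]` is integrally closed, so `x / X` lies in `S`. Then `x` is
  -- divisible by `X` in `S`, and setting `X = 0` gives `x = 0`.
  let y : S ⊗[k[X]] K := x' ⊗ₜ (algebraMap k[X] K X)⁻¹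
  have hy : IsNilpotent y := by
    obtain ⟨n, hn⟩ := hx'
    exact ⟨n, by rw [Algebra.TensorProduct.tmul_pow, hn, TensorProduct.zero_tmul]⟩
  have hyi : IsIntegral S y := by
    obtain ⟨n, hn⟩ := hy
    refine ⟨X ^ n, monic_X_pow n, by simp [hn]⟩
  obtain ⟨z, hz⟩ := hsurj ⟨y, hyi⟩
  have hs : ∃ s : S, y = s ⊗ₜ 1 := by
    have hz' : (TensorProduct.toIntegralClosure k[X] S K z : S ⊗[k[X]] K) = y := congrArg Subtype.val hz
    rw [← hz']
    clear hz hz'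
    induction z with
    | zero => exact ⟨0, by simp⟩
    | add z z' h h' =>
      obtain ⟨s, hs⟩ := h
      obtain ⟨s', hs'⟩ := h'
      exact ⟨s + s', by rw [map_add, Subalgebra.coe_add, hs, hs', TensorProduct.add_tmul]⟩
    | tmul s b =>
      obtain ⟨r, hr⟩ := (IsIntegrallyClosed.isIntegral_iff (R := k[X]) (K := K)).1 b.2
      refine ⟨r • s, ?_⟩
      change s ⊗ₜ[k[X]] (b : K) = _
      rw [← hr, Algebra.algebraMap_eq_smul_one, TensorProduct.smul_tmul]
  obtain ⟨s, hs⟩ := hs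
  have hfl : Function.Injective (Algebra.TensorProduct.includeLeft : S →ₐ[k[X]] S ⊗[k[X]] K) :=
    Algebra.TensorProduct.includeLeft_injective (IsFractionRing.injective k[X] K)
  have h1 : x' = (X : k[X]) • s := by
    apply hfl
    change x' ⊗ₜ[k[X]] (1 : K) = ((X : k[X]) • s) ⊗ₜ[k[X]] (1 : K)
    have := congrArg ((X : k[X]) • ·) hs
    simp only [y, ← TensorProduct.tmul_smul] at this
    rw [Algebra.smul_def, mul_inv_cancel₀ hX] at this
    rw [this, TensorProduct.tmul_smul, TensorProduct.smul_tmul']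
  let ev : S →ₐ[k] A := Algebra.TensorProduct.lift (Polynomial.aeval 0) (AlgHom.id k A)
    fun _ _ ↦ Commute.all _ _
  have h2 := congrArg ev (h1.trans (Algebra.smul_def (X : k[X]) s))
  rw [map_mul] at h2
  have h3 : ev (algebraMap k[X] S X) = 0 := by
    refine (Algebra.TensorProduct.lift_tmul _ _ _ (X : k[X]) (1 : A)).trans ?_
    simp
  rw [h3, zero_mul] at h2
  have h4 : ev x' = x := by
    refine (Algebra.TensorProduct.lift_tmul _ _ _ (1 : k[X]) x).trans ?_
    simp
  rw [← h4, h2]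

/-! ### Functions with vanishing differential are `p`-th powers -/

section Cartier

open TensorProduct in
/-- An unramified algebra which contains `p`-th powers only of scalars is a quotient. -/
lemma surjective_algebraMap_of_pow_mem {S A : Type u} [CommRing S] [CommRing A] [Algebra S A] {p : ℕ}
    [Fact p.Prime] (h0 : (p : A) = 0) [Algebra.FiniteType S A] [Algebra.FormallyUnramified S A]
    (h : ∀ a : A, a ^ p ∈ Set.range (algebraMap S A)) : Function.Surjective (algebraMap S A) := by
  have : Algebra.IsIntegral S A := ⟨fun a ↦ by
    obtain ⟨b, hb⟩ := h a
    exact IsIntegral.of_pow (Fact.out : p.Prime).pos (hb ▸ isIntegral_algebraMap)⟩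
  have : Module.Finite S A := Algebra.IsIntegral.finite
  rw [← Algebra.isEpi_iff_surjective_algebraMap_of_finite, Algebra.isEpi_iff_forall_one_tmul_eq]
  obtain ⟨t, ht, ht1⟩ := Algebra.FormallyUnramified.iff_exists_tensorProduct.1 ‹Algebra.FormallyUnramified S A›
  have hp0 : (p : A ⊗[S] A) = 0 := by
    rw [← map_natCast (algebraMap A (A ⊗[S] A)), h0, map_zero]
  -- The `p`-th power of `1 ⊗ a - a ⊗ 1` vanishes since `a ^ p` comes from `S`. The element `t`
  -- given by unramifiedness is thus `1` minus a nilpotent, a unit; it kills `1 ⊗ a - a ⊗ 1`, so `S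
  -- → A` is an epimorphism, and a finite epimorphism is surjective.
  have hnil : KaehlerDifferential.ideal S A ≤ nilradical (A ⊗[S] A) := by
    rw [← KaehlerDifferential.span_range_eq_ideal, Ideal.span_le]
    rintro _ ⟨a, rfl⟩
    refine ⟨p, ?_⟩
    have e := add_pow_prime_of_cast_eq_zero (Fact.out : p.Prime) hp0
      ((1 : A) ⊗ₜ[S] a - a ⊗ₜ[S] (1 : A)) (a ⊗ₜ[S] (1 : A))
    rw [sub_add_cancel, Algebra.TensorProduct.tmul_pow, Algebra.TensorProduct.tmul_pow, one_pow] at e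
    obtain ⟨b, hb⟩ := h a
    rw [← hb, Algebra.algebraMap_eq_smul_one, ← TensorProduct.smul_tmul] at e
    exact right_eq_add.1 e
  have hu : IsUnit t := by
    have h1 : 1 - t ∈ KaehlerDifferential.ideal S A := by
      rw [KaehlerDifferential.ideal, RingHom.mem_ker, map_sub, map_one, sub_eq_zero]
      exact ht1.symm
    have := (mem_nilradical.1 (hnil h1)).isUnit_one_sub
    rwa [sub_sub_cancel] at this
  intro a
  have := ht a
  rw [hu.mul_left_eq_zero, sub_eq_zero] at this
  exact this

variable {A : Type u} [CommRing A] {p : ℕ} [Fact p.Prime]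

lemma iterate_derivation_mul_pow (δ : Derivation ℤ A A) {x u : A} (hx : δ x = 1) (hu : δ u = 0)
    (m n : ℕ) : δ^[n] (u * x ^ m) = m.descFactorial n * (u * x ^ (m - n)) := by
  induction n with
  | zero => simp
  | succ n ih =>
    have hn : δ (((m.descFactorial n : ℕ) : A)) = 0 := δ.map_natCast _
    rw [Function.iterate_succ_apply', ih, δ.leibniz, δ.leibniz, δ.leibniz_pow, hx, hu, hn,
      Nat.descFactorial_succ]
    simp only [smul_eq_mul, mul_zero, add_zero, mul_one, nsmul_eq_mul, Nat.cast_mul, Nat.sub_sub]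
    ring

/-- Projection to the kernel of a derivation kills the positive powers of the coordinate. -/
lemma projection_mul_pow {c : ℕ → ℤ} (hc0 : c 0 = (1 : A))
    (hc : ∀ n < p, (c n : A) * (n.factorial : A) = 1)
    (δ : Derivation ℤ A A) {x u : A} (hx : δ x = 1) (hu : δ u = 0) {m : ℕ} (hm : m < p) :
    ∑ n ∈ Finset.range p, (c n : A) * ((-x) ^ n * δ^[n] (u * x ^ m)) = if m = 0 then u else 0 := by
  have e : ∀ n ∈ Finset.range p, (c n : A) * ((-x) ^ n * δ^[n] (u * x ^ m)) =
      (((-1) ^ n * (m.choose n : ℤ) : ℤ) : A) * (u * x ^ m) := by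
    intro n hn
    rw [Finset.mem_range] at hn
    rw [iterate_derivation_mul_pow δ hx hu]
    by_cases hnm : n ≤ m
    · rw [Nat.descFactorial_eq_factorial_mul_choose, neg_pow]
      have e1 : x ^ m = x ^ n * x ^ (m - n) := by rw [← pow_add, Nat.add_sub_cancel' hnm]
      rw [e1]
      push_cast
      linear_combination ((-1) ^ n * m.choose n * u * x ^ n * x ^ (m - n)) * hc n hn
    · rw [Nat.descFactorial_of_lt (not_le.1 hnm), Nat.choose_eq_zero_of_lt (not_le.1 hnm)]
      simp
  rw [Finset.sum_congr rfl e, ← Finset.sum_mul, ← Int.cast_sum]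
  have e2 : ∑ n ∈ Finset.range p, (-1) ^ n * (m.choose n : ℤ) =
      ∑ n ∈ Finset.range (m + 1), (-1) ^ n * (m.choose n : ℤ) := by
    symm
    refine Finset.sum_subset (fun n hn ↦ ?_) fun n _ hn ↦ ?_
    · rw [Finset.mem_range] at hn ⊢; omega
    · rw [Finset.mem_range, not_lt] at hn
      rw [Nat.choose_eq_zero_of_lt (by omega)]; simp
  rw [e2, Int.alternating_sum_range_choose]
  split_ifs with h
  · simp [h]
  · simp

/-- If a ring of characteristic `p` is generated by `p`-th powers and elements `x i`, and `δ i` are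
dual derivations, then an element killed by the `δ i` is a `p`-th power. -/
lemma exists_eq_pow_of_derivation_eq_zero {ι : Type} [Fintype ι] (h0 : (p : A) = 0) (x : ι → A)
    (δ : ι → Derivation ℤ A A) (hdual : ∀ i, δ i (x i) = 1) (hne : ∀ i j, i ≠ j → δ i (x j) = 0)
    (hgen : ∀ N : AddSubgroup A, 1 ∈ N → (∀ c, ∀ a ∈ N, c ^ p * a ∈ N) → (∀ i, ∀ a ∈ N, x i * a ∈ N) →
      ∀ a, a ∈ N)
    (a : A) (ha : ∀ i, δ i a = 0) : ∃ b, a = b ^ p := by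
  classical
  obtain ⟨c, hc⟩ := exists_inverse_factorial.{u} p
  obtain ⟨hc0, hc⟩ := hc A h0
  have hpos := (Fact.out : p.Prime).pos
  -- Products of a `p`-th power and a monomial with exponents below `p` that does not involve the
  -- coordinates in `t`.
  let g (t : Finset ι) : Set A :=
    {a | ∃ (b : A) (α : ι → ℕ), (∀ i, α i < p) ∧ (∀ i ∈ t, α i = 0) ∧ a = b ^ p * ∏ i, x i ^ α i}
  have hδp : ∀ i b, δ i (b ^ p) = 0 := fun i b ↦ by
    rw [Derivation.leibniz_pow, ← Nat.cast_smul_eq_nsmul A, h0, zero_smul]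
  have hδx : ∀ i (s : Finset ι) (α : ι → ℕ), i ∉ s → δ i (∏ j ∈ s, x j ^ α j) = 0 := by
    intro i s α
    induction s using Finset.induction_on with
    | empty => intro _; simp
    | insert j s hj ih =>
      intro hi
      rw [Finset.mem_insert, not_or] at hi
      rw [Finset.prod_insert hj, Derivation.leibniz, ih hi.2, Derivation.leibniz_pow, hne i j hi.1]
      simp
  have hall : ∀ a, a ∈ AddSubgroup.closure (g ∅) := by
    refine hgen _ (AddSubgroup.subset_closure ⟨1, 0, fun _ ↦ hpos, by simp, by simp⟩) ?_ ?_
    · intro b a ha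
      refine AddSubgroup.closure_induction (p := fun a _ ↦ b ^ p * a ∈ AddSubgroup.closure (g ∅))
        ?_ (by simp [zero_mem]) (fun _ _ _ _ h h' ↦ by rw [mul_add]; exact add_mem h h')
        (fun _ _ h ↦ by rw [mul_neg]; exact neg_mem h) ha
      rintro _ ⟨b', α, h1, h2, rfl⟩
      exact AddSubgroup.subset_closure ⟨b * b', α, h1, h2, by ring⟩
    · intro i a ha
      refine AddSubgroup.closure_induction (p := fun a _ ↦ x i * a ∈ AddSubgroup.closure (g ∅))
        ?_ (by simp [zero_mem]) (fun _ _ _ _ h h' ↦ by rw [mul_add]; exact add_mem h h')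
        (fun _ _ h ↦ by rw [mul_neg]; exact neg_mem h) ha
      rintro _ ⟨b', α, h1, h2, rfl⟩
      have e : ∀ n, ∏ j, x j ^ Function.update α i n j = x i ^ n * ∏ j ∈ Finset.univ.erase i, x j ^ α j := by
        intro n
        rw [← Finset.mul_prod_erase _ _ (Finset.mem_univ i), Function.update_self]
        congr 1
        refine Finset.prod_congr rfl fun j hj ↦ ?_
        rw [Function.update_of_ne (Finset.ne_of_mem_erase hj)]
      have e' : ∏ j, x j ^ α j = x i ^ α i * ∏ j ∈ Finset.univ.erase i, x j ^ α j := by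
        rw [← Finset.mul_prod_erase _ _ (Finset.mem_univ i)]
      by_cases hi : α i + 1 < p
      · refine AddSubgroup.subset_closure ⟨b', Function.update α i (α i + 1), fun j ↦ ?_, by simp, ?_⟩
        · rcases eq_or_ne j i with rfl | hj
          · simpa using hi
          · simpa [hj] using h1 j
        · rw [e, e']; ring
      -- When the exponent reaches `p`, the factor `x i ^ p` is absorbed into the `p`-th power.
      · have hi' : α i + 1 = p := by have := h1 i; omega
        refine AddSubgroup.subset_closure ⟨b' * x i, Function.update α i 0, fun j ↦ ?_, by simp, ?_⟩
        · rcases eq_or_ne j i with rfl | hj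
          · simpa using hpos
          · simpa [hj] using h1 j
        · rw [e, e', mul_pow, ← hi']; ring
  -- Coordinates are eliminated one at a time: the projection to the kernel of `δ j` fixes `a` and
  -- kills all terms with a positive power of `x j`.
  have hstep : ∀ t : Finset ι, a ∈ AddSubgroup.closure (g t) := by
    intro t
    induction t using Finset.induction_on with
    | empty => exact hall a
    | insert j t hj ih =>
      let P : A →+ A :=
        { toFun := fun u ↦ ∑ n ∈ Finset.range p, (c n : A) * ((-x j) ^ n * (δ j)^[n] u)
          map_zero' := Finset.sum_eq_zero fun n _ ↦ by
            rw [Function.iterate_fixed (map_zero (δ j))]; simp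
          map_add' := fun u v ↦ by
            rw [← Finset.sum_add_distrib]
            refine Finset.sum_congr rfl fun n _ ↦ ?_
            rw [iterate_map_add]; ring }
      have hP : ∀ {u m}, δ j u = 0 → m < p → P (u * x j ^ m) = if m = 0 then u else 0 :=
        fun hu hm ↦ projection_mul_pow hc0 hc (δ j) (hdual j) hu hm
      have hPa : P a = a := by simpa using hP (m := 0) (ha j) hpos
      rw [← hPa]
      refine AddSubgroup.closure_induction
        (p := fun a _ ↦ P a ∈ AddSubgroup.closure (g (insert j t)))
        ?_ (by simp [zero_mem]) (fun _ _ _ _ h h' ↦ by rw [map_add]; exact add_mem h h')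
        (fun _ _ h ↦ by rw [map_neg]; exact neg_mem h) ih
      rintro _ ⟨b, α, h1, h2, rfl⟩
      have e : b ^ p * ∏ i, x i ^ α i = (b ^ p * ∏ i ∈ Finset.univ.erase j, x i ^ α i) * x j ^ α j := by
        rw [← Finset.mul_prod_erase _ _ (Finset.mem_univ j)]; ring
      rw [e, hP (by rw [Derivation.leibniz, hδp, hδx j _ α (by simp)]; simp) (h1 j)]
      split_ifs with h
      · refine AddSubgroup.subset_closure ⟨b, α, h1, fun i hi ↦ ?_, ?_⟩
        · rcases Finset.mem_insert.1 hi with rfl | hi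
          · exact h
          · exact h2 i hi
        · rw [e, h]; simp
      · exact zero_mem _
  have := hstep Finset.univ
  refine AddSubgroup.closure_induction (p := fun a _ ↦ ∃ b, a = b ^ p) ?_ ⟨0, by simp [hpos.ne']⟩
    ?_ ?_ this
  · rintro _ ⟨b, α, -, h2, rfl⟩
    exact ⟨b, by simp [fun i ↦ h2 i (Finset.mem_univ i)]⟩
  · rintro _ _ _ _ ⟨b, rfl⟩ ⟨b', rfl⟩
    exact ⟨b + b', (add_pow_prime_of_cast_eq_zero Fact.out h0 b b').symm⟩
  · rintro _ _ ⟨b, rfl⟩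
    refine ⟨-b, ?_⟩
    have := add_pow_prime_of_cast_eq_zero (Fact.out : p.Prime) h0 b (-b)
    rw [add_neg_cancel, zero_pow hpos.ne'] at this
    exact neg_eq_of_add_eq_zero_right this.symm

/-- The Cartier property of a smooth algebra over a perfect field in coordinates. -/
lemma exists_eq_pow_of_basis {k : Type u} [Field k] [CharP k p] [PerfectRing k p] [Algebra k A]
    [Algebra.FiniteType k A] {ι : Type} [Fintype ι] (x : ι → A)
    (b : Module.Basis ι A Ω[A⁄k]) (hb : ∀ i, b i = KaehlerDifferential.D k A (x i))
    (a : A) (ha : ∀ i, b.repr (KaehlerDifferential.D k A a) i = 0) : ∃ c, a = c ^ p := by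
  classical
  have h0 : (p : A) = 0 := by rw [← map_natCast (algebraMap k A), CharP.cast_eq_zero, map_zero]
  -- The differentials of `A` over `S` are spanned by the `dx i`, which vanish. So `A` is unramified
  -- over `S` and contains only elements whose `p`-th powers lie in `S`; hence `S = A`.
  let S : Subalgebra k A := Algebra.adjoin k (Set.range (fun a : A ↦ a ^ p) ∪ Set.range x)
  have hft : Algebra.FiniteType S A := Algebra.FiniteType.of_restrictScalars_finiteType k S A
  have hun : Algebra.FormallyUnramified S A := by
    rw [Algebra.formallyUnramified_iff]
    have hsurj : Function.Surjective (KaehlerDifferential.map k S A A) :=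
      KaehlerDifferential.map_surjective k S A
    have hz : KaehlerDifferential.map k S A A = 0 := by
      refine b.ext fun i ↦ ?_
      rw [hb, KaehlerDifferential.map_D, LinearMap.zero_apply]
      exact (KaehlerDifferential.D S A).map_algebraMap
        (⟨x i, Algebra.subset_adjoin (.inr ⟨i, rfl⟩)⟩ : S)
    refine ⟨fun u v ↦ ?_⟩
    obtain ⟨u, rfl⟩ := hsurj u
    obtain ⟨v, rfl⟩ := hsurj v
    rw [hz]; rfl
  have hS : ∀ a : A, a ∈ S := fun a ↦ by
    obtain ⟨s, rfl⟩ := surjective_algebraMap_of_pow_mem (S := S) (p := p) h0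
      (fun a ↦ ⟨⟨a ^ p, Algebra.subset_adjoin (.inl ⟨a, rfl⟩)⟩, rfl⟩) a
    exact s.2
  let δ : ι → Derivation ℤ A A := fun i ↦
    ((b.coord i).compDer (KaehlerDifferential.D k A)).restrictScalars ℤ
  have hδ : ∀ i a, δ i a = b.repr (KaehlerDifferential.D k A a) i := fun _ _ ↦ rfl
  refine exists_eq_pow_of_derivation_eq_zero h0 x δ (fun i ↦ by rw [hδ, ← hb]; simp)
    (fun i j hij ↦ by rw [hδ, ← hb]; simp [hij.symm]) (fun N h1 hp hx a ↦ ?_) a ha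
  have : ∀ a ∈ S, ∀ n ∈ N, a * n ∈ N := by
    intro a ha
    refine Algebra.adjoin_induction (p := fun a _ ↦ ∀ n ∈ N, a * n ∈ N) ?_ ?_ ?_ ?_ ha
    · rintro _ (⟨c, rfl⟩ | ⟨i, rfl⟩)
      · exact hp c
      · exact hx i
    · intro r n hn
      -- Constants count as `p`-th powers because `k` is perfect.
      have : algebraMap k A r = (algebraMap k A ((frobeniusEquiv k p).symm r)) ^ p := by
        rw [← map_pow, frobeniusEquiv_symm_pow_p]
      rw [this]
      exact hp _ n hn
    · intro c c' _ _ h h' n hn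
      rw [add_mul]; exact add_mem (h n hn) (h' n hn)
    · intro c c' _ _ h h' n hn
      rw [mul_assoc]; exact h _ (h' n hn)
  simpa using this a (hS a) 1 h1

end Cartier


/-! ### Existence of local coordinates -/

section Chart

variable {k : Type u} [Field k] {X : Scheme.{u}} (s : X ⟶ Spec (.of k))

/-- A smooth scheme over a field: the functions on an affine open subset are a smooth algebra. -/
lemma smooth_constFun [Smooth s] {U : X.Opens} (hU : IsAffineOpen U) : (constFun s U).Smooth := by
  have h1 := s.smooth_appLE (isAffineOpen_top (Spec (.of k))) hU
    (show U ≤ s ⁻¹ᵁ ⊤ from le_top)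
  exact RingHom.Smooth.respectsIso.2 (s.appLE ⊤ U _).hom
    (Scheme.ΓSpecIso (.of k)).symm.commRingCatIsoToRingEquiv h1

lemma isReduced_sections_of_isAffineOpen [Smooth s] {U : X.Opens} (hU : IsAffineOpen U) :
    _root_.IsReduced Γ(X, U) := by
  let _ : Algebra k Γ(X, U) := (constFun s U).toAlgebra
  have : Algebra.Smooth k Γ(X, U) := smooth_constFun s hU
  exact isReduced_of_smooth k _

lemma eq_of_basicOpen_eq {U V : X.Opens} (hU : IsAffineOpen U) (hV : V ≤ U) {f g : Γ(X, V)}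
    (h : ∀ (a : Γ(X, U)) (ha : X.basicOpen a ≤ V), X.presheaf.map (homOfLE ha).op f =
      X.presheaf.map (homOfLE ha).op g) : f = g := by
  have hc : ∀ y : V, ∃ g : Γ(X, U), X.basicOpen g ≤ V ∧ y.1 ∈ X.basicOpen g :=
    fun y ↦ hU.exists_basicOpen_le y (hV y.2)
  choose a ha hy using hc
  exact X.sheaf.eq_of_locally_eq' (fun y : V ↦ X.basicOpen (a y)) V (fun y ↦ homOfLE (ha y))
    (fun y hyV ↦ Opens.mem_iSup.2 ⟨⟨y, hyV⟩, hy _⟩) _ _ fun y ↦ h _ (ha y)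

lemma isReduced_sections [Smooth s] (V : X.Opens) : _root_.IsReduced Γ(X, V) := by
  refine ⟨fun f hf ↦ ?_⟩
  have hc : ∀ y : V, ∃ W : X.Opens, IsAffineOpen W ∧ y.1 ∈ W ∧ W ≤ V := fun y ↦ by
    obtain ⟨W, hW, hyW, hWV⟩ := exists_isAffineOpen_mem_and_subset y.2
    exact ⟨W, hW, hyW, hWV⟩
  choose W hW hy hWV using hc
  refine X.sheaf.eq_of_locally_eq' W V (fun y ↦ homOfLE (hWV y))
    (fun y hyV ↦ Opens.mem_iSup.2 ⟨⟨y, hyV⟩, hy _⟩) _ _ fun y ↦ ?_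
  have := isReduced_sections_of_isAffineOpen s (hW y)
  refine ((hf.map (X.presheaf.map (homOfLE (hWV y)).op).hom).eq_zero).trans (map_zero _).symm

variable (p : ℕ) [Fact p.Prime] [CharP k p]

/-- An affine open subset with coordinates. -/
structure Chart where
  /-- the open subset -/
  opens : X.Opens
  isAffineOpen : IsAffineOpen opens
  /-- the set of coordinates -/
  {ι : Type}
  [fintype : Fintype ι]
  /-- the coordinates -/
  x : ι → Γ(X, opens)
  /-- the dual vector fields -/
  d : ι → VectorField s opens
  coordinates : ∀ (V : X.Opens) (h : V ≤ opens), FrobeniusCoordinates p Γ(X, V) (VectorField s V)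
    (VectorField.pPow p) (fun i ↦ X.presheaf.map (homOfLE h).op (x i))
    (fun i ↦ VectorField.restrict h (d i))
  krullDimLE : IsEmpty ι → Ring.KrullDimLE 0 Γ(X, opens)

attribute [instance] Chart.fintype

section Coordinates

variable {s p} {U : X.Opens} (hU : IsAffineOpen U) {ι : Type}

include hU

/-- On a basic open subset of `U`, the derivation restricted to functions on `U` factors through the
differentials, which the `dx i` span. A derivation of a localization is determined by its
restriction, and basic open subsets cover `V`. -/
lemma VectorField.eq_zero_of_derivation_ext (x : ι → Γ(X, U))
    (hx : letI := (constFun s U).toAlgebra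
      Submodule.span Γ(X, U) (Set.range fun i ↦ KaehlerDifferential.D k Γ(X, U) (x i)) = ⊤)
    {V : X.Opens} (hV : V ≤ U) {D : VectorField s V}
    (hD : ∀ i, D.app V le_rfl (X.presheaf.map (homOfLE hV).op (x i)) = 0) : D = 0 := by
  letI := (constFun s U).toAlgebra
  have key : ∀ (a : Γ(X, U)) (ha : X.basicOpen a ≤ V) (f : Γ(X, X.basicOpen a)), D.app _ ha f = 0 := by
    intro a ha f
    have := hU.isLocalization_basicOpen a
    letI : Algebra k Γ(X, X.basicOpen a) := (constFun s (X.basicOpen a)).toAlgebra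
    have : IsScalarTower k Γ(X, U) Γ(X, X.basicOpen a) :=
      .of_algebraMap_eq fun c ↦ (constFun_res s (X.basicOpen_le a) c).symm
    let δ : Derivation k Γ(X, U) Γ(X, X.basicOpen a) :=
      .mk' { toFun := fun f ↦ D.app _ ha (algebraMap Γ(X, U) Γ(X, X.basicOpen a) f)
             map_add' := fun f g ↦ by rw [map_add, map_add]
             map_smul' := fun c f ↦ by
              rw [Algebra.smul_def, map_mul, D.leibniz, RingHom.id_apply,
                ← IsScalarTower.algebraMap_apply, Algebra.smul_def]
              have := D.app_const _ ha c
              change _ + _ * D.app _ ha (constFun s _ c) = _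
              rw [this, mul_zero, add_zero] }
        fun f g ↦ by
          change D.app _ ha _ = _ • D.app _ ha _ + _ • D.app _ ha _
          rw [map_mul, D.leibniz, Algebra.smul_def, Algebra.smul_def]
    have hδ : δ.liftKaehlerDifferential = 0 := by
      refine LinearMap.ext_on_range hx fun i ↦ ?_
      rw [Derivation.liftKaehlerDifferential_comp_D, LinearMap.zero_apply]
      have := congrArg (X.presheaf.map (homOfLE ha).op) (hD i)
      rw [D.res, map_zero, res_res] at this
      exact this
    have hδ' : ∀ f, δ f = 0 := fun f ↦ by
      rw [← Derivation.liftKaehlerDifferential_comp_D, hδ, LinearMap.zero_apply]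
    exact eq_of_leibniz_of_isLocalization (Submonoid.powers a) (RingHom.id Γ(X, X.basicOpen a))
      (D.app _ ha) 0 (D.leibniz _ _) (fun _ _ ↦ by simp) hδ' f
  refine VectorField.ext_apply fun W hW f ↦ ?_
  refine eq_of_basicOpen_eq hU (hW.trans hV) fun a ha ↦ ?_
  rw [D.res, key a (ha.trans hW), VectorField.zero_app, map_zero]

/-- On basic open subsets one clears denominators by `p`-th powers, which the derivations ignore.
The local roots are unique because the sections are reduced, so they glue on an arbitrary open
subset. -/
lemma exists_eq_pow_of_lie_eq_zero [Smooth s] [PerfectRing k p]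
    (d : ι → VectorField s U)
    (hA : ∀ a : Γ(X, U), (∀ i, (d i).app U le_rfl a = 0) → ∃ b, a = b ^ p)
    [Finite ι] {V : X.Opens} (hV : V ≤ U) (a : Γ(X, V)) (ha : ∀ i, (d i).app V hV a = 0) :
    ∃ b, a = b ^ p := by
  have hp := (Fact.out : p.Prime)
  have hchar : ∀ W : X.Opens, (p : Γ(X, W)) = 0 := fun W ↦ by
    rw [← map_natCast (constFun s W), CharP.cast_eq_zero, map_zero]
  have key : ∀ (g : Γ(X, U)) (hg : X.basicOpen g ≤ V), ∃ b : Γ(X, X.basicOpen g),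
      X.presheaf.map (homOfLE hg).op a = b ^ p := by
    intro g hg
    have hloc := hU.isLocalization_basicOpen g
    let r := algebraMap Γ(X, U) Γ(X, X.basicOpen g)
    obtain ⟨⟨c, _, n, rfl⟩, hc⟩ := IsLocalization.surj (Submonoid.powers g)
      (X.presheaf.map (homOfLE hg).op a)
    change X.presheaf.map (homOfLE hg).op a * r (g ^ n) = r c at hc
    have hdg : ∀ i (f : Γ(X, U)), r ((d i).app U le_rfl f) = (d i).app _ (X.basicOpen_le g) (r f) :=
      fun i f ↦ (d i).res U le_rfl _ (X.basicOpen_le g) f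
    have hpow : ∀ (W : X.Opens) (hW : W ≤ U) i (f : Γ(X, W)), (d i).app W hW (f ^ p) = 0 := by
      intro W hW i f
      let δ : Derivation ℤ Γ(X, W) Γ(X, W) :=
        .mk' ((d i).app W hW).toIntLinearMap ((d i).leibniz W hW)
      have := δ.leibniz_pow f p
      rw [← Nat.cast_smul_eq_nsmul Γ(X, W), hchar, zero_smul] at this
      exact this
    have hag : ∀ i, (d i).app _ (X.basicOpen_le g) (X.presheaf.map (homOfLE hg).op a) = 0 := fun i ↦ by
      have := congrArg (X.presheaf.map (homOfLE hg).op) (ha i)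
      rw [(d i).res, map_zero] at this
      exact this
    -- The extra factor turns the denominator `g ^ n` of `a` into its `p`-th power.
    let c' := c * g ^ (n * (p - 1))
    have hc' : r c' = X.presheaf.map (homOfLE hg).op a * r (g ^ n) ^ p := by
      have e : r (g ^ n) ^ p = r (g ^ n) * r (g ^ n) ^ (p - 1) := by
        rw [← pow_succ', Nat.sub_add_cancel hp.one_le]
      simp only [c']
      rw [map_mul, ← hc, e, pow_mul, map_pow r (g ^ n) (p - 1), mul_assoc]
    have h1 : ∀ i, ∃ m : ℕ, g ^ m * (d i).app U le_rfl c' = 0 := fun i ↦ by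
      have : r ((d i).app U le_rfl c') = 0 := by
        rw [hdg, hc', (d i).leibniz, hag, hpow, mul_zero, mul_zero, add_zero]
      obtain ⟨⟨_, m, rfl⟩, hm⟩ := (IsLocalization.map_eq_zero_iff (Submonoid.powers g) _ _).1 this
      exact ⟨m, hm⟩
    choose m hm using h1
    obtain ⟨N, hN⟩ : ∃ N, ∀ i, m i ≤ N := by
      have := Fintype.ofFinite ι
      exact ⟨Finset.univ.sup m, fun i ↦ Finset.le_sup (Finset.mem_univ i)⟩
    -- The derivatives of `c'` vanish only after restriction to the basic open subset; one common
    -- power of `g` kills all of them on `U`.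
    obtain ⟨b, hb⟩ := hA ((g ^ N) ^ p * c') fun i ↦ by
      rw [(d i).leibniz, hpow, mul_zero, add_zero]
      have hle : m i ≤ N * p := (hN i).trans (Nat.le_mul_of_pos_right N hp.pos)
      rw [← pow_mul, ← Nat.sub_add_cancel hle, pow_add, mul_assoc, hm, mul_zero]
    have hu : IsUnit (r (g ^ N) * r (g ^ n)) := by
      rw [← map_mul, ← pow_add]
      exact IsLocalization.map_units _ (⟨g ^ (N + n), N + n, rfl⟩ : Submonoid.powers g)
    have h2 := congrArg r hb
    rw [map_mul, hc', map_pow r (g ^ N) p, map_pow r b p] at h2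
    refine ⟨↑hu.unit⁻¹ * r b, ?_⟩
    rw [mul_pow, ← h2]
    have h3 : (↑hu.unit⁻¹ : Γ(X, X.basicOpen g)) * (r (g ^ N) * r (g ^ n)) = 1 := hu.val_inv_mul
    have h4 := congrArg (· ^ p) h3
    simp only [mul_pow, one_pow] at h4
    linear_combination (-X.presheaf.map (homOfLE hg).op a) * h4
  have hc : ∀ y : V, ∃ g : Γ(X, U), X.basicOpen g ≤ V ∧ y.1 ∈ X.basicOpen g :=
    fun y ↦ hU.exists_basicOpen_le y (hV y.2)
  choose g hg hy using hc
  choose b hb using fun y ↦ key (g y) (hg y)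
  have hcover : V ≤ ⨆ y, X.basicOpen (g y) := fun y hyV ↦ Opens.mem_iSup.2 ⟨⟨y, hyV⟩, hy _⟩
  obtain ⟨c, hc, -⟩ := X.sheaf.existsUnique_gluing' (fun y : V ↦ X.basicOpen (g y)) V
    (fun y ↦ homOfLE (hg y)) hcover b (fun y z ↦ by
      have hred := isReduced_sections s (X.basicOpen (g y) ⊓ X.basicOpen (g z))
      have h1 := congrArg (X.presheaf.map (Opens.infLELeft (X.basicOpen (g y)) (X.basicOpen (g z))).op) (hb y)
      have h2 := congrArg (X.presheaf.map (Opens.infLERight (X.basicOpen (g y)) (X.basicOpen (g z))).op) (hb z)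
      have h12 := h1.symm.trans ((res_res (hg y) inf_le_left a).trans
        ((res_res (hg z) inf_le_right a).symm.trans h2))
      rw [map_pow, map_pow] at h12
      have e := add_pow_prime_of_cast_eq_zero hp (hchar (X.basicOpen (g y) ⊓ X.basicOpen (g z)))
        (X.presheaf.map (Opens.infLELeft (X.basicOpen (g y)) (X.basicOpen (g z))).op (b y) -
          X.presheaf.map (Opens.infLERight (X.basicOpen (g y)) (X.basicOpen (g z))).op (b z))
        (X.presheaf.map (Opens.infLERight (X.basicOpen (g y)) (X.basicOpen (g z))).op (b z))
      rw [sub_add_cancel, h12] at e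
      exact sub_eq_zero.1 (hred.eq_zero _ ⟨p, right_eq_add.1 e⟩))
  refine ⟨c, X.sheaf.eq_of_locally_eq' (fun y : V ↦ X.basicOpen (g y)) V (fun y ↦ homOfLE (hg y))
    hcover _ _ fun y ↦ ?_⟩
  refine (hb y).trans ?_
  rw [← hc y]
  exact (map_pow (X.presheaf.map (homOfLE (hg y)).op).hom c p).symm

end Coordinates

/-- A standard smooth neighbourhood has a basis of differentials consisting of exact ones. The dual
basis gives derivations of the functions, and these extend to vector fields. -/
lemma exists_chart [Smooth s] [PerfectRing k p] (W : X.Opens) (z : X) (hz : z ∈ W) :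
    ∃ c : Chart s p, z ∈ c.opens ∧ c.opens ≤ W := by
  classical
  obtain ⟨U₀, hU₀, hzU₀, hU₀W⟩ := exists_isAffineOpen_mem_and_subset hz
  have hU₀W : U₀ ≤ W := hU₀W
  let _ : Algebra k Γ(X, U₀) := (constFun s U₀).toAlgebra
  have : Algebra.Smooth k Γ(X, U₀) := smooth_constFun s hU₀
  obtain ⟨S, hS, hstd⟩ := Algebra.Smooth.exists_span_eq_top_isStandardSmooth k Γ(X, U₀)
  have hcov := iSup_basicOpen_of_span_eq_top U₀ S hS
  obtain ⟨f, hf⟩ := Opens.mem_iSup.1 (hcov.symm ▸ hzU₀ : z ∈ ⨆ i ∈ S, X.basicOpen i)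
  obtain ⟨hfS, hzf⟩ := Opens.mem_iSup.1 hf
  let U := X.basicOpen f
  have hU : IsAffineOpen U := hU₀.basicOpen f
  have hUU₀ : U ≤ U₀ := X.basicOpen_le f
  let _ : Algebra k Γ(X, U) := (constFun s U).toAlgebra
  have : IsScalarTower k Γ(X, U₀) Γ(X, U) :=
    .of_algebraMap_eq fun c ↦ (constFun_res s hUU₀ c).symm
  have := hU₀.isLocalization_basicOpen f
  have hstd' := hstd f hfS
  have : Algebra.IsStandardSmooth k Γ(X, U) := .of_algEquiv (R := k) (S := Localization.Away f)
    ((IsLocalization.algEquiv (Submonoid.powers f) (Localization.Away f) Γ(X, U)).restrictScalars k)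
  have : Algebra.Smooth k Γ(X, U) := smooth_constFun s hU
  obtain ⟨-, ι, b, hb⟩ := Algebra.IsStandardSmooth.iff_exists_basis_kaehlerDifferential.1
    ‹Algebra.IsStandardSmooth k Γ(X, U)›
  have : Nontrivial Γ(X, U) := by
    have : Nonempty U := ⟨⟨z, hzf⟩⟩
    infer_instance
  have : Finite ι := Module.Finite.finite_basis b
  have : Fintype ι := Fintype.ofFinite ι
  have hb' : ∀ i, ∃ x, KaehlerDifferential.D k Γ(X, U) x = b i := fun i ↦ hb ⟨i, rfl⟩
  choose x hx using hb'
  let δ : ι → Derivation k Γ(X, U) Γ(X, U) := fun i ↦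
    (b.coord i).compDer (KaehlerDifferential.D k Γ(X, U))
  have hd : ∀ i, ∃ D : VectorField s U, D.app U le_rfl = (δ i).toLinearMap.toAddMonoidHom := fun i ↦
    VectorField.exists_of_isAffineOpen hU _ (fun f g ↦ (δ i).leibniz f g)
      (fun c ↦ (δ i).map_algebraMap c)
  choose d hd using hd
  have hdapp : ∀ i a, (d i).app U le_rfl a = b.repr (KaehlerDifferential.D k Γ(X, U) a) i :=
    fun i a ↦ congr($(hd i) a)
  have hdual : ∀ i j, (d i).app U le_rfl (x j) = if i = j then 1 else 0 := fun i j ↦ by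
    rw [hdapp, hx, b.repr_self, Finsupp.single_apply]
    simp only [eq_comm]
  have hspan : Submodule.span Γ(X, U) (Set.range fun i ↦ KaehlerDifferential.D k Γ(X, U) (x i)) = ⊤ := by
    simp only [hx]; exact b.span_eq
  refine ⟨⟨U, hU, x, d, fun V hV ↦ ?_, fun hι ↦ ?_⟩, hzf, hUU₀.trans hU₀W⟩
  · have hdualV : ∀ i j, (d i).app V hV (X.presheaf.map (homOfLE hV).op (x j)) =
        if i = j then 1 else 0 := fun i j ↦ by
      rw [← (d i).res U le_rfl V hV, hdual]
      split_ifs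
      · exact map_one (X.presheaf.map (homOfLE hV).op).hom
      · exact map_zero (X.presheaf.map (homOfLE hV).op).hom
    refine
      { leibniz := fun D ↦ D.leibniz V le_rfl
        smul_lie := fun a D f ↦ ?_
        dual_self := fun i ↦ (hdualV i i).trans (if_pos rfl)
        dual_ne := fun i j hij ↦ (hdualV i j).trans (if_neg hij)
        ext := fun D hD ↦ VectorField.eq_zero_of_derivation_ext hU x hspan hV hD
        char := by rw [← map_natCast (constFun s V), CharP.cast_eq_zero, map_zero]
        lie_pp := fun D a ↦ rfl
        reduced := isReduced_sections s V
        cartier := exists_eq_pow_of_lie_eq_zero hU d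
          (fun a ha ↦ exists_eq_pow_of_basis x b (fun i ↦ (hx i).symm) a fun i ↦
            (hdapp i a).symm.trans (ha i)) hV }
    change X.presheaf.map (homOfLE le_rfl).op a * _ = a * _
    congr 1
    exact congr($(X.presheaf.map_id (op V)) a)
  -- Without coordinates there are no differentials, so the algebra is unramified, hence finite over
  -- `k` and Artinian.
  · have : Subsingleton Ω[Γ(X, U)⁄k] := b.repr.toEquiv.subsingleton
    have : Algebra.FormallyUnramified k Γ(X, U) := (Algebra.formallyUnramified_iff _ _).2 this
    have : Module.Finite k Γ(X, U) := Algebra.FormallyUnramified.finite_of_free k Γ(X, U)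
    have : IsArtinianRing Γ(X, U) := IsArtinianRing.of_finite k Γ(X, U)
    infer_instance

end Chart


/-! ### Sections of an associated sheaf of rings -/

section Sheafify

variable {X : TopCat.{u}} (P : TopCat.Presheaf RingCat.{u} X)

/-- The sheaf associated with a presheaf of rings. -/
def ringSheafify : TopCat.Sheaf RingCat.{u} X :=
  (presheafToSheaf (Opens.grothendieckTopology X) RingCat.{u}).obj P

/-- The map from a presheaf of rings to the associated sheaf, on sections. -/
def ringSheafifyMap (V : Opens X) : P.obj (op V) →+* (ringSheafify P).presheaf.obj (op V) :=
  ((toSheafify (Opens.grothendieckTopology X) P).app (op V)).hom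

variable {P}

lemma ringSheafifyMap_res {V W : Opens X} (h : W ≤ V) (a : P.obj (op V)) :
    (ringSheafify P).presheaf.map (homOfLE h).op (ringSheafifyMap P V a) =
      ringSheafifyMap P W (P.map (homOfLE h).op a) :=
  (ConcreteCategory.congr_hom ((toSheafify (Opens.grothendieckTopology X) P).naturality
    (homOfLE h).op) a).symm

lemma exists_res_eq_of_ringSheafifyMap_eq {V : Opens X} {a b : P.obj (op V)}
    (h : ringSheafifyMap P V a = ringSheafifyMap P V b) (x : X) (hx : x ∈ V) :
    ∃ (W : Opens X) (hW : W ≤ V), x ∈ W ∧ P.map (homOfLE hW).op a = P.map (homOfLE hW).op b := by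
  have := Presheaf.equalizerSieve_mem (Opens.grothendieckTopology X)
    (toSheafify (Opens.grothendieckTopology X) P) a b h
  obtain ⟨W, f, hf, hxW⟩ := this x hx
  exact ⟨W, f.le, hxW, hf⟩

lemma exists_ringSheafifyMap_eq_res {V : Opens X} (t : (ringSheafify P).presheaf.obj (op V)) (x : X)
    (hx : x ∈ V) : ∃ (W : Opens X) (hW : W ≤ V), x ∈ W ∧ ∃ a, ringSheafifyMap P W a =
      (ringSheafify P).presheaf.map (homOfLE hW).op t := by
  have := Presheaf.imageSieve_mem (Opens.grothendieckTopology X)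
    (toSheafify (Opens.grothendieckTopology X) P) t
  obtain ⟨W, f, ⟨a, ha⟩, hxW⟩ := this x hx
  exact ⟨W, f.le, hxW, a, ha⟩

lemma presheaf_res_res {V W W' : Opens X} (h : W ≤ V) (h' : W' ≤ W) (f : P.obj (op V)) :
    P.map (homOfLE h').op (P.map (homOfLE h).op f) = P.map (homOfLE (h'.trans h)).op f := by
  rw [← ConcreteCategory.comp_apply, ← Functor.map_comp]
  rfl

variable (P) in
/-- A presheaf is separated on `V`. -/
def IsSeparatedAt (V : Opens X) : Prop :=
  ∀ a b : P.obj (op V), (∀ x ∈ V, ∃ (W : Opens X) (hW : W ≤ V), x ∈ W ∧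
    P.map (homOfLE hW).op a = P.map (homOfLE hW).op b) → a = b

variable (P) in
/-- Compatible families of sections of a presheaf on open covers of `V` glue. -/
def GluesAt (V : Opens X) : Prop :=
  ∀ (W : V → Opens X) (hW : ∀ y, W y ≤ V) (_ : ∀ y, y.1 ∈ W y) (a : ∀ y, P.obj (op (W y))),
    (∀ y z, P.map (homOfLE (inf_le_left : W y ⊓ W z ≤ W y)).op (a y) =
      P.map (homOfLE (inf_le_right : W y ⊓ W z ≤ W z)).op (a z)) →
    ∃ b : P.obj (op V), ∀ y, P.map (homOfLE (hW y)).op b = a y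

lemma ringSheafifyMap_injective {V : Opens X} (h : IsSeparatedAt P V) :
    Function.Injective (ringSheafifyMap P V) :=
  fun _ _ hab ↦ h _ _ fun x hx ↦ exists_res_eq_of_ringSheafifyMap_eq hab x hx

lemma sheaf_eq_of_locally_eq (F : TopCat.Sheaf RingCat.{u} X) {V : Opens X}
    {a b : F.presheaf.obj (op V)} (h : ∀ x ∈ V, ∃ (W : Opens X) (hW : W ≤ V), x ∈ W ∧
      F.presheaf.map (homOfLE hW).op a = F.presheaf.map (homOfLE hW).op b) : a = b := by
  choose W hW hx h using fun x : V ↦ h x.1 x.2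
  exact F.eq_of_locally_eq' W V (fun x ↦ homOfLE (hW x))
    (fun x hxV ↦ Opens.mem_iSup.2 ⟨⟨x, hxV⟩, hx _⟩) _ _ h

/-- A section of the associated sheaf comes locally from `P`. Separatedness on the overlaps makes
these local sections compatible already in `P`, where they glue. -/
lemma ringSheafifyMap_surjective {V : Opens X} (h : ∀ W ≤ V, IsSeparatedAt P W) (hV : GluesAt P V) :
    Function.Surjective (ringSheafifyMap P V) := by
  intro t
  choose W hW hx a ha using fun x : V ↦ exists_ringSheafifyMap_eq_res t x.1 x.2
  obtain ⟨b, hb⟩ := hV W hW hx a fun y z ↦ by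
    apply ringSheafifyMap_injective (h _ (inf_le_left.trans (hW y)))
    rw [← ringSheafifyMap_res, ← ringSheafifyMap_res, ha, ha, presheaf_res_res, presheaf_res_res]
  refine ⟨b, sheaf_eq_of_locally_eq _ fun x hx' ↦ ⟨W ⟨x, hx'⟩, hW _, hx _, ?_⟩⟩
  rw [ringSheafifyMap_res, hb, ha]

lemma ringSheafifyMap_bijective {V : Opens X} (h : ∀ W ≤ V, IsSeparatedAt P W) (hV : GluesAt P V) :
    Function.Bijective (ringSheafifyMap P V) :=
  ⟨ringSheafifyMap_injective (h V le_rfl), ringSheafifyMap_surjective h hV⟩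

end Sheafify

/-! ### Sections of `𝒟_X` over coordinate neighbourhoods -/

section DiffOpSections

variable {k : Type u} [Field k] {X : Scheme.{u}} {s : X ⟶ Spec (.of k)}
  {p : ℕ} [Fact p.Prime] [CharP k p]

open MvPolynomial

variable (s) in
/-- Restriction of sections of the presheaf of enveloping algebras. -/
def diffOpRes {V W : X.Opens} (h : W ≤ V) :
    Envelope Γ(X, V) (VectorField s V) →+* Envelope Γ(X, W) (VectorField s W) :=
  Envelope.map (X.presheaf.map (homOfLE h).op).hom (VectorField.restrict h)
    (fun a D ↦ VectorField.restrict_smul h a D) (fun a D ↦ D.res _ _ _ h a) (fun _ _ ↦ rfl)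

@[simp] lemma diffOpRes_ofFun {V W : X.Opens} (h : W ≤ V) (a : Γ(X, V)) :
    diffOpRes s h (Envelope.ofFun _ _ a) = Envelope.ofFun _ _ (X.presheaf.map (homOfLE h).op a) := by
  unfold diffOpRes Envelope.map
  rw [Envelope.lift_ofFun]
  rfl

@[simp] lemma diffOpRes_ofVec {V W : X.Opens} (h : W ≤ V) (D : VectorField s V) :
    diffOpRes s h (Envelope.ofVec _ _ D) = Envelope.ofVec _ _ (VectorField.restrict h D) := by
  unfold diffOpRes Envelope.map
  rw [Envelope.lift_ofVec]
  rfl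

/-- Below a chart, normal ordering identifies the presheaf of enveloping algebras with polynomials
over the structure sheaf, which reduces sheaf properties to coefficients. -/
lemma diffOpRes_op (c : Chart s p) {V W : X.Opens} (hV : V ≤ c.opens) (h : W ≤ V)
    (m : MvPolynomial c.ι Γ(X, V)) :
    diffOpRes s h ((c.coordinates V hV).op m) =
      (c.coordinates W (h.trans hV)).op
        (MvPolynomial.map (X.presheaf.map (homOfLE h).op).hom m) := by
  have hd : ∀ i, VectorField.restrict h (VectorField.restrict hV (c.d i)) =
    VectorField.restrict (h.trans hV) (c.d i) := fun _ ↦ rfl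
  induction m using MvPolynomial.induction_on with
  | C a =>
    rw [LieCoordinates.op_C, MvPolynomial.map_C, LieCoordinates.op_C, diffOpRes_ofFun]
  | add m n hm hn => rw [map_add, map_add, map_add, map_add, ← hm, ← hn]
  | mul_X m i hm =>
    rw [LieCoordinates.op_mul_X, map_mul, map_mul, MvPolynomial.map_X, LieCoordinates.op_mul_X, ← hm,
      ← hd, diffOpRes_ofVec]

lemma diffOpPresheaf_map_op (c : Chart s p) {V W : X.Opens} (hV : V ≤ c.opens) (h : W ≤ V)
    (m : MvPolynomial c.ι Γ(X, V)) :
    (diffOpPresheaf s).map (homOfLE h).op ((c.coordinates V hV).op m) =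
      (c.coordinates W (h.trans hV)).op
        (MvPolynomial.map (X.presheaf.map (homOfLE h).op).hom m) :=
  diffOpRes_op c hV h m

lemma diffOpPresheaf_isSeparatedAt (c : Chart s p) {V : X.Opens} (hV : V ≤ c.opens) :
    IsSeparatedAt (diffOpPresheaf s) V := by
  intro a b h
  obtain ⟨m, rfl⟩ : ∃ m, (c.coordinates V hV).op m = a := ⟨_, (c.coordinates V hV).op_app_one a⟩
  obtain ⟨n, rfl⟩ : ∃ n, (c.coordinates V hV).op n = b := ⟨_, (c.coordinates V hV).op_app_one b⟩
  congr 1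
  ext α
  choose W hW hx h using fun x : V ↦ h x.1 x.2
  refine X.sheaf.eq_of_locally_eq' W V (fun x ↦ homOfLE (hW x))
    (fun x hxV ↦ Opens.mem_iSup.2 ⟨⟨x, hxV⟩, hx _⟩) _ _ fun x ↦ ?_
  have := h x
  rw [diffOpPresheaf_map_op, diffOpPresheaf_map_op] at this
  have := congrArg (coeff α) ((c.coordinates _ ((hW x).trans hV)).op_injective this)
  rwa [coeff_map, coeff_map] at this

/-- Coefficients glue one by one. Compactness bounds the union of the supports, so that the result
is again a polynomial; without it the order of the glued operator could be infinite. -/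
lemma diffOpPresheaf_gluesAt (c : Chart s p) {V : X.Opens} (hV : V ≤ c.opens)
    (hc : IsCompact (V : Set X)) : GluesAt (diffOpPresheaf s) V := by
  classical
  intro W hW hx a ha
  choose m hm using fun y ↦ (show ∃ m, (c.coordinates (W y) ((hW y).trans hV)).op m = a y from
    ⟨_, (c.coordinates _ _).op_app_one (a y)⟩)
  have hcover : V ≤ iSup W := fun x hxV ↦ Opens.mem_iSup.2 ⟨⟨x, hxV⟩, hx _⟩
  have hcomp : ∀ y z α,
      X.presheaf.map (homOfLE (inf_le_left : W y ⊓ W z ≤ W y)).op ((m y).coeff α) =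
        X.presheaf.map (homOfLE (inf_le_right : W y ⊓ W z ≤ W z)).op ((m z).coeff α) := by
    intro y z α
    have := ha y z
    rw [← hm, ← hm, diffOpPresheaf_map_op, diffOpPresheaf_map_op] at this
    have := congrArg (coeff α) ((c.coordinates _ (inf_le_left.trans ((hW y).trans hV))).op_injective this)
    rwa [coeff_map, coeff_map] at this
  have hglue : ∀ α, ∃ f : Γ(X, V), ∀ y, X.presheaf.map (homOfLE (hW y)).op f = (m y).coeff α := fun α ↦ by
    obtain ⟨f, hf, -⟩ := X.sheaf.existsUnique_gluing' W V (fun x ↦ homOfLE (hW x)) hcover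
      (fun y ↦ (m y).coeff α) (fun y z ↦ hcomp y z α)
    exact ⟨f, hf⟩
  choose f hf using hglue
  obtain ⟨T, hT⟩ := hc.elim_finite_subcover (fun y ↦ (W y : Set X)) (fun y ↦ (W y).2)
    (fun x hx ↦ by simpa using hcover hx)
  have hsupp : ∀ α, f α ≠ 0 → α ∈ T.biUnion fun y ↦ (m y).support := by
    intro α hα
    by_contra h
    refine hα (X.sheaf.eq_of_locally_eq' (fun y : T ↦ W y) V (fun x ↦ homOfLE (hW x))
      (fun x hx ↦ ?_) _ _ fun y ↦ ?_)
    · obtain ⟨y, hy, hxy⟩ := Set.mem_iUnion₂.1 (hT hx)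
      exact Opens.mem_iSup.2 ⟨⟨y, hy⟩, hxy⟩
    · refine (hf α y).trans (Eq.trans ?_ (map_zero (X.presheaf.map (homOfLE (hW y)).op).hom).symm)
      by_contra h'
      exact h (Finset.mem_biUnion.2 ⟨y, y.2, mem_support_iff.2 h'⟩)
  refine ⟨(c.coordinates V hV).op (.ofCoeff (Finsupp.onFinset _ f hsupp)), fun y ↦ ?_⟩
  rw [diffOpPresheaf_map_op, ← hm]
  congr 1
  ext α
  rw [coeff_map]
  exact hf α y

lemma toDiffOp_bijective (c : Chart s p) {V : X.Opens} (hV : V ≤ c.opens) (hc : IsCompact (V : Set X)) :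
    Function.Bijective (ringSheafifyMap (diffOpPresheaf s) V) :=
  ringSheafifyMap_bijective (fun _ hW ↦ diffOpPresheaf_isSeparatedAt c (hW.trans hV))
    (diffOpPresheaf_gluesAt c hV hc)

end DiffOpSections


/-! ### Functions on the cotangent bundle and topology of its projection -/

section Cotangent

variable {k : Type u} [Field k] {X : Scheme.{u}} (s : X ⟶ Spec (.of k)) [Smooth s]

lemma cotangentChart_proj (U : X.AffineZariskiSite) : cotangentChart s U ≫ cotangentProj s =
    Spec.map (CommRingCat.ofHom (algebraMap Γ(X, U.toOpens)
      (SymmetricAlgebra Γ(X, U.toOpens) (VectorField s U.toOpens)))) ≫ U.2.fromSpec := by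
  refine ((Scheme.AffineZariskiSite.relativeGluingData
    (coequifibered_toSymTangent s)).ι_toBase U).trans ?_
  change (Spec.map _ ≫ U.2.isoSpec.inv) ≫ U.1.ι = _
  rw [Category.assoc, IsAffineOpen.isoSpec_inv_ι]
  rfl

lemma map_cotangentChart {U V : X.AffineZariskiSite} (h : V ≤ U) :
    Spec.map ((symTangent s).map (homOfLE h).op) ≫ cotangentChart s U = cotangentChart s V := by
  let D := Scheme.AffineZariskiSite.relativeGluingData (coequifibered_toSymTangent s)
  haveI : (D.functor ⋙ Scheme.forget).IsLocallyDirected :=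
    Scheme.Cover.RelativeGluingData.instIsLocallyDirectedI₀CompFunctorForgetOfIsThin ..
  exact Limits.colimit.w D.functor (homOfLE h)

lemma top_le_preimage_cotangentChart (U : X.AffineZariskiSite) :
    ⊤ ≤ cotangentChart s U ⁻¹ᵁ (cotangentProj s ⁻¹ᵁ U.toOpens) := by
  rw [opensRange_cotangentChart]
  exact fun x _ ↦ ⟨x, rfl⟩

lemma appLE_cotangentSections (U : X.AffineZariskiSite)
    (t : SymmetricAlgebra Γ(X, U.toOpens) (VectorField s U.toOpens)) :
    (cotangentChart s U).appLE _ ⊤ (top_le_preimage_cotangentChart s U) (cotangentSections s U t) =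
      (Scheme.ΓSpecIso _).inv t := by
  have h : (IsOpenImmersion.ΓIsoTop (cotangentChart s U)).hom ≫
      (cotangentBundle s).presheaf.map (eqToHom (opensRange_cotangentChart s U)).op ≫
      (cotangentChart s U).appLE _ ⊤ (top_le_preimage_cotangentChart s U) = 𝟙 _ := by
    rw [Scheme.Hom.map_appLE, IsOpenImmersion.ΓIsoTop]
    simp only [Iso.trans_hom, Iso.symm_hom, Category.assoc, Functor.mapIso_hom, Iso.op_hom, eqToIso.hom]
    rw [Scheme.Hom.map_appLE]
    rw [Scheme.Hom.appIso_inv_appLE]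
    simp
  have h' := ConcreteCategory.congr_hom h ((Scheme.ΓSpecIso (.of (SymmetricAlgebra Γ(X, U.toOpens)
    (VectorField s U.toOpens)))).inv t)
  exact h'

lemma appLE_cotangentChart_injective (U : X.AffineZariskiSite) :
    Function.Injective
      ((cotangentChart s U).appLE _ ⊤ (top_le_preimage_cotangentChart s U)) := by
  intro a b hab
  obtain ⟨t, rfl⟩ := (cotangentSections_bijective s U).2 a
  obtain ⟨t', rfl⟩ := (cotangentSections_bijective s U).2 b
  rw [appLE_cotangentSections, appLE_cotangentSections] at hab
  congr 1
  exact (ConcreteCategory.bijective_of_isIso (Scheme.ΓSpecIso _).inv).1 hab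

lemma cotangentSections_algebraMap (U : X.AffineZariskiSite) (a : Γ(X, U.toOpens)) :
    cotangentSections s U (algebraMap _ _ a) = (cotangentProj s).app U.toOpens a := by
  apply appLE_cotangentChart_injective
  rw [appLE_cotangentSections]
  have h1 : (cotangentProj s).app U.toOpens ≫
      (cotangentChart s U).appLE _ ⊤ (top_le_preimage_cotangentChart s U) =
      CommRingCat.ofHom (algebraMap Γ(X, U.toOpens)
        (SymmetricAlgebra Γ(X, U.toOpens) (VectorField s U.toOpens))) ≫ (Scheme.ΓSpecIso _).inv := by
    rw [← Scheme.Hom.appLE_eq_app, Scheme.Hom.appLE_comp_appLE]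
    simp only [cotangentChart_proj]
    rw [← Scheme.Hom.appLE_comp_appLE (Spec.map (CommRingCat.ofHom (algebraMap Γ(X, U.toOpens)
      (SymmetricAlgebra Γ(X, U.toOpens) (VectorField s U.toOpens))))) U.2.fromSpec U.toOpens ⊤ ⊤
      (by rw [IsAffineOpen.fromSpec_preimage_self]) (by simp), Scheme.ΓSpecIso_inv_naturality]
    congr 1
    · rw [Scheme.Hom.appLE, U.2.fromSpec_app_self, Category.assoc]
      refine (congrArg ((Scheme.ΓSpecIso Γ(X, U.toOpens)).inv ≫ ·)
        ((Spec Γ(X, U.toOpens)).presheaf.map_comp _ _).symm).trans ?_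
      exact (congrArg ((Scheme.ΓSpecIso Γ(X, U.toOpens)).inv ≫ ·)
        ((Spec Γ(X, U.toOpens)).presheaf.map_id _)).trans (Category.comp_id _)
  exact (ConcreteCategory.congr_hom h1 a).symm

lemma cotangentSections_res_of_site_le {U V : X.AffineZariskiSite} (h : V ≤ U)
    (t : SymmetricAlgebra Γ(X, U.toOpens) (VectorField s U.toOpens)) :
    (cotangentBundle s).presheaf.map (homOfLE ((cotangentProj s).preimage_mono
      (Scheme.AffineZariskiSite.toOpens_mono h))).op (cotangentSections s U t) =
      cotangentSections s V ((symTangent s).map (homOfLE h).op t) := by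
  apply appLE_cotangentChart_injective
  refine Eq.trans ?_ (appLE_cotangentSections s V _).symm
  let e : CommRingCat.of (SymmetricAlgebra Γ(X, U.toOpens) (VectorField s U.toOpens)) ⟶
    CommRingCat.of (SymmetricAlgebra Γ(X, V.toOpens) (VectorField s V.toOpens)) :=
    (symTangent s).map (homOfLE h).op
  have h0 : ∀ (φ : Spec (.of (SymmetricAlgebra Γ(X, V.toOpens) (VectorField s V.toOpens))) ⟶
      cotangentBundle s) (hφ : Spec.map e ≫ cotangentChart s U = φ) (W W' : (cotangentBundle s).Opens)
      (hW : W' ≤ W) (h1 : ⊤ ≤ φ ⁻¹ᵁ W') (h2 : ⊤ ≤ cotangentChart s U ⁻¹ᵁ W),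
      (cotangentBundle s).presheaf.map (homOfLE hW).op ≫ φ.appLE W' ⊤ h1 =
        (cotangentChart s U).appLE W ⊤ h2 ≫ (Spec.map e).appLE ⊤ ⊤ (show ⊤ ≤ Spec.map e ⁻¹ᵁ ⊤ from le_top) := by
    rintro _ rfl W W' hW h1 h2
    rw [Scheme.Hom.map_appLE, Scheme.Hom.appLE_comp_appLE]
  have h2 := ConcreteCategory.congr_hom (h0 _ (map_cotangentChart s h) _ _
    ((cotangentProj s).preimage_mono (Scheme.AffineZariskiSite.toOpens_mono h))
    (top_le_preimage_cotangentChart s V) (top_le_preimage_cotangentChart s U))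
    (cotangentSections s U t)
  refine h2.trans ?_
  refine (congrArg ((Spec.map e).appLE ⊤ ⊤ (show ⊤ ≤ Spec.map e ⁻¹ᵁ ⊤ from le_top)) (appLE_cotangentSections s U t)).trans ?_
  have h3 : (Scheme.ΓSpecIso _).inv ≫ (Spec.map e).appLE ⊤ ⊤ (show ⊤ ≤ Spec.map e ⁻¹ᵁ ⊤ from le_top) =
      e ≫ (Scheme.ΓSpecIso _).inv := by
    rw [Scheme.ΓSpecIso_inv_naturality, Scheme.Hom.appLE]
    simp
    exact Category.comp_id _
  exact ConcreteCategory.congr_hom h3 t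

/-- Restriction of polynomial functions on the cotangent bundle. -/
def symRes {U V : X.Opens} (h : V ≤ U) : SymmetricAlgebra Γ(X, U) (VectorField s U) →+*
    SymmetricAlgebra Γ(X, V) (VectorField s V) :=
  symMap (X.presheaf.map (homOfLE h).op).hom (VectorField.restrict h)
    (fun a D ↦ VectorField.restrict_smul _ a D)

lemma symRes_symRes {U V W : X.Opens} (h : V ≤ U) (h' : W ≤ V)
    (t : SymmetricAlgebra Γ(X, U) (VectorField s U)) :
    symRes s h' (symRes s h t) = symRes s (h'.trans h) t := by
  refine DFunLike.congr_fun (f := (symRes s h').comp (symRes s h)) (sym_hom_ext ?_ ?_) t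
  · intro a
    simp [symRes, res_res]
  · intro D
    simp [symRes]
    rfl

/-- The order of the affine Zariski site only sees basic open subsets, whereas here the inclusion is
arbitrary. Locally one passes to open subsets that are basic in both `U` and `V`. -/
lemma cotangentSections_res {U V : X.AffineZariskiSite} (h : V.toOpens ≤ U.toOpens)
    (t : SymmetricAlgebra Γ(X, U.toOpens) (VectorField s U.toOpens)) :
    (cotangentBundle s).presheaf.map (homOfLE ((cotangentProj s).preimage_mono h)).op
      (cotangentSections s U t) = cotangentSections s V (symRes s h t) := by
  refine (cotangentBundle s).IsSheaf.section_ext fun y hy ↦ ?_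
  obtain ⟨f, g, hfg, hx⟩ := exists_basicOpen_le_affine_inter V.2 U.2 (cotangentProj s y)
    ⟨hy, h hy⟩
  have hV : V.basicOpen f ≤ V := V.basicOpen_le f
  have hU : V.basicOpen f ≤ U := ⟨g, hfg.symm⟩
  refine ⟨cotangentProj s ⁻¹ᵁ X.basicOpen f, (cotangentProj s).preimage_mono (X.basicOpen_le f),
    hx, ?_⟩
  refine ((res_res _ _ _).trans (cotangentSections_res_of_site_le s hU t)).trans
    ((cotangentSections_res_of_site_le s hV _).trans (congrArg _ ?_)).symm
  exact symRes_symRes s _ _ t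

lemma cotangentChart_proj_apply (U : X.AffineZariskiSite)
    (z : PrimeSpectrum (SymmetricAlgebra Γ(X, U.toOpens) (VectorField s U.toOpens))) :
    cotangentProj s (cotangentChart s U z) = U.2.fromSpec (PrimeSpectrum.comap
      (algebraMap Γ(X, U.toOpens) (SymmetricAlgebra Γ(X, U.toOpens) (VectorField s U.toOpens))) z) := by
  have h := congrArg (fun f : Spec (.of (SymmetricAlgebra Γ(X, U.toOpens) (VectorField s U.toOpens))) ⟶ X
    ↦ f z) (cotangentChart_proj s U)
  exact h

lemma cotangentProj_surjective : Function.Surjective (cotangentProj s) := by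
  intro x
  obtain ⟨U, hU, hx, -⟩ := exists_isAffineOpen_mem_and_subset (X := X) (U := ⊤) (x := x) trivial
  let U' : X.AffineZariskiSite := ⟨U, hU⟩
  obtain ⟨q, hq⟩ := (hU.range_fromSpec ▸ hx : x ∈ Set.range hU.fromSpec)
  -- The zero section.
  let r : SymmetricAlgebra Γ(X, U) (VectorField s U) →+* Γ(X, U) :=
    (SymmetricAlgebra.lift (0 : VectorField s U →ₗ[Γ(X, U)] Γ(X, U))).toRingHom
  refine ⟨cotangentChart s U' (PrimeSpectrum.comap r q), (cotangentChart_proj_apply s U' _).trans ?_⟩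
  rw [← hq]
  congr 1
  change (PrimeSpectrum.comap _ ∘ PrimeSpectrum.comap r) q = q
  rw [← PrimeSpectrum.comap_comp]
  have : r.comp (algebraMap Γ(X, U) (SymmetricAlgebra Γ(X, U) (VectorField s U))) = RingHom.id _ := by
    ext a
    exact AlgHom.commutes _ a
  refine (congrArg (fun f ↦ PrimeSpectrum.comap f q) this).trans ?_
  exact congrFun PrimeSpectrum.comap_id q

-- Over a chart the cotangent bundle is an affine space.
variable {s} in
lemma Chart.isOpenMap_comap {p : ℕ} [Fact p.Prime] [CharP k p] (c : Chart s p) :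
    IsOpenMap (PrimeSpectrum.comap (algebraMap Γ(X, c.opens)
      (SymmetricAlgebra Γ(X, c.opens) (VectorField s c.opens)))) := by
  have h := c.coordinates c.opens le_rfl
  let e := RingEquiv.ofBijective (FrobeniusCoordinates.symPolynomial h.toLieCoordinates).toRingHom
    (FrobeniusCoordinates.symPolynomial_bijective h.toLieCoordinates)
  have he : algebraMap Γ(X, c.opens) (SymmetricAlgebra Γ(X, c.opens) (VectorField s c.opens)) =
      (e.symm : _ →+* _).comp (MvPolynomial.C (σ := c.ι)) := by
    ext a
    refine e.injective (Eq.trans ?_ (e.apply_symm_apply _).symm)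
    exact AlgHom.commutes (FrobeniusCoordinates.symPolynomial h.toLieCoordinates) a
  rw [he, PrimeSpectrum.comap_comp]
  exact (MvPolynomial.isOpenMap_comap_C (σ := c.ι)).comp
    (PrimeSpectrum.homeomorphOfRingEquiv e).isOpenMap

/-- Openness makes the image of an open subset open, so the inverse image of `𝒟_X` can be formed
from sections over the image, without a colimit over neighbourhoods. -/
lemma isOpenMap_cotangentProj (p : ℕ) [Fact p.Prime] [CharP k p] [PerfectRing k p] :
    IsOpenMap (cotangentProj s) := by
  intro W hW
  rw [isOpen_iff_forall_mem_open]
  rintro _ ⟨y, hy, rfl⟩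
  obtain ⟨c, hc, -⟩ := exists_chart (s := s) (p := p) ⊤ (cotangentProj s y) trivial
  let U : X.AffineZariskiSite := ⟨c.opens, c.isAffineOpen⟩
  obtain ⟨z, rfl⟩ : y ∈ (cotangentChart s U).opensRange := by
    rw [← opensRange_cotangentChart]
    exact hc
  refine ⟨cotangentProj s '' (cotangentChart s U '' (cotangentChart s U ⁻¹' W)),
    Set.image_mono (Set.image_preimage_subset _ _), ?_, ⟨_, ⟨z, hy, rfl⟩, rfl⟩⟩
  rw [Set.image_image]
  have h := (c.isAffineOpen.fromSpec.isOpenEmbedding.isOpenMap.comp c.isOpenMap_comap) _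
    (hW.preimage (cotangentChart s U).continuous)
  refine cast (congrArg IsOpen (Set.image_congr fun z _ ↦ ?_)) h
  exact (cotangentChart_proj_apply s U z).symm

end Cotangent


/-- The target need not be commutative, as required for homomorphisms to enveloping algebras. -/
lemma sym_ringHom_ext {A L R : Type u} [CommRing A] [AddCommGroup L] [Module A L] [Ring R]
    {f g : SymmetricAlgebra A L →+* R} (h₁ : ∀ a, f (algebraMap A _ a) = g (algebraMap A _ a))
    (h₂ : ∀ x, f (SymmetricAlgebra.ι A L x) = g (SymmetricAlgebra.ι A L x)) : f = g := by
  refine RingHom.ext fun t ↦ ?_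
  induction t using SymmetricAlgebra.induction with
  | algebraMap a => exact h₁ a
  | ι x => exact h₂ x
  | mul a b ha hb => rw [map_mul, map_mul, ha, hb]
  | add a b ha hb => rw [map_add, map_add, ha, hb]

lemma WeylRel.map {p : ℕ} {E E' : Type*} [Ring E] [Ring E'] {ι : Type} {x d : ι → E}
    (h : WeylRel p x d) (f : E →+* E') (hx : ∀ i e, Commute (f (x i) ^ p) e)
    (hd : ∀ i e, Commute (f (d i) ^ p) e) : WeylRel p (fun i ↦ f (x i)) (fun i ↦ f (d i)) where
  x_comm i j := (h.x_comm i j).map f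
  d_comm i j := (h.d_comm i j).map f
  rel i j hij := (h.rel i j hij).map f
  rel_self i := by rw [← map_mul, h.rel_self, map_add, map_mul, map_one]
  char := by rw [← map_natCast f, h.char, map_zero]
  x_pow := hx
  d_pow := hd

lemma WeylOver.map_bijective {p : ℕ} {S E E' : Type*} [CommRing S] [Ring E] [Ring E']
    {ψ : S →+* E} {ι : Type} {x d : ι → E} (h : WeylOver p ψ x d) {f : E →+* E'}
    (hf : Function.Bijective f) :
    WeylOver p (f.comp ψ) (fun i ↦ f (x i)) (fun i ↦ f (d i)) where
  toWeylRel := h.toWeylRel.map f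
    (fun i e ↦ by
      obtain ⟨e, rfl⟩ := hf.2 e
      rw [← map_pow]
      exact (h.x_pow i e).map f)
    (fun i e ↦ by
      obtain ⟨e, rfl⟩ := hf.2 e
      rw [← map_pow]
      exact (h.d_pow i e).map f)
  central a e := by
    obtain ⟨e, rfl⟩ := hf.2 e
    exact (h.central a e).map f
  inj := hf.1.comp h.inj
  centralizer e hx hd := by
    obtain ⟨e, rfl⟩ := hf.2 e
    obtain ⟨a, rfl⟩ := h.centralizer e
      (fun i ↦ hf.1 (by rw [map_mul, map_mul]; exact hx i))
      (fun i ↦ hf.1 (by rw [map_mul, map_mul]; exact hd i))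
    exact ⟨a, rfl⟩

/-! ### The Frobenius homomorphism over coordinate neighbourhoods -/

section Frobenius

variable {k : Type u} [Field k] {X : Scheme.{u}} (s : X ⟶ Spec (.of k)) [Smooth s]
  (p : ℕ) [Fact p.Prime] [CharP k p]

/-- The affine open subsets on which there are coordinates. -/
abbrev ChartOpen : Type u := {U : X.Opens // IsAffineOpen U ∧ ∃ c : Chart s p, U ≤ c.opens}

lemma isBasis_chartOpen [PerfectRing k p] :
    Opens.IsBasis (Set.range fun U : ChartOpen s p ↦ U.1) := by
  rw [Opens.isBasis_iff_nbhd]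
  intro U x hx
  obtain ⟨c, hc, hU⟩ := exists_chart (s := s) (p := p) U x hx
  exact ⟨c.opens, ⟨⟨c.opens, c.isAffineOpen, c, le_rfl⟩, rfl⟩, hc, hU⟩

variable {s p}

lemma funOp_res {U V : X.Opens} (h : V ≤ U) (a : Γ(X, U)) :
    (diffOp s).presheaf.map (homOfLE h).op (funOp s U a) =
      funOp s V (X.presheaf.map (homOfLE h).op a) :=
  (ringSheafifyMap_res (P := diffOpPresheaf s) h _).trans
    (congrArg (ringSheafifyMap (diffOpPresheaf s) V) (diffOpRes_ofFun h a))

lemma vecOp_res {U V : X.Opens} (h : V ≤ U) (D : VectorField s U) :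
    (diffOp s).presheaf.map (homOfLE h).op (vecOp s U D) = vecOp s V (VectorField.restrict h D) :=
  (ringSheafifyMap_res (P := diffOpPresheaf s) h _).trans
    (congrArg (ringSheafifyMap (diffOpPresheaf s) V) (diffOpRes_ofVec h D))

namespace ChartOpen

/-- The corresponding object of the small affine Zariski site. -/
abbrev site (U : ChartOpen s p) : X.AffineZariskiSite := ⟨U.1, U.2.1⟩

/-- The homomorphism from the polynomial functions on the cotangent bundle to the center of the
enveloping algebra. -/
def frob (U : ChartOpen s p) :
    SymmetricAlgebra Γ(X, U.1) (VectorField s U.1) →+* Envelope Γ(X, U.1) (VectorField s U.1) :=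
  (U.2.2.choose.coordinates U.1 U.2.2.choose_spec).symFrob

lemma frob_algebraMap (U : ChartOpen s p) (a : Γ(X, U.1)) :
    U.frob (algebraMap _ _ a) = Envelope.ofFun _ _ (a ^ p) :=
  (U.2.2.choose.coordinates U.1 U.2.2.choose_spec).symFrob_algebraMap a

lemma frob_ι (U : ChartOpen s p) (D : VectorField s U.1) :
    U.frob (SymmetricAlgebra.ι _ _ D) = Envelope.ofVec _ _ D ^ p - Envelope.ofVec _ _ (D.pPow p) :=
  (U.2.2.choose.coordinates U.1 U.2.2.choose_spec).symFrob_ι D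

/-- Independence of the chosen chart: the values on functions and vector fields do not mention
coordinates. -/
lemma frob_eq (U : ChartOpen s p) (c : Chart s p) (h : U.1 ≤ c.opens) :
    U.frob = (c.coordinates U.1 h).symFrob :=
  sym_ringHom_ext
    (fun a ↦ (U.frob_algebraMap a).trans ((c.coordinates U.1 h).symFrob_algebraMap a).symm)
    (fun D ↦ (U.frob_ι D).trans ((c.coordinates U.1 h).symFrob_ι D).symm)

lemma diffOpRes_frob {U V : ChartOpen s p} (h : V.1 ≤ U.1)
    (t : SymmetricAlgebra Γ(X, U.1) (VectorField s U.1)) :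
    diffOpRes s h (U.frob t) = V.frob (symRes s h t) := by
  refine DFunLike.congr_fun (f := (diffOpRes s h).comp U.frob) (g := V.frob.comp (symRes s h))
    (sym_ringHom_ext (fun a ↦ ?_) fun D ↦ ?_) t
  · refine (congrArg (diffOpRes s h) (U.frob_algebraMap a)).trans ((diffOpRes_ofFun h _).trans ?_)
    refine Eq.trans ?_ (congrArg V.frob (symMap_algebraMap _ _ _ a)).symm
    refine Eq.trans ?_ (V.frob_algebraMap _).symm
    exact congrArg (Envelope.ofFun _ _) (map_pow (X.presheaf.map (homOfLE h).op).hom a p)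
  · refine (congrArg (diffOpRes s h) (U.frob_ι D)).trans ?_
    rw [map_sub, map_pow, diffOpRes_ofVec, diffOpRes_ofVec]
    refine Eq.trans ?_ (congrArg V.frob (symMap_ι _ _ _ D)).symm
    exact (V.frob_ι _).symm

/-- The functions on the part of the cotangent bundle over an affine open subset with
coordinates. -/
def sectionsEquiv (U : ChartOpen s p) : SymmetricAlgebra Γ(X, U.1) (VectorField s U.1) ≃+*
    Γ(cotangentBundle s, cotangentProj s ⁻¹ᵁ U.1) :=
  RingEquiv.ofBijective _ (cotangentSections_bijective s U.site)

lemma sectionsEquiv_res {U V : ChartOpen s p} (h : V.1 ≤ U.1)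
    (t : SymmetricAlgebra Γ(X, U.1) (VectorField s U.1)) :
    (cotangentBundle s).presheaf.map (homOfLE ((cotangentProj s).preimage_mono h)).op
      (U.sectionsEquiv t) = V.sectionsEquiv (symRes s h t) :=
  cotangentSections_res (U := U.site) (V := V.site) s h t

/-- The Frobenius homomorphism from the functions on the cotangent bundle to the center of the
differential operators. -/
def theta (U : ChartOpen s p) : Γ(cotangentBundle s, cotangentProj s ⁻¹ᵁ U.1) →+*
    (diffOp s).presheaf.obj (op U.1) :=
  ((ringSheafifyMap (diffOpPresheaf s) U.1).comp U.frob).comp (U.sectionsEquiv.symm : _ →+* _)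

lemma theta_apply (U : ChartOpen s p) (t : SymmetricAlgebra Γ(X, U.1) (VectorField s U.1)) :
    U.theta (U.sectionsEquiv t) = ringSheafifyMap (diffOpPresheaf s) U.1 (U.frob t) :=
  congrArg (fun t ↦ ringSheafifyMap (diffOpPresheaf s) U.1 (U.frob t)) (U.sectionsEquiv.symm_apply_apply t)

lemma theta_res {U V : ChartOpen s p} (h : V.1 ≤ U.1)
    (f : Γ(cotangentBundle s, cotangentProj s ⁻¹ᵁ U.1)) :
    (diffOp s).presheaf.map (homOfLE h).op (U.theta f) = V.theta
      ((cotangentBundle s).presheaf.map (homOfLE ((cotangentProj s).preimage_mono h)).op f) := by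
  obtain ⟨t, rfl⟩ := U.sectionsEquiv.surjective f
  refine (congrArg _ (U.theta_apply t)).trans
    ((ringSheafifyMap_res (P := diffOpPresheaf s) h (U.frob t)).trans ?_)
  refine Eq.trans ?_ (congrArg V.theta (sectionsEquiv_res h t)).symm
  refine Eq.trans ?_ (V.theta_apply _).symm
  exact congrArg (ringSheafifyMap (diffOpPresheaf s) V.1) (diffOpRes_frob h t)

lemma weylOver_theta (U : ChartOpen s p) (c : Chart s p) (h : U.1 ≤ c.opens) :
    WeylOver p U.theta (fun i ↦ funOp s U.1 (X.presheaf.map (homOfLE h).op (c.x i)))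
      (fun i ↦ vecOp s U.1 (VectorField.restrict h (c.d i))) := by
  have h1 : WeylOver p U.frob _ _ := U.frob_eq c h ▸ (c.coordinates U.1 h).weylOver_symFrob
  have hb := toDiffOp_bijective c h U.2.1.isCompact
  exact (h1.map_bijective hb).comp_bijective U.sectionsEquiv.symm.bijective

end ChartOpen

end Frobenius


/-! ### The global Frobenius homomorphism and the center -/

section Frobenius

variable {k : Type u} [Field k] {X : Scheme.{u}} (s : X ⟶ Spec (.of k)) [Smooth s]
  (p : ℕ) [Fact p.Prime] [CharP k p] [PerfectRing k p]

/-- The Frobenius homomorphism from the functions on the twisted cotangent bundle to the sheaf of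
differential operators. -/
def frobeniusHom : (TopCat.Sheaf.pushforward RingCat.{u} (cotangentTwistProj p s).base).obj
      (cotangentTwist p s).left.ringCatSheaf ⟶ diffOp s :=
  ⟨TopCat.Sheaf.restrictHomEquivHom _ _ (isBasis_chartOpen s p)
    { app := fun U ↦ RingCat.ofHom (U.unop : ChartOpen s p).theta
      naturality := fun U V i ↦ by
        ext f
        exact (ChartOpen.theta_res (leOfHom i.unop.hom) f).symm }⟩

variable {s p}

lemma onSections_frobeniusHom (U : ChartOpen s p) :
    onSections (frobeniusHom s p) U.1 = U.theta :=
  congrArg (fun f : RingCat.of _ ⟶ _ ↦ f.hom)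
    (TopCat.Sheaf.extend_hom_app _ _ (isBasis_chartOpen s p) _ U)

variable {θ : (TopCat.Sheaf.pushforward RingCat.{u} (cotangentTwistProj p s).base).obj
      (cotangentTwist p s).left.ringCatSheaf ⟶ diffOp s}

lemma onSections_res {U V : X.Opens} (h : V ≤ U)
    (f : Γ((cotangentTwist p s).left, cotangentTwistProj p s ⁻¹ᵁ U)) :
    (diffOp s).presheaf.map (homOfLE h).op (onSections θ U f) = onSections θ V
      ((cotangentTwist p s).left.presheaf.map
        (homOfLE ((cotangentTwistProj p s).preimage_mono h)).op f) :=
  (ConcreteCategory.congr_hom (θ.hom.naturality (homOfLE h).op) f).symm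

lemma exists_chartOpen (c : Chart s p) {V : X.Opens} (hV : V ≤ c.opens) {x : X} (hx : x ∈ V) :
    ∃ U : ChartOpen s p, x ∈ U.1 ∧ U.1 ≤ V := by
  obtain ⟨U, hU, hxU, hUV⟩ := exists_isAffineOpen_mem_and_subset (X := X) (U := V) hx
  exact ⟨⟨U, hU, c, hUV.trans hV⟩, hxU, hUV⟩

lemma exists_chartOpen' {V : X.Opens} {x : X} (hx : x ∈ V) :
    ∃ U : ChartOpen s p, x ∈ U.1 ∧ U.1 ≤ V := by
  obtain ⟨c, hc, hU⟩ := exists_chart (s := s) (p := p) V x hx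
  exact ⟨⟨c.opens, c.isAffineOpen, c, le_rfl⟩, hc, hU⟩

lemma onSections_injective (h : ∀ U : ChartOpen s p, Function.Injective (onSections θ U.1))
    (V : X.Opens) : Function.Injective (onSections θ V) := by
  intro a b hab
  refine (cotangentTwist p s).left.IsSheaf.section_ext fun y hy ↦ ?_
  obtain ⟨U, hxU, hUV⟩ := exists_chartOpen' (s := s) (p := p) (V := V) (x := cotangentTwistProj p s y) hy
  refine ⟨cotangentTwistProj p s ⁻¹ᵁ U.1, (cotangentTwistProj p s).preimage_mono hUV, hxU, h U ?_⟩
  rw [← onSections_res hUV, ← onSections_res hUV, hab]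

/-- Injectivity makes local preimages unique, so they agree on overlaps and glue. -/
lemma mem_range_onSections (h : ∀ U : ChartOpen s p, Function.Injective (onSections θ U.1))
    {V : X.Opens} {e : (diffOp s).presheaf.obj (op V)}
    (he : ∀ (U : ChartOpen s p) (hU : U.1 ≤ V),
      (diffOp s).presheaf.map (homOfLE hU).op e ∈ Set.range (onSections θ U.1)) :
    e ∈ Set.range (onSections θ V) := by
  have hinj := onSections_injective h
  let I := {U : ChartOpen s p // U.1 ≤ V}
  choose f hf using fun U : I ↦ he U.1 U.2
  obtain ⟨g, hg, -⟩ := (cotangentTwist p s).left.sheaf.existsUnique_gluing'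
    (fun U : I ↦ cotangentTwistProj p s ⁻¹ᵁ U.1.1) (cotangentTwistProj p s ⁻¹ᵁ V)
    (fun U ↦ homOfLE ((cotangentTwistProj p s).preimage_mono U.2))
    (fun y hy ↦ by
      obtain ⟨U, hxU, hUV⟩ := exists_chartOpen' (s := s) (p := p) (V := V) (x := cotangentTwistProj p s y) hy
      exact Opens.mem_iSup.2 ⟨⟨U, hUV⟩, hxU⟩) f (by
      intro U W
      refine hinj (U.1.1 ⊓ W.1.1) ?_
      refine ((onSections_res (θ := θ) (inf_le_left : U.1.1 ⊓ W.1.1 ≤ U.1.1) (f U)).symm.trans ?_).trans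
        (onSections_res (θ := θ) (inf_le_right : U.1.1 ⊓ W.1.1 ≤ W.1.1) (f W))
      rw [hf, hf, presheaf_res_res, presheaf_res_res])
  refine ⟨g, sheaf_eq_of_locally_eq (diffOp s) fun x hx ↦ ?_⟩
  obtain ⟨U, hxU, hUV⟩ := exists_chartOpen' (s := s) (p := p) (V := V) (x := x) hx
  refine ⟨U.1, hUV, hxU, ?_⟩
  exact (onSections_res (θ := θ) hUV g).trans
    ((congrArg (onSections θ U.1) (hg ⟨U, hUV⟩)).trans (hf ⟨U, hUV⟩))

lemma weylOver_onSections_chartOpen (U : ChartOpen s p) (c : Chart s p) (h : U.1 ≤ c.opens) :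
    WeylOver p (onSections (frobeniusHom s p) U.1)
      (fun i ↦ funOp s U.1 (X.presheaf.map (homOfLE h).op (c.x i)))
      (fun i ↦ vecOp s U.1 (VectorField.restrict h (c.d i))) :=
  onSections_frobeniusHom U ▸ U.weylOver_theta c h

lemma onSections_frobeniusHom_injective (V : X.Opens) :
    Function.Injective (onSections (frobeniusHom s p) V) :=
  onSections_injective (fun U ↦ by
    obtain ⟨c, h⟩ := U.2.2
    exact (weylOver_onSections_chartOpen U c h).inj) V

lemma commute_onSections_frobeniusHom (V : X.Opens)
    (f : Γ((cotangentTwist p s).left, cotangentTwistProj p s ⁻¹ᵁ V)) (e : (diffOp s).presheaf.obj (op V)) :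
    Commute (onSections (frobeniusHom s p) V f) e := by
  refine sheaf_eq_of_locally_eq (diffOp s) fun x hx ↦ ?_
  obtain ⟨U, hxU, hUV⟩ := exists_chartOpen' (s := s) (p := p) (V := V) (x := x) hx
  refine ⟨U.1, hUV, hxU, ?_⟩
  rw [map_mul, map_mul, onSections_res]
  obtain ⟨c, h⟩ := U.2.2
  exact (weylOver_onSections_chartOpen U c h).central _ _

lemma funOp_chart_res (c : Chart s p) {V W : X.Opens} (hV : V ≤ c.opens) (h : W ≤ V) (i : c.ι) :
    (diffOp s).presheaf.map (homOfLE h).op (funOp s V (X.presheaf.map (homOfLE hV).op (c.x i))) =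
      funOp s W (X.presheaf.map (homOfLE (h.trans hV)).op (c.x i)) :=
  (funOp_res h _).trans (congrArg _ (res_res _ _ _))

lemma vecOp_chart_res (c : Chart s p) {V W : X.Opens} (hV : V ≤ c.opens) (h : W ≤ V) (i : c.ι) :
    (diffOp s).presheaf.map (homOfLE h).op (vecOp s V (VectorField.restrict hV (c.d i))) =
      vecOp s W (VectorField.restrict (h.trans hV) (c.d i)) :=
  vecOp_res h _

lemma commute_of_locally (c : Chart s p) {V : X.Opens} (hV : V ≤ c.opens)
    {a e : (diffOp s).presheaf.obj (op V)} (h : ∀ (U : ChartOpen s p) (hU : U.1 ≤ V),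
      Commute ((diffOp s).presheaf.map (homOfLE hU).op a) ((diffOp s).presheaf.map (homOfLE hU).op e)) :
    Commute a e := by
  refine sheaf_eq_of_locally_eq (diffOp s) fun x hx ↦ ?_
  obtain ⟨U, hxU, hUV⟩ := exists_chartOpen c hV hx
  refine ⟨U.1, hUV, hxU, ?_⟩
  rw [map_mul, map_mul]
  exact h U hUV

/-- Extends the Weyl description from affine to arbitrary open subsets of a chart, by checking
commutation and membership in the image locally. The generality is needed because images of open
subsets of the cotangent bundle need not be affine. -/
lemma weylOver_onSections (c : Chart s p) {V : X.Opens} (hV : V ≤ c.opens) :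
    WeylOver p (onSections (frobeniusHom s p) V)
      (fun i ↦ funOp s V (X.presheaf.map (homOfLE hV).op (c.x i)))
      (fun i ↦ vecOp s V (VectorField.restrict hV (c.d i))) := by
  have hrel : WeylRel p
      (fun i ↦ funOp s V (X.presheaf.map (homOfLE hV).op (c.x i)))
      (fun i ↦ vecOp s V (VectorField.restrict hV (c.d i))) := by
    have hx : ∀ (i : c.ι) (e : (diffOp s).presheaf.obj (op V)),
        Commute (funOp s V (X.presheaf.map (homOfLE hV).op (c.x i)) ^ p) e := fun i e ↦
      commute_of_locally c hV fun U hU ↦ by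
        have h := weylOver_onSections_chartOpen U c (hU.trans hV)
        rw [map_pow, funOp_chart_res c hV hU]
        exact h.x_pow i _
    have hd : ∀ (i : c.ι) (e : (diffOp s).presheaf.obj (op V)),
        Commute (vecOp s V (VectorField.restrict hV (c.d i)) ^ p) e := fun i e ↦
      commute_of_locally c hV fun U hU ↦ by
        have h := weylOver_onSections_chartOpen U c (hU.trans hV)
        rw [map_pow, vecOp_chart_res c hV hU]
        exact h.d_pow i _
    exact (c.coordinates V hV).weylOver_symFrob.toWeylRel.map (ringSheafifyMap (diffOpPresheaf s) V) hx hd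
  refine ⟨hrel, commute_onSections_frobeniusHom V, onSections_frobeniusHom_injective V,
    fun e hx hd ↦ ?_⟩
  refine mem_range_onSections (fun U ↦ onSections_frobeniusHom_injective U.1) fun U hU ↦ ?_
  refine (weylOver_onSections_chartOpen U c (hU.trans hV)).centralizer _ (fun i ↦ ?_) fun i ↦ ?_
  · rw [← funOp_chart_res c hV hU]
    exact (hx i).map ((diffOp s).presheaf.map (homOfLE hU).op).hom
  · rw [← vecOp_chart_res c hV hU]
    exact (hd i).map ((diffOp s).presheaf.map (homOfLE hU).op).hom

/-- A central section commutes with the coordinates and the dual fields of every chart, and their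
centralizer is already the image. -/
lemma isIsoToCenter_frobeniusHom : IsIsoToCenter (frobeniusHom s p) := by
  refine fun U ↦ ⟨onSections_frobeniusHom_injective U, fun e ↦ ⟨?_, fun he ↦ ?_⟩⟩
  · rintro ⟨f, rfl⟩ V h d'
    rw [onSections_res]
    exact commute_onSections_frobeniusHom V _ _
  · refine mem_range_onSections (fun U ↦ onSections_frobeniusHom_injective U.1) fun V hV ↦ ?_
    obtain ⟨c, h⟩ := V.2.2
    exact (weylOver_onSections_chartOpen V c h).centralizer _ (fun i ↦ (he V.1 hV _).symm)
      fun i ↦ (he V.1 hV _).symm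

lemma frobeniusHom_map_fun (U : X.Opens) (f : Γ(X, U)) :
    onSections (frobeniusHom s p) U ((cotangentTwistProj p s).app U f) = funOp s U (f ^ p) := by
  refine sheaf_eq_of_locally_eq (diffOp s) fun x hx ↦ ?_
  obtain ⟨V, hxV, hVU⟩ := exists_chartOpen' (s := s) (p := p) (V := U) (x := x) hx
  refine ⟨V.1, hVU, hxV, ?_⟩
  rw [onSections_res, funOp_res, onSections_frobeniusHom]
  have h1 : (cotangentTwist p s).left.presheaf.map
        (homOfLE ((cotangentTwistProj p s).preimage_mono hVU)).op ((cotangentTwistProj p s).app U f) =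
      V.sectionsEquiv (algebraMap _ _ (X.presheaf.map (homOfLE hVU).op f)) :=
    (ConcreteCategory.congr_hom ((cotangentTwistProj p s).naturality (homOfLE hVU).op) f).symm.trans
      (cotangentSections_algebraMap s V.site _).symm
  refine (congrArg V.theta h1).trans ((V.theta_apply _).trans ?_)
  exact (congrArg (ringSheafifyMap (diffOpPresheaf s) V.1) (V.frob_algebraMap _)).trans
    (congrArg (fun a ↦ ringSheafifyMap (diffOpPresheaf s) V.1 (Envelope.ofFun _ _ a))
      (map_pow (X.presheaf.map (homOfLE hVU).op).hom f p).symm)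

lemma frobeniusHom_map_vec (U : X.AffineZariskiSite) (D : VectorField s U.toOpens) :
    onSections (frobeniusHom s p) U.toOpens (linearFunction s U D) =
      vecOp s U.toOpens D ^ p - vecOp s U.toOpens (D.pPow p) := by
  refine sheaf_eq_of_locally_eq (diffOp s) fun x hx ↦ ?_
  obtain ⟨V, hxV, hVU⟩ := exists_chartOpen' (s := s) (p := p) (V := U.toOpens) (x := x) hx
  refine ⟨V.1, hVU, hxV, ?_⟩
  refine (onSections_res hVU _).trans ?_
  rw [onSections_frobeniusHom, map_sub, map_pow, vecOp_res, vecOp_res]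
  have h1 : (cotangentTwist p s).left.presheaf.map
        (homOfLE ((cotangentTwistProj p s).preimage_mono hVU)).op (linearFunction s U D) =
      V.sectionsEquiv (SymmetricAlgebra.ι _ _ (VectorField.restrict hVU D)) :=
    (cotangentSections_res (V := V.site) s hVU _).trans
      (congrArg V.sectionsEquiv (symMap_ι _ _ _ D))
  refine (congrArg V.theta h1).trans ((V.theta_apply _).trans ?_)
  refine (congrArg (ringSheafifyMap (diffOpPresheaf s) V.1) (V.frob_ι _)).trans ?_
  exact (map_sub (ringSheafifyMap (diffOpPresheaf s) V.1) _ _).trans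
    (congrArg (· - vecOp s V.1 (VectorField.restrict hVU (D.pPow p)))
      (map_pow (ringSheafifyMap (diffOpPresheaf s) V.1) _ _))

/-- The twist makes the constant `c` on the cotangent bundle the pullback of `c^{1/p}` on `X`; the
`p`-th power taken by `frobeniusHom` then restores `c`, which is its `k`-linearity. -/
lemma constFun_cotangentTwist (U : X.Opens) (c : k) :
    constFun (cotangentTwist p s).hom (cotangentTwistProj p s ⁻¹ᵁ U) c =
      (cotangentTwistProj p s).app U (constFun s U ((frobeniusEquiv k p).symm c)) := by
  let φ := CommRingCat.ofHom (frobeniusEquiv k p).symm.toRingHom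
  have h : ∀ (Y : Scheme.{u}) (q : Y ⟶ X) (g : Y ⟶ Spec (.of k)) (hg : (q ≫ s) ≫ Spec.map φ = g),
      constFun g (q ⁻¹ᵁ U) c = q.app U (constFun s U ((frobeniusEquiv k p).symm c)) := by
    rintro Y q _ rfl
    have h1 : (Scheme.ΓSpecIso (.of k)).inv ≫ ((q ≫ s) ≫ Spec.map φ).appLE ⊤ (q ⁻¹ᵁ U)
        (show _ ≤ ((q ≫ s) ≫ Spec.map φ) ⁻¹ᵁ ⊤ from le_top) =
        φ ≫ (Scheme.ΓSpecIso (.of k)).inv ≫ s.appLE ⊤ U (show U ≤ s ⁻¹ᵁ ⊤ from le_top) ≫ q.app U := by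
      rw [← Scheme.Hom.appLE_comp_appLE (q ≫ s) (Spec.map φ) ⊤ ⊤ _ le_top le_top,
        ← Scheme.Hom.appLE_comp_appLE q s ⊤ U _ le_top le_rfl, Scheme.Hom.appLE_eq_app,
        Scheme.ΓSpecIso_inv_naturality_assoc]
      congr 1
    exact ConcreteCategory.congr_hom h1 c
  exact h _ _ _ rfl

lemma isFrobeniusHom_frobeniusHom : IsFrobeniusHom (frobeniusHom s p) where
  map_const U c := by
    rw [constFun_cotangentTwist, frobeniusHom_map_fun, ← map_pow]
    congr 2
    exact (frobeniusEquiv k p).apply_symm_apply c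
  map_fun := frobeniusHom_map_fun
  map_vec := frobeniusHom_map_vec

end Frobenius


/-! ### Presheaves of algebras with Weyl relations -/

section WeylPresheaf

variable {p : ℕ} [Fact p.Prime] {Y : Scheme.{u}} {P : TopCat.Presheaf RingCat.{u} Y}
  {ψ : ∀ W : Y.Opens, Γ(Y, W) →+* P.obj (op W)}
  (hψ : ∀ (V W : Y.Opens) (h : W ≤ V) (f : Γ(Y, V)),
    P.map (homOfLE h).op (ψ V f) = ψ W (Y.presheaf.map (homOfLE h).op f))
  {V : Y.Opens} {ι : Type} [Finite ι] {x d : ι → P.obj (op V)}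
  (hV : ∀ (W : Y.Opens) (h : W ≤ V), WeylOver p (ψ W) (fun i ↦ P.map (homOfLE h).op (x i))
    (fun i ↦ P.map (homOfLE h).op (d i)))

include hψ hV

/-- Sections of a presheaf of algebras with Weyl relations have coordinates, which are compatible
with restriction. -/
lemma exists_presheaf_coordinates : ∃ (Γ : Type) (_ : Fintype Γ)
    (b : ∀ (W : Y.Opens), W ≤ V → Γ → P.obj (op W))
    (c : ∀ (W : Y.Opens), W ≤ V → Γ → P.obj (op W) → Γ(Y, W)),
    (∀ W hW a, a = ∑ γ, ψ W (c W hW γ a) * b W hW γ) ∧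
    (∀ W hW W' (h : W' ≤ W) γ, P.map (homOfLE h).op (b W hW γ) = b W' (h.trans hW) γ) ∧
    ∀ W hW W' (h : W' ≤ W) γ a, Y.presheaf.map (homOfLE h).op (c W hW γ a) =
      c W' (h.trans hW) γ (P.map (homOfLE h).op a) := by
  obtain ⟨Γ, hΓ, a, c, Φ, -, hΦ⟩ := exists_weyl_coordinates.{u} p ι
  have h1 : ∀ (W : Y.Opens) (hW : W ≤ V), _ := fun W hW ↦ hΦ _ _ _ _ _ (hV W hW)
  choose f hf using fun (W : Y.Opens) (hW : W ≤ V) ↦ (h1 W hW).1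
  -- One noncommutative polynomial gives the operator on all open subsets, hence it commutes with
  -- restriction.
  have hres : ∀ (W : Y.Opens) (hW : W ≤ V) (W' : Y.Opens) (h : W' ≤ W) (w) (e : P.obj (op W)),
      P.map (homOfLE h).op (weylAct (fun i ↦ P.map (homOfLE hW).op (x i))
        (fun i ↦ P.map (homOfLE hW).op (d i)) w e) =
      weylAct (fun i ↦ P.map (homOfLE (h.trans hW)).op (x i))
        (fun i ↦ P.map (homOfLE (h.trans hW)).op (d i)) w (P.map (homOfLE h).op e) := by
    intro W hW W' h w e
    refine (weylAct_map (P.map (homOfLE h).op).hom _ _ w e).trans ?_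
    congr 2
    congr 1
    · ext i
      exact presheaf_res_res hW h (x i)
    · ext i
      exact presheaf_res_res hW h (d i)
  refine ⟨Γ, hΓ, fun W hW γ ↦ weylAct (fun i ↦ P.map (homOfLE hW).op (x i))
    (fun i ↦ P.map (homOfLE hW).op (d i)) (a γ) 1, fun W hW γ e ↦ f W hW e γ, ?_, ?_, ?_⟩
  · intro W hW e
    refine ((h1 W hW).2.1 e).trans (Finset.sum_congr rfl fun γ _ ↦ ?_)
    rw [hf]
  · intro W hW W' h γ
    rw [hres, map_one]
  · intro W hW W' h γ e
    refine (hV W' (h.trans hW)).inj ?_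
    rw [← hψ, hf, hf, hres]

/-- Taylor coordinates make `P` below `V` a retract of a finite power of the structure sheaf,
naturally in the open subset. Separatedness, gluing and the localization properties that follow are
inherited from functions. -/
lemma isSeparatedAt_of_weylOver : IsSeparatedAt P V := by
  obtain ⟨Γ, _, b, c, h1, h2, h3⟩ := exists_presheaf_coordinates hψ hV
  intro e e' h
  rw [h1 V le_rfl e, h1 V le_rfl e']
  refine Finset.sum_congr rfl fun γ _ ↦ ?_
  congr 2
  refine Y.IsSheaf.section_ext fun y hy ↦ ?_
  obtain ⟨W, hW, hyW, he⟩ := h y hy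
  refine ⟨W, hW, hyW, ?_⟩
  rw [h3, h3, he]

lemma gluesAt_of_weylOver : GluesAt P V := by
  obtain ⟨Γ, _, b, c, h1, h2, h3⟩ := exists_presheaf_coordinates hψ hV
  intro W hW hyW e he
  have h4 : ∀ γ, ∃ g : Γ(Y, V), ∀ y, Y.presheaf.map (homOfLE (hW y)).op g = c (W y) (hW y) γ (e y) := by
    intro γ
    obtain ⟨g, hg, -⟩ := Y.sheaf.existsUnique_gluing' W V (fun y ↦ homOfLE (hW y))
      (fun y hy ↦ Opens.mem_iSup.2 ⟨⟨y, hy⟩, hyW _⟩) (fun y ↦ c (W y) (hW y) γ (e y)) (by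
        intro y z
        refine (h3 _ _ _ inf_le_left γ _).trans (Eq.trans ?_ (h3 _ _ _ inf_le_right γ _).symm)
        rw [he])
    exact ⟨g, hg⟩
  choose g hg using h4
  refine ⟨∑ γ, ψ V (g γ) * b V le_rfl γ, fun y ↦ ?_⟩
  rw [h1 _ (hW y) (e y), map_sum]
  refine Finset.sum_congr rfl fun γ _ ↦ ?_
  rw [map_mul, hψ, hg, h2]

lemma exists_pow_mul_eq_zero_of_weylOver (hA : IsAffineOpen V) (f : Γ(Y, V)) (e : P.obj (op V))
    (he : P.map (homOfLE (Y.basicOpen_le f)).op e = 0) : ∃ n : ℕ, ψ V f ^ n * e = 0 := by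
  obtain ⟨Γ, _, b, c, h1, h2, h3⟩ := exists_presheaf_coordinates hψ hV
  have := hA.isLocalization_basicOpen f
  -- Additivity of the coordinates is not recorded, so those of `e` are compared with those of `0`
  -- instead of being shown to vanish.
  have h4 : ∀ γ, ∃ n : ℕ, f ^ n * c V le_rfl γ e = c V le_rfl γ 0 * f ^ n := by
    intro γ
    have h5 : Y.presheaf.map (homOfLE (Y.basicOpen_le f)).op (c V le_rfl γ e) =
        Y.presheaf.map (homOfLE (Y.basicOpen_le f)).op (c V le_rfl γ 0) := by
      rw [h3, h3, he, map_zero]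
    obtain ⟨⟨_, n, rfl⟩, hn⟩ := (IsLocalization.eq_iff_exists (Submonoid.powers f)
      Γ(Y, Y.basicOpen f)).1 h5
    exact ⟨n, hn.trans (mul_comm _ _)⟩
  choose n hn using h4
  refine ⟨∑ γ, n γ, ?_⟩
  have h0 : (0 : P.obj (op V)) = ψ V f ^ (∑ γ, n γ) * 0 := by rw [mul_zero]
  rw [h0, h1 V le_rfl e, h1 V le_rfl 0, Finset.mul_sum, Finset.mul_sum]
  refine Finset.sum_congr rfl fun γ _ ↦ ?_
  have h6 : (∑ γ, n γ) = (∑ γ, n γ - n γ) + n γ :=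
    (Nat.sub_add_cancel (Finset.single_le_sum (fun _ _ ↦ Nat.zero_le _) (Finset.mem_univ γ))).symm
  rw [h6, ← mul_assoc, ← mul_assoc, ← map_pow, ← map_mul, ← map_mul, pow_add, mul_assoc, hn,
    mul_assoc _ (f ^ n γ), mul_comm (f ^ n γ)]

lemma exists_eq_pow_mul_of_weylOver (hA : IsAffineOpen V) (f : Γ(Y, V))
    (e : P.obj (op (Y.basicOpen f))) : ∃ (n : ℕ) (a : P.obj (op V)),
      P.map (homOfLE (Y.basicOpen_le f)).op a =
        P.map (homOfLE (Y.basicOpen_le f)).op (ψ V f) ^ n * e := by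
  obtain ⟨Γ, _, b, c, h1, h2, h3⟩ := exists_presheaf_coordinates hψ hV
  have := hA.isLocalization_basicOpen f
  have h4 : ∀ γ, ∃ (n : ℕ) (g : Γ(Y, V)), Y.presheaf.map (homOfLE (Y.basicOpen_le f)).op g =
      Y.presheaf.map (homOfLE (Y.basicOpen_le f)).op f ^ n * c _ (Y.basicOpen_le f) γ e := by
    intro γ
    obtain ⟨⟨g, ⟨_, n, rfl⟩⟩, hg⟩ := IsLocalization.surj (Submonoid.powers f)
      (c _ (Y.basicOpen_le f) γ e)
    refine ⟨n, g, hg.symm.trans ((mul_comm _ _).trans ?_)⟩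
    congr 1
    exact map_pow (Y.presheaf.map (homOfLE (Y.basicOpen_le f)).op).hom f n
  choose n g hg using h4
  -- The sum of the exponents serves as a common denominator; each numerator is multiplied by the
  -- missing power of `f`.
  refine ⟨∑ γ, n γ, ∑ γ, ψ V (f ^ (∑ γ, n γ - n γ) * g γ) * b V le_rfl γ, ?_⟩
  rw [map_sum]
  conv_rhs => rw [h1 _ (Y.basicOpen_le f) e]
  rw [Finset.mul_sum]
  refine Finset.sum_congr rfl fun γ _ ↦ ?_
  have h6 : (∑ γ, n γ) = (∑ γ, n γ - n γ) + n γ :=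
    (Nat.sub_add_cancel (Finset.single_le_sum (fun _ _ ↦ Nat.zero_le _) (Finset.mem_univ γ))).symm
  rw [map_mul, hψ, hψ, h2, ← mul_assoc, ← map_pow, ← map_mul, map_mul, hg]
  congr 2
  rw [← mul_assoc, map_pow, ← pow_add, ← h6]

end WeylPresheaf

lemma isAzumayaAlgebra_of_weylOver {p : ℕ} [Fact p.Prime] {Y : Scheme.{u}}
    {𝒜 : TopCat.Sheaf RingCat.{u} Y} {ψ : Y.ringCatSheaf ⟶ 𝒜}
    (hc : ∀ (W : Y.Opens) (f : Γ(Y, W)) (a : 𝒜.presheaf.obj (op W)),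
      structureMap ψ W f * a = a * structureMap ψ W f)
    (h : ∀ y : Y, ∃ V : Y.Opens, y ∈ V ∧ IsAffineOpen V ∧
      ∃ (ι : Type) (_ : Finite ι) (x d : ι → 𝒜.presheaf.obj (op V)),
      ∀ (W : Y.Opens) (h : W ≤ V), WeylOver p (structureMap ψ W)
        (fun i ↦ 𝒜.presheaf.map (homOfLE h).op (x i))
        (fun i ↦ 𝒜.presheaf.map (homOfLE h).op (d i))) : IsAzumayaAlgebra ψ where
  central := hc
  exists_affine y := by
    obtain ⟨V, hy, hV, ι, _, x, d, h⟩ := h y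
    have hψ : ∀ (V W : Y.Opens) (h : W ≤ V) (f : Γ(Y, V)), 𝒜.presheaf.map (homOfLE h).op
        (structureMap ψ V f) = structureMap ψ W (Y.presheaf.map (homOfLE h).op f) :=
      fun V W h f ↦ (ConcreteCategory.congr_hom (ψ.hom.naturality (homOfLE h).op) f).symm
    refine ⟨V, hy, hV, fun f ↦ ⟨exists_pow_mul_eq_zero_of_weylOver hψ h hV f,
      exists_eq_pow_mul_of_weylOver hψ h hV f⟩, ?_⟩
    let _ : Algebra Γ(Y, V) (𝒜.presheaf.obj (op V)) := (structureMap ψ V).toAlgebra' (hc V)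
    exact WeylOver.isAzumaya (h V le_rfl)


namespace CentralTensor

variable {S B E : Type u} [CommRing S] [CommRing B] [Ring E] {φ : S →+* B} {ψ : S →+* E}
  {hψ : ∀ s e, Commute (ψ s) e}

lemma inr_bijective (hφ : Function.Bijective φ) : Function.Bijective (inr φ ψ hψ) := by
  let φ' := RingEquiv.ofBijective φ hφ
  have h1 : ∀ s, φ'.symm (φ s) = s := φ'.symm_apply_apply
  let r : CentralTensor φ ψ hψ →+* E := lift hψ (ψ.comp (φ'.symm : B →+* S)) (RingHom.id E)
    (fun b e ↦ hψ _ e) (fun s ↦ congrArg ψ (h1 s))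
  have h2 : ∀ e, r (inr φ ψ hψ e) = e := fun e ↦ lift_inr _ _ _ _ _ _ _ e
  refine ⟨Function.LeftInverse.injective h2, fun t ↦ ?_⟩
  refine induction (P := fun t ↦ ∃ e, inr φ ψ hψ e = t) (fun b e ↦ ?_) ?_ t
  · obtain ⟨s, rfl⟩ := hφ.2 b
    exact ⟨ψ s * e, by rw [map_mul, inl_inr]⟩
  · rintro _ _ ⟨e, rfl⟩ ⟨e', rfl⟩
    exact ⟨e + e', map_add _ _ _⟩

end CentralTensor

/-! ### The Azumaya algebra on the twisted cotangent bundle -/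

section Azumaya

variable {k : Type u} [Field k] {X : Scheme.{u}} (s : X ⟶ Spec (.of k)) [Smooth s]
  (p : ℕ) [Fact p.Prime] [CharP k p] [PerfectRing k p]

lemma isOpenMap_cotangentTwistProj : IsOpenMap (cotangentTwistProj p s) :=
  isOpenMap_cotangentProj s p

lemma cotangentTwistProj_surjective : Function.Surjective (cotangentTwistProj p s) :=
  cotangentProj_surjective s

variable {s p}

/-- The image of an open subset of the cotangent bundle. -/
def twistImage (W : (cotangentTwist p s).left.Opens) : X.Opens :=
  ⟨cotangentTwistProj p s '' W, isOpenMap_cotangentTwistProj s p _ W.2⟩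

lemma le_preimage_twistImage (W : (cotangentTwist p s).left.Opens) :
    W ≤ cotangentTwistProj p s ⁻¹ᵁ twistImage W :=
  fun y hy ↦ ⟨y, hy, rfl⟩

lemma twistImage_mono {W W' : (cotangentTwist p s).left.Opens} (h : W' ≤ W) :
    twistImage W' ≤ twistImage W :=
  Set.image_mono h

lemma twistImage_preimage (U : X.Opens) :
    twistImage (cotangentTwistProj p s ⁻¹ᵁ U) = U :=
  Opens.ext (Set.image_preimage_eq _ (cotangentTwistProj_surjective s p))

/-- The restriction of functions from the preimage of the image. -/
def twistRes (W : (cotangentTwist p s).left.Opens) :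
    Γ((cotangentTwist p s).left, cotangentTwistProj p s ⁻¹ᵁ twistImage W) →+*
      Γ((cotangentTwist p s).left, W) :=
  ((cotangentTwist p s).left.presheaf.map (homOfLE (le_preimage_twistImage W)).op).hom

variable (s p) in
/-- The sections on `W` of the presheaf inverse image of the sheaf of differential operators. -/
abbrev AzumayaSections (W : (cotangentTwist p s).left.Opens) : Type u :=
  CentralTensor (twistRes W) (onSections (frobeniusHom s p) (twistImage W))
    (commute_onSections_frobeniusHom (twistImage W))

/-- Restriction of sections. -/
def azumayaRes {W W' : (cotangentTwist p s).left.Opens} (h : W' ≤ W) :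
    AzumayaSections s p W →+* AzumayaSections s p W' :=
  CentralTensor.lift _
    ((CentralTensor.inl _ _ _).comp ((cotangentTwist p s).left.presheaf.map (homOfLE h).op).hom)
    ((CentralTensor.inr _ _ _).comp
      ((diffOp s).presheaf.map (homOfLE (twistImage_mono h)).op).hom)
    (fun b r ↦ CentralTensor.commute _ _ _ _ r)
    (fun f ↦ by
      have h1 : (cotangentTwist p s).left.presheaf.map (homOfLE h).op (twistRes W f) =
          twistRes W' ((cotangentTwist p s).left.presheaf.map (homOfLE
            ((cotangentTwistProj p s).preimage_mono (twistImage_mono h))).op f) :=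
        (res_res _ _ f).trans (res_res _ _ f).symm
      refine (congrArg (CentralTensor.inl _ _ _) h1).trans ?_
      refine (CentralTensor.inl_inr _ _ _ _).trans ?_
      exact congrArg (CentralTensor.inr _ _ _) (onSections_res (twistImage_mono h) f).symm)

lemma azumayaRes_inl {W W' : (cotangentTwist p s).left.Opens} (h : W' ≤ W)
    (f : Γ((cotangentTwist p s).left, W)) :
    azumayaRes h (CentralTensor.inl (twistRes W) (onSections (frobeniusHom s p) (twistImage W))
      (commute_onSections_frobeniusHom (twistImage W)) f) =
      CentralTensor.inl _ _ _ ((cotangentTwist p s).left.presheaf.map (homOfLE h).op f) :=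
  CentralTensor.lift_inl _ _ _ _ _ _ _ f

lemma azumayaRes_inr {W W' : (cotangentTwist p s).left.Opens} (h : W' ≤ W)
    (e : (diffOp s).presheaf.obj (op (twistImage W))) :
    azumayaRes h (CentralTensor.inr (twistRes W) (onSections (frobeniusHom s p) (twistImage W))
      (commute_onSections_frobeniusHom (twistImage W)) e) =
      CentralTensor.inr _ _ _ ((diffOp s).presheaf.map (homOfLE (twistImage_mono h)).op e) :=
  CentralTensor.lift_inr _ _ _ _ _ _ _ e

variable (s p) in
/-- The presheaf inverse image of the sheaf of differential operators, on the twisted cotangent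
bundle. -/
def azumayaPresheaf : TopCat.Presheaf RingCat.{u} (cotangentTwist p s).left where
  obj W := .of (AzumayaSections s p W.unop)
  map i := RingCat.ofHom (azumayaRes i.unop.le)
  map_id W := by
    ext1
    refine CentralTensor.hom_ext (hψ := commute_onSections_frobeniusHom _) (fun f ↦ ?_) fun e ↦ ?_
    · refine (azumayaRes_inl le_rfl f).trans (congrArg (CentralTensor.inl _ _ _) ?_)
      exact ConcreteCategory.congr_hom ((cotangentTwist p s).left.presheaf.map_id _) f
    · refine (azumayaRes_inr le_rfl e).trans (congrArg (CentralTensor.inr _ _ _) ?_)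
      exact ConcreteCategory.congr_hom ((diffOp s).presheaf.map_id _) e
  map_comp i j := by
    ext1
    refine CentralTensor.hom_ext (hψ := commute_onSections_frobeniusHom _) (fun f ↦ ?_) fun e ↦ ?_
    · refine (azumayaRes_inl _ f).trans (Eq.trans ?_ (congrArg (azumayaRes j.unop.le)
        (azumayaRes_inl i.unop.le f)).symm)
      refine Eq.trans (congrArg (CentralTensor.inl _ _ _) ?_) (azumayaRes_inl _ _).symm
      exact (res_res _ _ f).symm
    · refine (azumayaRes_inr _ e).trans (Eq.trans ?_ (congrArg (azumayaRes j.unop.le)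
        (azumayaRes_inr i.unop.le e)).symm)
      refine Eq.trans (congrArg (CentralTensor.inr _ _ _) ?_) (azumayaRes_inr _ _).symm
      exact (presheaf_res_res _ _ e).symm

variable (s p) in
/-- The differential operators as a sheaf of algebras on the twisted cotangent bundle. -/
def azumayaSheaf : TopCat.Sheaf RingCat.{u} (cotangentTwist p s).left :=
  ringSheafify (azumayaPresheaf s p)

/-- Functions on the twisted cotangent bundle as sections of the presheaf. -/
def azumayaInl (W : (cotangentTwist p s).left.Opens) :
    Γ((cotangentTwist p s).left, W) →+* (azumayaPresheaf s p).obj (op W) :=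
  CentralTensor.inl (twistRes W) (onSections (frobeniusHom s p) (twistImage W))
      (commute_onSections_frobeniusHom (twistImage W))

/-- Differential operators as sections of the presheaf. -/
def azumayaInr (W : (cotangentTwist p s).left.Opens) :
    (diffOp s).presheaf.obj (op (twistImage W)) →+* (azumayaPresheaf s p).obj (op W) :=
  CentralTensor.inr (twistRes W) (onSections (frobeniusHom s p) (twistImage W))
      (commute_onSections_frobeniusHom (twistImage W))

lemma azumayaInl_res {W W' : (cotangentTwist p s).left.Opens} (h : W' ≤ W)
    (f : Γ((cotangentTwist p s).left, W)) :
    (azumayaPresheaf s p).map (homOfLE h).op (azumayaInl W f) =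
      azumayaInl W' ((cotangentTwist p s).left.presheaf.map (homOfLE h).op f) :=
  azumayaRes_inl h f

lemma azumayaInr_res {W W' : (cotangentTwist p s).left.Opens} (h : W' ≤ W)
    (e : (diffOp s).presheaf.obj (op (twistImage W))) :
    (azumayaPresheaf s p).map (homOfLE h).op (azumayaInr W e) =
      azumayaInr W' ((diffOp s).presheaf.map (homOfLE (twistImage_mono h)).op e) :=
  azumayaRes_inr h e

lemma weylOver_azumayaInl (c : Chart s p) {W : (cotangentTwist p s).left.Opens}
    (hW : twistImage W ≤ c.opens) : WeylOver p (azumayaInl W)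
      (fun i ↦ azumayaInr W (funOp s _ (X.presheaf.map (homOfLE hW).op (c.x i))))
      (fun i ↦ azumayaInr W (vecOp s _ (VectorField.restrict hW (c.d i)))) :=
  (weylOver_onSections c hW).centralTensor (twistRes W)

lemma weylOver_azumayaInl_res (c : Chart s p) {W : (cotangentTwist p s).left.Opens}
    (hW : twistImage W ≤ c.opens) {W' : (cotangentTwist p s).left.Opens} (h : W' ≤ W) :
    WeylOver p (azumayaInl W')
      (fun i ↦ (azumayaPresheaf s p).map (homOfLE h).op
        (azumayaInr W (funOp s _ (X.presheaf.map (homOfLE hW).op (c.x i)))))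
      (fun i ↦ (azumayaPresheaf s p).map (homOfLE h).op
        (azumayaInr W (vecOp s _ (VectorField.restrict hW (c.d i))))) := by
  have h1 := weylOver_azumayaInl c ((twistImage_mono h).trans hW)
  simp only [azumayaInr_res, funOp_chart_res c hW (twistImage_mono h),
    vecOp_chart_res c hW (twistImage_mono h)]
  exact h1

/-- Weyl relations over the center persist under the base change defining the presheaf, and over a
chart they make it separated and glue. No sections are added by sheafification there. -/
lemma ringSheafifyMap_azumayaPresheaf_bijective (c : Chart s p)
    {W : (cotangentTwist p s).left.Opens} (hW : twistImage W ≤ c.opens) :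
    Function.Bijective (ringSheafifyMap (azumayaPresheaf s p) W) :=
  ringSheafifyMap_bijective
    (fun W' h ↦ isSeparatedAt_of_weylOver (ψ := azumayaInl) (fun _ _ h f ↦ azumayaInl_res h f)
      fun _ h' ↦ weylOver_azumayaInl_res c ((twistImage_mono h).trans hW) h')
    (gluesAt_of_weylOver (ψ := azumayaInl) (fun _ _ h f ↦ azumayaInl_res h f)
      fun _ h' ↦ weylOver_azumayaInl_res c hW h')

variable (s p) in
/-- The structure map of the sheaf of algebras. -/
def azumayaStructure : (cotangentTwist p s).left.ringCatSheaf ⟶ azumayaSheaf s p :=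
  ⟨{ app := fun W ↦ RingCat.ofHom ((ringSheafifyMap (azumayaPresheaf s p) W.unop).comp
      (azumayaInl W.unop))
     naturality := fun W W' i ↦ by
      ext f
      refine Eq.trans ?_ (ringSheafifyMap_res i.unop.le (azumayaInl W.unop f)).symm
      exact congrArg (ringSheafifyMap (azumayaPresheaf s p) W'.unop) (azumayaInl_res i.unop.le f).symm }⟩

lemma weylOver_azumayaStructure (c : Chart s p) {W : (cotangentTwist p s).left.Opens}
    (hW : twistImage W ≤ c.opens) {W' : (cotangentTwist p s).left.Opens} (h : W' ≤ W) :
    WeylOver p (structureMap (azumayaStructure s p) W')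
      (fun i ↦ (azumayaSheaf s p).presheaf.map (homOfLE h).op
        (ringSheafifyMap (azumayaPresheaf s p) W
        (azumayaInr W (funOp s _ (X.presheaf.map (homOfLE hW).op (c.x i))))))
      (fun i ↦ (azumayaSheaf s p).presheaf.map (homOfLE h).op
        (ringSheafifyMap (azumayaPresheaf s p) W
        (azumayaInr W (vecOp s _ (VectorField.restrict hW (c.d i)))))) := by
  have h1 := (weylOver_azumayaInl_res c hW h).map_bijective
    (ringSheafifyMap_azumayaPresheaf_bijective c ((twistImage_mono h).trans hW))
  simp only [← ringSheafifyMap_res] at h1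
  exact h1

lemma isAffineOpen_preimage (U : ChartOpen s p) : IsAffineOpen (cotangentTwistProj p s ⁻¹ᵁ U.1) := by
  have : IsAffineOpen (cotangentProj s ⁻¹ᵁ U.1) := by
    have h := opensRange_cotangentChart s U.site
    exact h ▸ isAffineOpen_opensRange _
  exact this

/-- Over a general `W` a section comes from the tensor products only locally, where centrality is
clear. -/
lemma structureMap_azumayaStructure_central (W : (cotangentTwist p s).left.Opens)
    (f : Γ((cotangentTwist p s).left, W)) (a : (azumayaSheaf s p).presheaf.obj (op W)) :
    structureMap (azumayaStructure s p) W f * a = a * structureMap (azumayaStructure s p) W f := by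
  refine sheaf_eq_of_locally_eq (azumayaSheaf s p) fun y hy ↦ ?_
  obtain ⟨W', hW', hy', b, hb⟩ := exists_ringSheafifyMap_eq_res a y hy
  refine ⟨W', hW', hy', ?_⟩
  have h1 : (azumayaSheaf s p).presheaf.map (homOfLE hW').op
      (structureMap (azumayaStructure s p) W f) = ringSheafifyMap (azumayaPresheaf s p) W'
        (azumayaInl W' ((cotangentTwist p s).left.presheaf.map (homOfLE hW').op f)) :=
    (ConcreteCategory.congr_hom ((azumayaStructure s p).hom.naturality (homOfLE hW').op) f).symm
  have hb' : (azumayaSheaf s p).presheaf.map (homOfLE hW').op a =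
    ringSheafifyMap (azumayaPresheaf s p) W' b := hb.symm
  rw [map_mul, map_mul, h1, hb']
  exact Commute.map (f := ringSheafifyMap (azumayaPresheaf s p) W') (CentralTensor.commute _ _ _ _ b)

lemma isAzumayaAlgebra_azumayaStructure : IsAzumayaAlgebra (azumayaStructure s p) := by
  refine isAzumayaAlgebra_of_weylOver (p := p) structureMap_azumayaStructure_central fun y ↦ ?_
  obtain ⟨U, hy, -⟩ := exists_chartOpen' (s := s) (p := p) (V := ⊤) (x := cotangentTwistProj p s y) trivial
  obtain ⟨c, hc⟩ := U.2.2
  refine ⟨_, hy, isAffineOpen_preimage U, c.ι, inferInstance, _, _, fun W h ↦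
    weylOver_azumayaStructure c ((twistImage_preimage U.1).le.trans hc) h⟩

variable (s p) in
/-- The map from the differential operators to the direct image of the sheaf of algebras. -/
def diffOpToAzumaya : diffOp s ⟶
    (TopCat.Sheaf.pushforward RingCat.{u} (cotangentTwistProj p s).base).obj (azumayaSheaf s p) :=
  ⟨{ app := fun U ↦ RingCat.ofHom (((ringSheafifyMap (azumayaPresheaf s p) _).comp
      (azumayaInr (cotangentTwistProj p s ⁻¹ᵁ U.unop))).comp
        ((diffOp s).presheaf.map (homOfLE (twistImage_preimage U.unop).le).op).hom)
     naturality := fun U V i ↦ by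
      ext e
      have hVU := i.unop.le
      have h := (cotangentTwistProj p s).preimage_mono hVU
      refine Eq.trans ?_ (ringSheafifyMap_res h (azumayaInr _ _)).symm
      refine congrArg (ringSheafifyMap (azumayaPresheaf s p) _) ?_
      refine Eq.trans ?_ (azumayaInr_res h _).symm
      refine congrArg (azumayaInr _) ?_
      exact (presheaf_res_res hVU _ e).trans (presheaf_res_res _ _ e).symm }⟩

lemma diffOpToAzumaya_app (U : X.Opens) (e : (diffOp s).presheaf.obj (op U)) :
    (diffOpToAzumaya s p).hom.app (op U) e = ringSheafifyMap (azumayaPresheaf s p) _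
      (azumayaInr (cotangentTwistProj p s ⁻¹ᵁ U)
        ((diffOp s).presheaf.map (homOfLE (twistImage_preimage U).le).op e)) := rfl

lemma presheaf_map_bijective {C : TopCat.{u}} (P : TopCat.Presheaf RingCat.{u} C) {V W : Opens C}
    (h : W = V) : Function.Bijective (P.map (homOfLE h.le).op) := by
  subst h
  have : P.map (homOfLE (le_refl W)).op = 𝟙 _ := P.map_id _
  rw [this]
  exact Function.bijective_id

lemma twistRes_preimage_bijective (U : X.Opens) :
    Function.Bijective (twistRes (cotangentTwistProj p s ⁻¹ᵁ U)) := by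
  have h : cotangentTwistProj p s ⁻¹ᵁ U = cotangentTwistProj p s ⁻¹ᵁ
    twistImage (cotangentTwistProj p s ⁻¹ᵁ U) := by rw [twistImage_preimage]
  exact presheaf_map_bijective ((cotangentTwist p s).left.ringCatSheaf.presheaf) h

/-- For `W = π⁻¹ U` the image of `W` is `U` by surjectivity of `π`, so the tensor product is taken
along an isomorphism and returns `𝒟(U)`. -/
lemma diffOpToAzumaya_app_bijective (U : ChartOpen s p) :
    Function.Bijective ((diffOpToAzumaya s p).hom.app (op U.1)) := by
  obtain ⟨c, hc⟩ := U.2.2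
  exact ((ringSheafifyMap_azumayaPresheaf_bijective c ((twistImage_preimage U.1).le.trans hc)).comp
    (CentralTensor.inr_bijective (twistRes_preimage_bijective U.1))).comp
      (presheaf_map_bijective (diffOp s).presheaf (twistImage_preimage U.1))

instance : IsIso (diffOpToAzumaya s p) := by
  refine TopCat.Sheaf.isIso_iff_isIso_basis (isBasis_chartOpen s p) fun U ↦ ?_
  rw [ConcreteCategory.isIso_iff_bijective]
  exact diffOpToAzumaya_app_bijective U

lemma pushforward_azumayaStructure :
    (TopCat.Sheaf.pushforward RingCat.{u} (cotangentTwistProj p s).base).map (azumayaStructure s p) =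
      frobeniusHom s p ≫ diffOpToAzumaya s p := by
  apply Sheaf.hom_ext
  ext U f
  refine Eq.trans ?_ (diffOpToAzumaya_app U.unop (onSections (frobeniusHom s p) U.unop f)).symm
  refine congrArg (ringSheafifyMap (azumayaPresheaf s p) (cotangentTwistProj p s ⁻¹ᵁ U.unop)) ?_
  have h1 := onSections_res (θ := frobeniusHom s p) (twistImage_preimage (s := s) (p := p) U.unop).le f
  refine Eq.trans ?_ (congrArg (azumayaInr (s := s) (p := p) (cotangentTwistProj p s ⁻¹ᵁ U.unop)) h1).symm
  refine Eq.trans (congrArg (azumayaInl (s := s) (p := p) (cotangentTwistProj p s ⁻¹ᵁ U.unop)) ?_) (CentralTensor.inl_inr _ _ _ _)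
  refine Eq.trans ?_ (res_res _ _ f).symm
  exact (ConcreteCategory.congr_hom ((cotangentTwist p s).left.presheaf.map_id _) f).symm

end Azumaya


/-! ### Endomorphisms of a framed bundle -/

section Frame

variable {Y : Scheme.{u}} {V : Y.Modules} {W : Y.Opens} {n : ℕ} {b : Fin n → Γ(V, W)}

lemma modules_res_res {W W' W'' : Y.Opens} (h : W' ≤ W) (h' : W'' ≤ W') (v : Γ(V, W)) :
    V.presheaf.map (homOfLE h').op (V.presheaf.map (homOfLE h).op v) =
      V.presheaf.map (homOfLE (h'.trans h)).op v := by
  rw [← ConcreteCategory.comp_apply, ← Functor.map_comp]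
  rfl

variable (hb : ∀ (W' : Y.Opens) (h : W' ≤ W) (v : Γ(V, W')), ∃! c : Fin n → Γ(Y, W'),
  v = ∑ i, c i • V.presheaf.map (homOfLE h).op (b i))

include hb

/-- If the ring of endomorphisms of a bundle with a frame is reduced, then the frame has at most one
element. -/
lemma le_one_of_isReduced_sheafEnd [Nontrivial Γ(Y, W)]
    (hr : ∀ φ : sheafEnd V W, φ ^ 2 = 0 → φ = 0) : n ≤ 1 := by
  by_contra! hn
  choose c hc hu using hb
  let i₀ : Fin n := ⟨0, by omega⟩
  let i₁ : Fin n := ⟨1, by omega⟩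
  have hi : i₁ ≠ i₀ := by simp [i₀, i₁]
  have hadd : ∀ W' h v w, c W' h (v + w) = c W' h v + c W' h w := fun W' h v w ↦
    (hu W' h (v + w) _ (by
      simp only [Pi.add_apply, add_smul, Finset.sum_add_distrib]
      rw [← hc, ← hc])).symm
  have hsmul : ∀ W' h (a : Γ(Y, W')) v, c W' h (a • v) = a • c W' h v := fun W' h a v ↦
    (hu W' h (a • v) _ (by
      simp only [Pi.smul_apply, smul_eq_mul, mul_smul]
      rw [← Finset.smul_sum, ← hc])).symm
  have hres : ∀ W' (h : W' ≤ W) W'' (h' : W'' ≤ W') v i, c W'' (h'.trans h)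
      (V.presheaf.map (homOfLE h').op v) i = Y.presheaf.map (homOfLE h').op (c W' h v i) :=
    fun W' h W'' h' v i ↦ (congrFun (hu W'' (h'.trans h) (V.presheaf.map (homOfLE h').op v)
      (fun i ↦ Y.presheaf.map (homOfLE h').op (c W' h v i)) (by
        refine (congrArg (V.presheaf.map (homOfLE h').op) (hc W' h v)).trans ?_
        rw [map_sum]
        refine Finset.sum_congr rfl fun i _ ↦ ?_
        rw [Scheme.Modules.map_smul, modules_res_res])) i).symm
  have hbasis : ∀ W' (h : W' ≤ W) i, c W' h (V.presheaf.map (homOfLE h).op (b i)) = Pi.single i 1 :=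
    fun W' h i ↦ (hu W' h _ _ (by simp [Pi.single_apply])).symm
  -- The elementary matrix that sends `b i₀` to `b i₁` and the other frame elements to `0`. Its
  -- square is zero, while its value at `b i₀` is not.
  let φ : sheafEnd V W := ⟨fun W' ↦
    { toFun := fun v ↦ c W'.1 W'.2 v i₀ • V.presheaf.map (homOfLE W'.2).op (b i₁)
      map_add' := fun v w ↦ by rw [hadd, Pi.add_apply, add_smul]
      map_smul' := fun a v ↦ by rw [hsmul, Pi.smul_apply, smul_eq_mul, mul_smul, RingHom.id_apply] },
    fun W₁ W₂ h v ↦ by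
      change V.presheaf.map (homOfLE h).op (c W₁.1 W₁.2 v i₀ • V.presheaf.map (homOfLE W₁.2).op (b i₁)) =
        c W₂.1 W₂.2 _ i₀ • V.presheaf.map (homOfLE W₂.2).op (b i₁)
      rw [Scheme.Modules.map_smul, modules_res_res, hres W₁.1 W₁.2]⟩
  have h0 : φ = 0 := hr φ (by
    refine Subtype.ext (funext fun W' ↦ LinearMap.ext fun v ↦ ?_)
    change c W'.1 W'.2 (c W'.1 W'.2 v i₀ • V.presheaf.map (homOfLE W'.2).op (b i₁)) i₀ •
      V.presheaf.map (homOfLE W'.2).op (b i₁) = 0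
    rw [hsmul, hbasis]
    simp [Pi.single_apply, hi.symm])
  have h1 : c W le_rfl (V.presheaf.map (homOfLE (le_refl W)).op (b i₀)) i₀ •
      V.presheaf.map (homOfLE (le_refl W)).op (b i₁) = 0 :=
    congrArg (fun φ : sheafEnd V W ↦ φ.1 ⟨W, le_rfl⟩ (V.presheaf.map (homOfLE (le_refl W)).op (b i₀))) h0
  rw [hbasis, Pi.single_eq_same, one_smul] at h1
  have h2 := congrFun (hbasis W le_rfl i₁) i₁
  have h3 := hsmul W le_rfl 0 0
  rw [h1, ← zero_smul Γ(Y, W) (0 : Γ(V, W)), h3] at h2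
  simp at h2

/-- The ring of endomorphisms of a bundle with a frame with at most one element is commutative. -/
lemma sheafEnd_mul_comm_of_le_one (hn : n ≤ 1) (φ χ : sheafEnd V W) : φ * χ = χ * φ := by
  have hs : Subsingleton (Fin n) := Fin.subsingleton_iff_le_one.2 hn
  refine Subtype.ext (funext fun W' ↦ LinearMap.ext fun v ↦ ?_)
  change φ.1 W' (χ.1 W' v) = χ.1 W' (φ.1 W' v)
  have h1 : ∀ (α : Module.End Γ(Y, W'.1) Γ(V, W'.1)) (i : Fin n), ∃ a : Γ(Y, W'.1),
      α (V.presheaf.map (homOfLE W'.2).op (b i)) = a • V.presheaf.map (homOfLE W'.2).op (b i) := by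
    intro α i
    obtain ⟨c, hc, -⟩ := hb W'.1 W'.2 (α (V.presheaf.map (homOfLE W'.2).op (b i)))
    refine ⟨c i, hc.trans ?_⟩
    rw [Finset.sum_eq_single i (fun j _ hj ↦ (hj (Subsingleton.elim _ _)).elim) (by simp)]
  obtain ⟨c, hc, -⟩ := hb W'.1 W'.2 v
  rw [hc]
  simp only [map_sum, map_smul]
  refine Finset.sum_congr rfl fun i _ ↦ ?_
  obtain ⟨x, hx⟩ := h1 (φ.1 W') i
  obtain ⟨y, hy⟩ := h1 (χ.1 W') i
  rw [hx, hy, map_smul, map_smul, hx, hy, smul_smul, smul_smul, smul_smul, smul_smul]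
  congr 1
  ring

end Frame

/-- Positive dimension gives two nested irreducible closed subsets; take their generic points. -/
lemma exists_specializes_ne {T : Type*} [TopologicalSpace T] [QuasiSober T]
    (h : 0 < topologicalKrullDim T) : ∃ x y : T, x ⤳ y ∧ x ≠ y := by
  obtain ⟨Z, Z', hZ⟩ := Order.krullDim_pos_iff.1 h
  obtain ⟨x, hx⟩ := QuasiSober.sober Z'.isIrreducible Z'.isClosed
  obtain ⟨y, hy⟩ := QuasiSober.sober Z.isIrreducible Z.isClosed
  refine ⟨x, y, hx.specializes (hZ.le hy.mem), ?_⟩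
  rintro rfl
  exact hZ.ne (IrreducibleCloseds.ext (hy.symm.trans hx))

/-! ### Non-triviality in positive dimension -/

section Nontrivial

variable {k : Type u} [Field k] {X : Scheme.{u}} {s : X ⟶ Spec (.of k)} [Smooth s]
  {p : ℕ} [Fact p.Prime] [CharP k p] [PerfectRing k p]

/-- A chart without coordinates has a zero-dimensional ring, in which all primes are maximal, and so
has no proper specializations. -/
lemma Chart.nonempty_of_specializes (c : Chart s p) {x y : X} (h : x ⤳ y) (hxy : x ≠ y)
    (hy : y ∈ c.opens) : Nonempty c.ι := by
  by_contra hι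
  have := c.krullDimLE (not_nonempty_iff.1 hι)
  have hx : x ∈ c.opens := h.mem_open c.opens.2 hy
  have hr := c.isAffineOpen.range_fromSpec
  obtain ⟨q, rfl⟩ : x ∈ Set.range c.isAffineOpen.fromSpec := hr ▸ hx
  obtain ⟨q', rfl⟩ : y ∈ Set.range c.isAffineOpen.fromSpec := hr ▸ hy
  have h1 : q ⤳ q' := (c.isAffineOpen.fromSpec.isOpenEmbedding.isInducing.specializes_iff).1 h
  have h2 := (PrimeSpectrum.le_iff_specializes q q').2 h1
  have h3 : q.asIdeal.IsMaximal := Ideal.IsPrime.isMaximal' q.2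
  refine hxy (congrArg _ (PrimeSpectrum.ext (h3.eq_of_le q'.2.ne_top h2)))

lemma isReduced_azumayaSheaf (U : ChartOpen s p) :
    _root_.IsReduced ((azumayaSheaf s p).presheaf.obj (op (cotangentTwistProj p s ⁻¹ᵁ U.1))) := by
  obtain ⟨c, hc⟩ := U.2.2
  have h0 := isReduced_sections s U.1
  have h1 : _root_.IsReduced (Envelope Γ(X, U.1) (VectorField s U.1)) :=
    (c.coordinates U.1 hc).toLieCoordinates.isReduced
  let f : Envelope Γ(X, U.1) (VectorField s U.1) →+*
      (azumayaSheaf s p).presheaf.obj (op (cotangentTwistProj p s ⁻¹ᵁ U.1)) :=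
    ((diffOpToAzumaya s p).hom.app (op U.1)).hom.comp (ringSheafifyMap (diffOpPresheaf s) U.1)
  have hf : Function.Bijective f := (diffOpToAzumaya_app_bijective U).comp
    (toDiffOp_bijective c hc U.2.1.isCompact)
  exact isReduced_of_injective (RingEquiv.ofBijective f hf).symm (RingEquiv.injective _)

/-- Reducedness passes to a central localization: clear the denominator of `b`, kill the square of
the numerator by a power of `f`, and use that `W` has reduced sections. -/
lemma eq_zero_of_pow_two_eq_zero_of_isLocalization {Y : Scheme.{u}} {𝒜 : TopCat.Sheaf RingCat.{u} Y}
    {ψ : Y.ringCatSheaf ⟶ 𝒜} (hc : ∀ (W : Y.Opens) (f : Γ(Y, W)) (a : 𝒜.presheaf.obj (op W)),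
      structureMap ψ W f * a = a * structureMap ψ W f) {W : Y.Opens}
    [_root_.IsReduced (𝒜.presheaf.obj (op W))] (f : Γ(Y, W))
    (h1 : ∀ a : 𝒜.presheaf.obj (op W), 𝒜.presheaf.map (homOfLE (Y.basicOpen_le f)).op a = 0 →
        ∃ n : ℕ, structureMap ψ W f ^ n * a = 0)
    (h2 : ∀ b : 𝒜.presheaf.obj (op (Y.basicOpen f)), ∃ (n : ℕ) (a : 𝒜.presheaf.obj (op W)),
        𝒜.presheaf.map (homOfLE (Y.basicOpen_le f)).op a =
          𝒜.presheaf.map (homOfLE (Y.basicOpen_le f)).op (structureMap ψ W f) ^ n * b)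
    (b : 𝒜.presheaf.obj (op (Y.basicOpen f))) (hb : b ^ 2 = 0) : b = 0 := by
  let r := (𝒜.presheaf.map (homOfLE (Y.basicOpen_le f)).op).hom
  let t := structureMap ψ W f
  have hψ : r t = structureMap ψ _ (Y.presheaf.map (homOfLE (Y.basicOpen_le f)).op f) :=
    (ConcreteCategory.congr_hom (ψ.hom.naturality (homOfLE (Y.basicOpen_le f)).op) f).symm
  have hu : IsUnit (r t) := by
    rw [hψ]
    exact (RingedSpace.isUnit_res_basicOpen _ f).map _
  have ht : ∀ a, Commute t a := hc W f
  have ht' : ∀ a, Commute (r t) a := fun a ↦ by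
    rw [hψ]
    exact hc _ _ a
  obtain ⟨n, a, ha⟩ := h2 b
  have ha : r a = r t ^ n * b := ha
  obtain ⟨m, hm⟩ := h1 (a ^ 2) (by
    change r (a ^ 2) = 0
    rw [map_pow, ha, ((ht' b).pow_left n).mul_pow, hb, mul_zero])
  have h3 : t ^ m * a = 0 := by
    refine IsReduced.eq_zero _ ⟨2, ?_⟩
    rw [((ht a).pow_left m).mul_pow, pow_two (t ^ m), mul_assoc]
    exact (congrArg (t ^ m * ·) hm).trans (mul_zero _)
  have h4 : r t ^ m * (r t ^ n * b) = 0 := by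
    rw [← ha, ← map_pow, ← map_mul, h3, map_zero]
  exact (hu.pow n).mul_right_eq_zero.1 ((hu.pow m).mul_right_eq_zero.1 h4)

theorem not_isTrivialAzumaya_azumayaStructure (hX : 0 < topologicalKrullDim X) :
    ¬ IsTrivialAzumaya (azumayaStructure s p) := by
  rintro ⟨V, hV, e, he, -⟩
  obtain ⟨x₁, x₀, hx, hne⟩ := exists_specializes_ne hX
  obtain ⟨c, hc, -⟩ := exists_chart (s := s) (p := p) ⊤ x₀ trivial
  obtain ⟨i⟩ := c.nonempty_of_specializes hx hne hc
  let U : ChartOpen s p := ⟨c.opens, c.isAffineOpen, c, le_rfl⟩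
  let Y := (cotangentTwist p s).left
  let W₀ : Y.Opens := cotangentTwistProj p s ⁻¹ᵁ c.opens
  have hW₀ : IsAffineOpen W₀ := isAffineOpen_preimage U
  obtain ⟨y, rfl⟩ := cotangentTwistProj_surjective s p x₀
  have hy : y ∈ W₀ := hc
  obtain ⟨W, n, b, hyW, hb⟩ := hV y
  -- A basic open subset of the preimage of the chart is chosen inside the domain of the frame:
  -- reducedness is known over the preimage and passes to its localization `D`, where the frame is
  -- also available.
  obtain ⟨f, hfW, hyf⟩ := hW₀.exists_basicOpen_le ⟨y, hyW⟩ hy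
  let D := Y.basicOpen f
  have hDW : D ≤ W := hfW
  have hD : D ≤ W₀ := Y.basicOpen_le f
  have hw := fun W' h ↦ weylOver_azumayaStructure c (W := W₀) (twistImage_preimage c.opens).le
    (W' := W') h
  have hψ : ∀ (V W : Y.Opens) (h : W ≤ V) (f : Γ(Y, V)), (azumayaSheaf s p).presheaf.map (homOfLE h).op
        (structureMap (azumayaStructure s p) V f) =
      structureMap (azumayaStructure s p) W (Y.presheaf.map (homOfLE h).op f) :=
    fun V W h f ↦ (ConcreteCategory.congr_hom
      ((azumayaStructure s p).hom.naturality (homOfLE h).op) f).symm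
  have hred := isReduced_azumayaSheaf U
  have hred' : ∀ a : (azumayaSheaf s p).presheaf.obj (op D), a ^ 2 = 0 → a = 0 :=
    eq_zero_of_pow_two_eq_zero_of_isLocalization structureMap_azumayaStructure_central f
      (exists_pow_mul_eq_zero_of_weylOver hψ hw hW₀ f) (exists_eq_pow_mul_of_weylOver hψ hw hW₀ f)
  have : Nonempty D := ⟨⟨y, hyf⟩⟩
  have : Nontrivial Γ(Y, D) := inferInstance
  have hb' : ∀ (W' : Y.Opens) (h : W' ≤ D) (v : Γ(V, W')), ∃! c : Fin n → Γ(Y, W'),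
      v = ∑ i, c i • V.presheaf.map (homOfLE h).op (V.presheaf.map (homOfLE hDW).op (b i)) := by
    intro W' h v
    simp only [modules_res_res]
    exact hb W' (h.trans hDW) v
  have hn : n ≤ 1 := le_one_of_isReduced_sheafEnd hb' fun φ hφ ↦ by
    have := hred' ((e D).symm φ) (by rw [← map_pow, hφ, map_zero])
    simpa using this
  have hcomm := sheafEnd_mul_comm_of_le_one hb' hn
  have h1 := (hw D hD).rel_self i
  have h2 : ∀ a a' : (azumayaSheaf s p).presheaf.obj (op D), a * a' = a' * a := fun a a' ↦
    (e D).injective (by rw [map_mul, map_mul, hcomm])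
  -- In a commutative ring the relation `d i * x i = x i * d i + 1` gives `1 = 0`, and the structure
  -- map is injective.
  rw [h2, left_eq_add] at h1
  have h3 : (1 : Γ(Y, D)) = 0 := (hw D hD).inj ((map_one _).trans (h1.trans (map_zero _).symm))
  exact one_ne_zero h3

end Nontrivial

end CrystallineDiff

end

theorem theorem2p2p3 {k : Type u} [Field k] [IsAlgClosed k] (p : ℕ) [Fact p.Prime] [CharP k p]
    {X : Scheme.{u}} (s : X ⟶ Spec (.of k)) [Smooth s] [IsSeparated s] [QuasiCompact s] :
    ∃ θ : (TopCat.Sheaf.pushforward RingCat.{u}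
          (CrystallineDiff.cotangentTwistProj p s).base).obj
        (CrystallineDiff.cotangentTwist p s).left.ringCatSheaf ⟶ CrystallineDiff.diffOp s,
      CrystallineDiff.IsFrobeniusHom θ ∧
      CrystallineDiff.IsIsoToCenter θ ∧
      ∃ (𝒜 : TopCat.Sheaf RingCat.{u} (CrystallineDiff.cotangentTwist p s).left)
        (ψ : (CrystallineDiff.cotangentTwist p s).left.ringCatSheaf ⟶ 𝒜)
        (e : (TopCat.Sheaf.pushforward RingCat.{u}
          (CrystallineDiff.cotangentTwistProj p s).base).obj 𝒜 ≅ CrystallineDiff.diffOp s),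
        (TopCat.Sheaf.pushforward RingCat.{u}
          (CrystallineDiff.cotangentTwistProj p s).base).map ψ ≫ e.hom = θ ∧
        CrystallineDiff.IsAzumayaAlgebra ψ ∧
        (0 < topologicalKrullDim X → ¬ CrystallineDiff.IsTrivialAzumaya ψ) := by
  have : PerfectField k := inferInstance
  refine ⟨CrystallineDiff.frobeniusHom s p, CrystallineDiff.isFrobeniusHom_frobeniusHom,
    CrystallineDiff.isIsoToCenter_frobeniusHom, CrystallineDiff.azumayaSheaf s p,
    CrystallineDiff.azumayaStructure s p, (asIso (CrystallineDiff.diffOpToAzumaya s p)).symm, ?_,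
    CrystallineDiff.isAzumayaAlgebra_azumayaStructure,
    CrystallineDiff.not_isTrivialAzumaya_azumayaStructure⟩
  rw [CrystallineDiff.pushforward_azumayaStructure]
  simp
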